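/- **Proposition (Exterior trace of the double-layer potential).** Let $t_{\max}>0$ and let $c=c(x,t)$ be a smooth positive sound speed on $\mathbb R^3\times[0,t_{\max})$, with slowness $\kappa=1/c$. For $t\in[0,t_{\max})$ let $\Omega^-(t)\subset\mathbb R^3$ be a bounded domain whose boundary $\Gamma(t)$ is the image of an embedding $z(\cdot,t)$ of $\mathbb S^2$, where $z\in C^2(\mathbb S^2\times[0,t_{\max});\mathbb R^3)$. Put $\Omega^+(t)=\mathbb R^3\setminus\overline{\Omega^-(t)}$, let $N(\beta,\tau)$ be the unit normal to $\Gamma(\tau)$ at $z(\beta,\tau)$ pointing into $\Omega^+(\tau)$, $dS_y$ the surface element of $\Gamma(\tau)$, and $V_N=N\cdot\partial_tz$. Assume the subsonic condition $|V_N(\beta,t)|<c(z(\beta,t),t)$ on $\mathbb S^2\times[0,t_{\max})$. Let $\eta(x,t;y,\tau)\ge 0$ be a travel-time function. Precisely, for $0\le\tau\le t<t_{\max}$, with $r=|x-y|$: 1. $\eta$ is continuous, $\eta=0$ if and only if $x=y$, and $\eta$ is $C^2$ in $(x,t,y,\tau)$ where $x\ne y$ and $\tau<t$. 2. Near every point of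 the space-time diagonal $(x,t)=(y,\tau)$ one has $\eta(x,t;y,\tau)=\kappa(y,\tau)\,r+e(x,t;y,\tau)$, where for some constant $M$, locally uniformly on $\{x\neq y,\ \tau<t\}$, $$\bigl|D^{j}_{(y,\tau)}e\bigr|\;\le\; M\,r^{-j}\bigl(r^2+|t-\tau|\,r\bigr),\qquad j=0,1,2.$$ 3. (Non-degeneracy.) For every $(x,t)$ and $\beta$ the function $\tau\mapsto t-\tau-\eta(x,t;z(\beta,\tau),\tau)$ is strictly decreasing on $[0,t]$, with $1+\frac{d}{d\tau}\eta(x,t;z(\beta,\tau),\tau)>0$ whenever $\tau<t$, $x\neq z(\beta,\tau)$. The directional limits of this quantity on the diagonal are also positive: $1-\kappa(z(\beta,\tau),\tau)\,\partial_\tau z(\beta,\tau)\cdot\omega>0$ for all unit vectors $\omega$ and all $\tau\in[0,t_{\max})$. Let $\mathcal A(x,t;y,\tau)$ be an amplitude, smooth where $x\ne y$, $0\le\tau<t<t_{\max}$, normalized by $\mathcal A(y,\tau;y,\tau)=\kappa(y,\tau)$, continuous at the space-time diagonal (through events with $0\le\tau\le t$), and with first derivatives in $(y,\tau)$ that are bounded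 near each point of the diagonal. Let $\mu\in C^1(\mathbb S^2\times(-\infty,t_{\max}))$ be a causal density, i.e. $\mu(\cdot,\tau)=0$ for $\tau\le0$. With $\mathcal G_0(r,s)=\delta(s-r)/(4\pi r)$ define $$\mathcal D_{\mathsf{DL}}[\mu](x,t)=\int_{\mathbb S^2}\int_0^t \partial_{N_y}\Bigl[\mathcal A(x,t;z(\beta,\tau),\tau)\,\mathcal G_0\bigl(\eta(x,t;z(\beta,\tau),\tau),\,t-\tau\bigr)\Bigr]\,\mu(\beta,\tau)\,dS_y\,d\tau ,\qquad \partial_{N_y}=N(\beta,\tau)\cdot\nabla_y .$$ Here, for each $\beta$, the $\tau$-integral is the pairing with the distributions $\delta(\Phi)$, $\delta'(\Phi)$ of the phase $\Phi(\tau)=t-\tau-\eta(x,t;z(\beta,\tau),\tau)$, whose zeros are simple: $\int_0^t\delta(\Phi)f\,d\tau=\sum f/|\Phi'|$ and $\int_0^t\delta'(\Phi)f\,d\tau=-\sum\frac1{\Phi'}\frac{d}{d\tau}\bigl(\frac{f}{|\Phi'|}\bigr)$, with sums over the zeros of $\Phi$ in $(0,t)$. Then for every $(\alpha,t)\in\mathbb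 S^2\times(0,t_{\max})$ the following holds. For all small $\varepsilon>0$ the point $z(\alpha,t)+\varepsilon N(\alpha,t)$ lies in $\Omega^+(t)$ and the integral over $\mathbb S^2$ defining $\mathcal D_{\mathsf{DL}}[\mu]$ there converges absolutely. The principal value $$\mathcal D[\mu](\alpha,t)=\lim_{\rho\downarrow0}\int_{\{\beta\in\mathbb S^2:\,|\beta-\alpha|>\rho\}}\int_0^t\partial_{N_y}\Bigl[\mathcal A\,\mathcal G_0(\eta,t-\tau)\Bigr]_{x=z(\alpha,t)}\,\mu\,dS_y\,d\tau$$ exists, with absolutely convergent integrals over $\beta$ for each $\rho>0$. The exterior trace exists and satisfies $$\lim_{\varepsilon\downarrow0}\mathcal D_{\mathsf{DL}}[\mu]\bigl(z(\alpha,t)+\varepsilon N(\alpha,t),t\bigr)=\tfrac12\,\lambda(\alpha,t)\,\mu(\alpha,t)+\mathcal D[\mu](\alpha,t),$$ $$\lambda(\alpha,t)=1+\frac{V_N(\alpha,t)^2}{C(\alpha,t)^2-V_N(\alpha,t)^2},\qquad C(\alpha,t)=c(z(\alpha,t),t).$$ -/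

import Mathlib

open Set Filter Topology MeasureTheory
open scoped ContDiff RealInnerProductSpace

noncomputable section

/-- Physical space `ℝ³`. -/
abbrev E3 : Type := EuclideanSpace ℝ (Fin 3)

/-- The parameter sphere `𝕊²`. -/
abbrev S2 : Type := Metric.sphere (0 : E3) 1

/-- The surface measure of `𝕊²` (of total mass `4π`). -/
abbrev sphereMeasure : Measure S2 := (volume : Measure E3).toSphere

/-! ### Calculus on the parameter sphere -/

/-- The radial retraction `p ↦ p / |p|` of `ℝ³ ∖ {0}` onto `𝕊²` (arbitrary value at `0`). -/
def toS2 (p : E3) : S2 :=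
  if h : p = 0 then ⟨EuclideanSpace.single 0 1, by simp⟩
  else ⟨‖p‖⁻¹ • p, by
    rw [mem_sphere_zero_iff_norm, norm_smul, norm_inv, norm_norm,
      inv_mul_cancel₀ (norm_ne_zero_iff.mpr h)]⟩

/-- `f ∈ C^k(𝕊² × I)`: the extension of `f` that is constant along rays is `C^k` on
`(ℝ³ ∖ {0}) × I`. If `I` is half-open, derivatives at its endpoint are one-sided. -/
def ContDiffOnSphere {F : Type*} [NormedAddCommGroup F] [NormedSpace ℝ F]
    (k : ℕ∞) (f : S2 → ℝ → F) (I : Set ℝ) : Prop :=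
  ContDiffOn ℝ k (fun p : E3 × ℝ => f (toS2 p.1) p.2) ({0}ᶜ ×ˢ I)

/-- The cross product of `ℝ³`. -/
def cross (u v : E3) : E3 := WithLp.toLp 2 (crossProduct (WithLp.ofLp u) (WithLp.ofLp v))

/-! ### The moving surface -/

/-- `∂_k` (at `β`, at fixed time) of the extension of `z(·, τ)` constant along rays. -/
def dz (z : S2 → ℝ → E3) (β : S2) (τ : ℝ) (k : Fin 3) : E3 :=
  fderiv ℝ (fun p : E3 => z (toS2 p) τ) (β : E3) (EuclideanSpace.single k 1)

/-- The vector `∂_{e₁} z × ∂_{e₂} z` for an orthonormal basis `(e₁, e₂)` of the tangent plane of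
`𝕊²` at `β` with `e₁ × e₂ = β`. By bilinearity of the cross product and `e₁ × e₂ = β` it is the
following combination of the partial derivatives of the radially constant extension. -/
def areaVector (z : S2 → ℝ → E3) (β : S2) (τ : ℝ) : E3 :=
  (β : E3) 0 • cross (dz z β τ 1) (dz z β τ 2)
    + (β : E3) 1 • cross (dz z β τ 2) (dz z β τ 0)
    + (β : E3) 2 • cross (dz z β τ 0) (dz z β τ 1)

/-- The surface Jacobian `J`: the area element of `Γ(τ)` is `J(β, τ) dβ`, with `dβ` the surface
measure of `𝕊²`. -/
def surfJ (z : S2 → ℝ → E3) (β : S2) (τ : ℝ) : ℝ := ‖areaVector z β τ‖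

/-- The unit normal `N(β, τ)`; `σ = ±1` is the orientation of the parametrization. -/
def unitNormal (z : S2 → ℝ → E3) (σ : ℝ) (β : S2) (τ : ℝ) : E3 :=
  σ • (‖areaVector z β τ‖⁻¹ • areaVector z β τ)

/-- The velocity `∂_τ z(β, τ)` for `τ ≥ 0` (one-sided at `τ = 0`). -/
def velocity (z : S2 → ℝ → E3) (β : S2) (τ : ℝ) : E3 := derivWithin (z β) (Ici 0) τ

/-- The normal velocity `V_N = N · ∂_τ z`. -/
def normalVelocity (z : S2 → ℝ → E3) (σ : ℝ) (β : S2) (τ : ℝ) : ℝ :=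
  ⟪unitNormal z σ β τ, velocity z β τ⟫

/-- The exterior domain `Ω⁺(t)`. -/
def exterior (Ωm : ℝ → Set E3) (t : ℝ) : Set E3 := (closure (Ωm t))ᶜ

/-- On the time interval `[0, T)`, `z` is a `C²` parametrization, by embeddings of `𝕊²`, of the
boundaries `Γ(t)` of the bounded domains `Ω⁻(t)`, and the normal `N` (formed with the orientation
sign `σ`) points from `Ω⁻(t)` into `Ω⁺(t)`. -/
structure IsMovingObstacle (T : ℝ) (Ωm : ℝ → Set E3) (z : S2 → ℝ → E3) (σ : ℝ) : Prop where
  contDiff : ContDiffOnSphere 2 z (Ico 0 T)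
  isOpen : ∀ t ∈ Ico 0 T, IsOpen (Ωm t)
  isConnected : ∀ t ∈ Ico 0 T, IsConnected (Ωm t)
  isBounded : ∀ t ∈ Ico 0 T, Bornology.IsBounded (Ωm t)
  frontier_eq : ∀ t ∈ Ico 0 T, frontier (Ωm t) = range (fun β => z β t)
  injective : ∀ t ∈ Ico 0 T, Function.Injective (fun β => z β t)
  immersion : ∀ t ∈ Ico 0 T, ∀ β, areaVector z β t ≠ 0
  orientation : σ = 1 ∨ σ = -1
  outward : ∀ t ∈ Ico 0 T, ∀ β, ∀ᶠ ε in 𝓝[>] (0 : ℝ),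
    z β t + ε • unitNormal z σ β t ∈ exterior Ωm t ∧ z β t - ε • unitNormal z σ β t ∈ Ωm t

/-- The subsonic condition `|V_N| < c` along the moving surface. -/
def Subsonic (T : ℝ) (c : E3 → ℝ → ℝ) (z : S2 → ℝ → E3) (σ : ℝ) : Prop :=
  ∀ β, ∀ t ∈ Ico 0 T, |normalVelocity z σ β t| < c (z β t) t

/-! ### Sound speed, travel time and amplitude

Kernels depend on an observation event `(x, t)` and a source event `(y, τ)`, in the order
`x t y τ`; conditions are imposed only for `0 ≤ τ ≤ t < T`. -/

/-- A function of an observation event and a source event, as a function on pairs of events. -/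
def onEvents (f : E3 → ℝ → E3 → ℝ → ℝ) (p : (E3 × ℝ) × (E3 × ℝ)) : ℝ :=
  f p.1.1 p.1.2 p.2.1 p.2.2

/-- The pairs of events `((x, t), (y, τ))` with `0 ≤ τ ≤ t < T`. -/
def causalPairs (T : ℝ) : Set ((E3 × ℝ) × (E3 × ℝ)) :=
  {p | 0 ≤ p.2.2 ∧ p.2.2 ≤ p.1.2 ∧ p.1.2 < T}

/-- The pairs of events with `0 ≤ τ < t < T` and `x ≠ y`. -/
def properPairs (T : ℝ) : Set ((E3 × ℝ) × (E3 × ℝ)) :=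
  {p | 0 ≤ p.2.2 ∧ p.2.2 < p.1.2 ∧ p.1.2 < T ∧ p.1.1 ≠ p.2.1}

/-- A smooth positive sound speed. -/
structure IsSoundSpeed (T : ℝ) (c : E3 → ℝ → ℝ) : Prop where
  smooth : ∀ x, ∀ t ∈ Ico 0 T, ContDiffAt ℝ ∞ (fun q : E3 × ℝ => c q.1 q.2) (x, t)
  pos : ∀ x, ∀ t ∈ Ico 0 T, 0 < c x t

/-- The slowness `κ = 1 / c`. -/
def slowness (c : E3 → ℝ → ℝ) (y : E3) (τ : ℝ) : ℝ := 1 / c y τ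

/-- The remainder `η(x,t;y,τ) - κ(y,τ)|x - y|` of the diagonal expansion, as a function of the
source event `q = (y, τ)`. -/
def diagRemainder (c : E3 → ℝ → ℝ) (η : E3 → ℝ → E3 → ℝ → ℝ) (x : E3) (t : ℝ) (q : E3 × ℝ) : ℝ :=
  η x t q.1 q.2 - slowness c q.1 q.2 * ‖x - q.1‖

/-- The total derivative `d/dτ [η(x,t;z(β,τ),τ)] = ∂_τ η + ∂_τ z · ∇_y η`. -/
def totalDeriv (η : E3 → ℝ → E3 → ℝ → ℝ) (z : S2 → ℝ → E3) (x : E3) (t : ℝ) (β : S2) (τ : ℝ) : ℝ :=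
  fderiv ℝ (fun q : E3 × ℝ => η x t q.1 q.2) (z β τ, τ) (velocity z β τ, 1)

/-- `η` is a travel-time function for the sound speed `c` and the moving surface `z`, in the
canonical gauge `θ = t - τ`. -/
structure IsTravelTime (T : ℝ) (c : E3 → ℝ → ℝ) (z : S2 → ℝ → E3)
    (η : E3 → ℝ → E3 → ℝ → ℝ) : Prop where
  nonneg : ∀ x t y τ, 0 ≤ τ → τ ≤ t → t < T → 0 ≤ η x t y τ
  eq_zero_iff : ∀ x t y τ, 0 ≤ τ → τ ≤ t → t < T → (η x t y τ = 0 ↔ x = y)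
  continuousOn : ContinuousOn (onEvents η) (causalPairs T)
  contDiffAt : ∀ p ∈ properPairs T, ContDiffAt ℝ 2 (onEvents η) p
  /-- `η = κ(y,τ)|x-y| + O(r² + |t-τ| r)`, `r = |x-y|`, near each point of the space-time diagonal,
  where each derivative of the remainder in the source event, up to order two, costs one
  power of `r`. -/
  expansion : ∀ y₀ : E3, ∀ t₀ ∈ Ico 0 T, ∃ M : ℝ,
    ∀ᶠ p in 𝓝 (((y₀, t₀), (y₀, t₀)) : (E3 × ℝ) × (E3 × ℝ)), p ∈ properPairs T →
      ∀ j ≤ 2, ‖iteratedFDeriv ℝ j (diagRemainder c η p.1.1 p.1.2) p.2‖ * ‖p.1.1 - p.2.1‖ ^ j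
        ≤ M * (‖p.1.1 - p.2.1‖ ^ 2 + |p.1.2 - p.2.2| * ‖p.1.1 - p.2.1‖)
  /-- Non-degeneracy: the phase is strictly decreasing along each trajectory of the surface. -/
  strictAnti : ∀ x t β, 0 ≤ t → t < T →
    StrictAntiOn (fun τ => t - τ - η x t (z β τ) τ) (Icc 0 t)
  nondegenerate : ∀ x t β τ, 0 ≤ τ → τ < t → t < T → x ≠ z β τ → 0 < 1 + totalDeriv η z x t β τ
  /-- Non-degeneracy of the directional limits, as `(x, t) → (z(β,τ), τ)` with `x - z(β,τ)` in
  direction `e`, of the preceding quantity. -/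
  nondegenerate_diag : ∀ β, ∀ τ ∈ Ico 0 T, ∀ e : E3, ‖e‖ = 1 →
    0 < 1 - slowness c (z β τ) τ * ⟪velocity z β τ, e⟫

/-- `A` is an amplitude: smooth away from `x = y`, continuous at the space-time diagonal with
value `κ` there, and with bounded first derivatives in the source event near the diagonal. -/
structure IsAmplitude (T : ℝ) (c : E3 → ℝ → ℝ) (A : E3 → ℝ → E3 → ℝ → ℝ) : Prop where
  contDiffAt : ∀ p ∈ properPairs T, ContDiffAt ℝ ∞ (onEvents A) p
  diag : ∀ y, ∀ τ ∈ Ico 0 T, A y τ y τ = slowness c y τ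
  continuous_diag : ∀ y, ∀ τ ∈ Ico 0 T,
    ContinuousWithinAt (onEvents A) (causalPairs T) ((y, τ), (y, τ))
  deriv_bounded : ∀ y₀ : E3, ∀ t₀ ∈ Ico 0 T, ∃ M : ℝ,
    ∀ᶠ p in 𝓝 (((y₀, t₀), (y₀, t₀)) : (E3 × ℝ) × (E3 × ℝ)), p ∈ properPairs T →
      ‖fderiv ℝ (fun q : E3 × ℝ => A p.1.1 p.1.2 q.1 q.2) p.2‖ ≤ M

/-! ### The double-layer potential

For a phase `Φ` with simple zeros in `(0, t)`, the distributions `δ(Φ)` and `δ'(Φ)` act by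
`∫₀ᵗ δ(Φ) f = ∑ f / |Φ'|` and `∫₀ᵗ δ'(Φ) f = ∑ -(1/Φ') d/dτ (f / |Φ'|)`, with sums over the zeros. -/

/-- `∫₀ᵗ δ(Φ(τ)) f(τ) dτ`. -/
def deltaPair (t : ℝ) (Φ f : ℝ → ℝ) : ℝ :=
  ∑ᶠ τ ∈ {τ | τ ∈ Ioo 0 t ∧ Φ τ = 0}, f τ / |deriv Φ τ|

/-- `∫₀ᵗ δ'(Φ(τ)) f(τ) dτ`. -/
def deltaDerivPair (t : ℝ) (Φ f : ℝ → ℝ) : ℝ :=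
  ∑ᶠ τ ∈ {τ | τ ∈ Ioo 0 t ∧ Φ τ = 0}, -(deriv (fun s => f s / |deriv Φ s|) τ / deriv Φ τ)

/-- `∫₀ᵗ G₀(h(τ), t - τ) f(τ) dτ` with `G₀(r, s) = δ(s - r) / (4πr)`. -/
def greenPair (t : ℝ) (h f : ℝ → ℝ) : ℝ :=
  deltaPair t (fun τ => t - τ - h τ) (fun τ => f τ / (4 * Real.pi * h τ))

/-- `∫₀ᵗ ∂_r G₀(h(τ), t - τ) f(τ) dτ`, where
`∂_r G₀(r, s) = -δ'(s - r) / (4πr) - δ(s - r) / (4πr²)`. -/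
def greenDerivPair (t : ℝ) (h f : ℝ → ℝ) : ℝ :=
  -deltaDerivPair t (fun τ => t - τ - h τ) (fun τ => f τ / (4 * Real.pi * h τ))
    - deltaPair t (fun τ => t - τ - h τ) (fun τ => f τ / (4 * Real.pi * h τ ^ 2))

/-- The source normal derivative `N(β,τ) · ∇_y f(x,t;y,τ)` at `y = z(β,τ)`. -/
def sourceNormalDeriv (z : S2 → ℝ → E3) (σ : ℝ) (f : E3 → ℝ → E3 → ℝ → ℝ)
    (x : E3) (t : ℝ) (β : S2) (τ : ℝ) : ℝ :=
  fderiv ℝ (fun y => f x t y τ) (z β τ) (unitNormal z σ β τ)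

/-- The inner time integral of the double-layer potential,
`∫₀ᵗ ∂_{N_y} [A G₀(η, t - τ)] μ J dτ = ∫₀ᵗ (∂_{N_y}A G₀ + A ∂_r G₀ ∂_{N_y}η) μ J dτ`. -/
def doubleLayerDensity (z : S2 → ℝ → E3) (σ : ℝ) (η A : E3 → ℝ → E3 → ℝ → ℝ) (μ : S2 → ℝ → ℝ)
    (x : E3) (t : ℝ) (β : S2) : ℝ :=
  greenPair t (fun τ => η x t (z β τ) τ)
      (fun τ => sourceNormalDeriv z σ A x t β τ * μ β τ * surfJ z β τ)
    + greenDerivPair t (fun τ => η x t (z β τ) τ)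
      (fun τ => A x t (z β τ) τ * sourceNormalDeriv z σ η x t β τ * μ β τ * surfJ z β τ)

/-- The double-layer potential `𝒟[μ](x, t)`. -/
def doubleLayer (z : S2 → ℝ → E3) (σ : ℝ) (η A : E3 → ℝ → E3 → ℝ → ℝ) (μ : S2 → ℝ → ℝ)
    (x : E3) (t : ℝ) : ℝ :=
  ∫ β, doubleLayerDensity z σ η A μ x t β ∂sphereMeasure

/-- `D` is the principal value, with respect to the singularity at `(β, τ) = (α, t)`, of the
double-layer integral at the boundary point `x = z(α, t)`: the integrals over the complements of
the balls of radius `ρ` about `α` in `𝕊²` converge absolutely and tend to `D` as `ρ ↓ 0`. -/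
def IsPrincipalValue (z : S2 → ℝ → E3) (σ : ℝ) (η A : E3 → ℝ → E3 → ℝ → ℝ) (μ : S2 → ℝ → ℝ)
    (α : S2) (t D : ℝ) : Prop :=
  (∀ ρ > 0, IntegrableOn (doubleLayerDensity z σ η A μ (z α t) t) {β | ρ < dist β α}
    sphereMeasure) ∧
  Tendsto (fun ρ : ℝ => ∫ β in {β | ρ < dist β α},
    doubleLayerDensity z σ η A μ (z α t) t β ∂sphereMeasure) (𝓝[>] 0) (𝓝 D)

/-- A causal `C¹` density: it vanishes for nonpositive times. -/
structure IsCausalDensity (T : ℝ) (μ : S2 → ℝ → ℝ) : Prop where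
  contDiff : ContDiffOnSphere 1 μ (Iio T)
  causal : ∀ β τ, τ ≤ 0 → μ β τ = 0

/-- The coefficient `λ = 1 + V_N² / (C² - V_N²)`, with `C(α,t) = c(z(α,t),t)`. -/
def jumpCoeff (c : E3 → ℝ → ℝ) (z : S2 → ℝ → E3) (σ : ℝ) (α : S2) (t : ℝ) : ℝ :=
  1 + normalVelocity z σ α t ^ 2 / (c (z α t) t ^ 2 - normalVelocity z σ α t ^ 2)

end

/-! The time integral pairs `δ` and `δ'` with a strictly decreasing phase, so it localizes at the
single emission time τ of the signal that reaches (x, t) from the trajectory of β. The outcome is an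
explicit kernel in β at the retarded time, continuous as long as x ≠ z(β,t)
(`doubleLayerDensity_eq_retardedKernel`, `continuousOn_doubleLayerDensity`). Trajectories whose
signal would have left before time 0 contribute nothing, and no discontinuity arises there, because
a causal C¹ density vanishes to first order at τ = 0.

For x = z(α,t) + εN the difficulty sits at β = α. Let r be the distance from emission point to x, ν
its direction, and κ, N, V the slowness, normal and velocity at (α,t). Then t − τ = κr + O(r²) and ε
+ |β − α| = O(r), and after multiplication of the kernel by r² every coefficient may be frozen at
(α,t) at the cost of O(r). What is left is a function of ν. As for the Liénard–Wiechert field of a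
uniformly moving charge, it takes a simple shape in terms of the present separation r(ν − κV): this
is `leadForm`, homogeneous of degree −2. Up to O(r²) that separation is the linear expression
`modelVec`. Hence the density differs from `modelKernel` by O(1/(ε + |β − α|)), which is integrable
over the surface uniformly in ε, and ε = 0 is included (`isBigO_density_sub_model`).

In the gnomonic chart about α the model kernel becomes exactly a constant coefficient form on the
tangent plane. On the whole plane it decays in general only like |u|⁻², which is not integrable; on
the strip |u₁| < 1 it is integrable for ε > 0, and elementary primitives apply. As ε ↓ 0 a
difference of arctangents tends to π, the flux through the strip tends to 2π/(J(1 − κ²V_N²)), and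
the prefactor μJ/(4π) turns it into ½λμ (`tendsto_integral_band_modelKernel`). At ε = 0 the form is
odd, so its truncated integrals vanish (`integral_band_far_modelKernel`).

The density minus the model kernel on the band is dominated by a fixed integrable function
(`exists_abs_regularPart_le`) and converges pointwise. Its integral at ε = 0 is therefore both the
limit of the regular part and the principal value; adding the flux of the model gives the trace. -/

/-! ### Calculus on the parameter sphere -/

section SphereCalculus

variable {F G : Type*} [NormedAddCommGroup F] [NormedSpace ℝ F]
  [NormedAddCommGroup G] [NormedSpace ℝ G]

lemma coe_toS2 {p : E3} (hp : p ≠ 0) : (toS2 p : E3) = ‖p‖⁻¹ • p := by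
  simp [toS2, hp]

lemma S2.norm_coe (β : S2) : ‖(β : E3)‖ = 1 := mem_sphere_zero_iff_norm.mp β.2

lemma S2.coe_ne_zero (β : S2) : (β : E3) ≠ 0 := by
  rw [← norm_ne_zero_iff, S2.norm_coe]; exact one_ne_zero

@[simp] lemma toS2_coe (β : S2) : toS2 (β : E3) = β := by
  apply Subtype.ext
  rw [coe_toS2 (S2.coe_ne_zero β), S2.norm_coe]; simp

lemma toS2_smul {s : ℝ} (hs : 0 < s) {p : E3} (hp : p ≠ 0) : toS2 (s • p) = toS2 p := by
  apply Subtype.ext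
  rw [coe_toS2 (smul_ne_zero hs.ne' hp), coe_toS2 hp, norm_smul, Real.norm_of_nonneg hs.le,
    smul_smul]
  congr 1
  have := norm_ne_zero_iff.mpr hp
  field_simp

lemma contDiffAt_coe_toS2 {n : ℕ∞ω} {p : E3} (hp : p ≠ 0) :
    ContDiffAt ℝ n (fun q : E3 => (toS2 q : E3)) p := by
  have h : ContDiffAt ℝ n (fun q : E3 => ‖q‖⁻¹ • q) p :=
    ((contDiffAt_norm ℝ hp).inv (norm_ne_zero_iff.mpr hp)).smul contDiffAt_id
  refine h.congr_of_eventuallyEq ?_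
  filter_upwards [isOpen_compl_singleton.mem_nhds hp] with q hq using coe_toS2 hq

lemma continuousAt_toS2 {p : E3} (hp : p ≠ 0) : ContinuousAt toS2 p := by
  rw [Topology.IsInducing.subtypeVal.continuousAt_iff]
  exact (contDiffAt_coe_toS2 (n := 0) hp).continuousAt

/-- The slab `(ℝ³ ∖ {0}) × [0, T)` on which radially constant extensions are differentiated. -/
abbrev slab (T : ℝ) : Set (E3 × ℝ) := {0}ᶜ ×ˢ Ico 0 T

/-- The extension of a function on `𝕊² × ℝ` that is constant along rays. -/
noncomputable abbrev rayExt (f : S2 → ℝ → F) (p : E3 × ℝ) : F := f (toS2 p.1) p.2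

lemma uniqueDiffOn_slab (T : ℝ) : UniqueDiffOn ℝ (slab T) :=
  isOpen_compl_singleton.uniqueDiffOn.prod (uniqueDiffOn_Ico 0 T)

lemma coe_mem_slab {T τ : ℝ} (β : S2) (hτ : τ ∈ Ico 0 T) : ((β : E3), τ) ∈ slab T :=
  ⟨S2.coe_ne_zero β, hτ⟩

lemma slab_mem_nhds {T τ : ℝ} (β : S2) (hτ : τ ∈ Ioo 0 T) : slab T ∈ 𝓝 ((β : E3), τ) :=
  prod_mem_nhds (isOpen_compl_singleton.mem_nhds (S2.coe_ne_zero β)) (Ico_mem_nhds hτ.1 hτ.2)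

lemma ContDiffOnSphere.of_contDiffOn {k : ℕ∞} {g : E3 × ℝ → F} {T : ℝ}
    (hg : ContDiffOn ℝ k g (slab T)) :
    ContDiffOnSphere k (fun β τ => g ((β : E3), τ)) (Ico 0 T) := by
  have h1 : ContDiffOn ℝ k (fun p : E3 × ℝ => ((toS2 p.1 : E3), p.2)) (slab T) := by
    intro p hp
    exact (((contDiffAt_coe_toS2 hp.1).comp p contDiffAt_fst).prodMk contDiffAt_snd).contDiffWithinAt
  exact hg.comp h1 fun p hp => ⟨S2.coe_ne_zero _, hp.2⟩

lemma ContDiffOnSphere.continuousOn {k : ℕ∞} {f : S2 → ℝ → F} {I : Set ℝ}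
    (hf : ContDiffOnSphere k f I) : ContinuousOn (fun q : S2 × ℝ => f q.1 q.2) (univ ×ˢ I) := by
  have h1 : ContinuousOn (fun q : S2 × ℝ => ((q.1 : E3), q.2)) (univ ×ˢ I) := by fun_prop
  have := (ContDiffOn.continuousOn hf).comp h1 fun q hq => ⟨S2.coe_ne_zero _, hq.2⟩
  simpa [Function.comp_def] using this

/-- The time derivative on `[0, T)`, one-sided at `0`. -/
noncomputable def timeDeriv (f : S2 → ℝ → F) (β : S2) (τ : ℝ) : F := derivWithin (f β) (Ici 0) τ

lemma ContDiffOnSphere.hasFDerivWithinAt {k : ℕ∞} (hk : 1 ≤ k) {f : S2 → ℝ → F} {T τ : ℝ}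
    (hf : ContDiffOnSphere k f (Ico 0 T)) (β : S2) (hτ : τ ∈ Ico 0 T) :
    HasFDerivWithinAt (rayExt f) (fderivWithin ℝ (rayExt f) (slab T) ((β : E3), τ)) (slab T)
      ((β : E3), τ) := by
  refine (ContDiffOn.differentiableOn hf ?_ _ (coe_mem_slab β hτ)).hasFDerivWithinAt
  intro h
  have : k = 0 := by exact_mod_cast h
  subst this
  simp at hk

lemma ContDiffOnSphere.hasDerivWithinAt {k : ℕ∞} (hk : 1 ≤ k) {f : S2 → ℝ → F} {T τ : ℝ}
    (hf : ContDiffOnSphere k f (Ico 0 T)) (β : S2) (hτ : τ ∈ Ico 0 T) :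
    HasDerivWithinAt (f β) (fderivWithin ℝ (rayExt f) (slab T) ((β : E3), τ) (0, 1)) (Ici 0) τ := by
  have h := hf.hasFDerivWithinAt hk β hτ
  have h2 : HasDerivWithinAt (fun s : ℝ => ((β : E3), s)) (0, 1) (Ico 0 T) τ :=
    (hasDerivWithinAt_const _ _ _).prodMk (hasDerivWithinAt_id _ _)
  have h3 := h.comp_hasDerivWithinAt τ h2 fun s hs => coe_mem_slab β hs
  have h4 : HasDerivWithinAt (f β) (fderivWithin ℝ (rayExt f) (slab T) ((β : E3), τ) (0, 1))
      (Ico 0 T) τ := by simpa [Function.comp_def, rayExt] using h3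
  refine h4.mono_of_mem_nhdsWithin ?_
  have : Ico 0 T = Ici 0 ∩ Iio T := rfl
  rw [this]
  exact inter_mem self_mem_nhdsWithin (mem_nhdsWithin_of_mem_nhds (Iio_mem_nhds hτ.2))

lemma ContDiffOnSphere.timeDeriv_eq {k : ℕ∞} (hk : 1 ≤ k) {f : S2 → ℝ → F} {T τ : ℝ}
    (hf : ContDiffOnSphere k f (Ico 0 T)) (β : S2) (hτ : τ ∈ Ico 0 T) :
    timeDeriv f β τ = fderivWithin ℝ (rayExt f) (slab T) ((β : E3), τ) (0, 1) :=
  (hf.hasDerivWithinAt hk β hτ).derivWithin (uniqueDiffOn_Ici 0 τ hτ.1)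

lemma ContDiffOnSphere.hasDerivAt {k : ℕ∞} (hk : 1 ≤ k) {f : S2 → ℝ → F} {T τ : ℝ}
    (hf : ContDiffOnSphere k f (Ico 0 T)) (β : S2) (hτ : τ ∈ Ioo 0 T) :
    HasDerivAt (f β) (timeDeriv f β τ) τ := by
  rw [hf.timeDeriv_eq hk β ⟨hτ.1.le, hτ.2⟩]
  exact (hf.hasDerivWithinAt hk β ⟨hτ.1.le, hτ.2⟩).hasDerivAt (Ici_mem_nhds hτ.1)

lemma ContDiffOnSphere.congr' {k : ℕ∞} {f g : S2 → ℝ → F} {I : Set ℝ}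
    (hf : ContDiffOnSphere k f I) (h : ∀ β, ∀ τ ∈ I, g β τ = f β τ) : ContDiffOnSphere k g I :=
  ContDiffOn.congr hf fun _ hp => h _ _ hp.2

lemma ContDiffOnSphere.of_le' {k l : ℕ∞} {f : S2 → ℝ → F} {I : Set ℝ}
    (hf : ContDiffOnSphere k f I) (h : l ≤ k) : ContDiffOnSphere l f I :=
  ContDiffOn.of_le hf (by exact_mod_cast h)

/-- The derivative of a radially constant extension is not itself constant along rays; it is
restricted to the sphere and extended anew, which preserves its regularity. -/
lemma ContDiffOnSphere.fderivWithin_apply {k : ℕ∞} {f : S2 → ℝ → F} {T : ℝ}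
    (hf : ContDiffOnSphere (k + 1) f (Ico 0 T)) (v : E3 × ℝ) :
    ContDiffOnSphere k (fun β τ => fderivWithin ℝ (rayExt f) (slab T) ((β : E3), τ) v)
      (Ico 0 T) := by
  apply ContDiffOnSphere.of_contDiffOn (g := fun p => fderivWithin ℝ (rayExt f) (slab T) p v)
  exact (ContDiffOn.fderivWithin hf (uniqueDiffOn_slab T) (by simp)).clm_apply contDiffOn_const

lemma ContDiffOnSphere.timeDeriv {k : ℕ∞} {f : S2 → ℝ → F} {T : ℝ}
    (hf : ContDiffOnSphere (k + 1) f (Ico 0 T)) : ContDiffOnSphere k (timeDeriv f) (Ico 0 T) :=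
  (hf.fderivWithin_apply (0, 1)).congr' fun β _ hτ => hf.timeDeriv_eq (by simp) β hτ

lemma ContDiffOnSphere.hasFDerivAt_space {k : ℕ∞} (hk : 1 ≤ k) {f : S2 → ℝ → F} {T τ : ℝ}
    (hf : ContDiffOnSphere k f (Ico 0 T)) (β : S2) (hτ : τ ∈ Ico 0 T) :
    HasFDerivAt (fun p : E3 => f (toS2 p) τ)
      ((fderivWithin ℝ (rayExt f) (slab T) ((β : E3), τ)).comp (.inl ℝ E3 ℝ)) (β : E3) := by
  have h := hf.hasFDerivWithinAt hk β hτ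
  have h2 : HasFDerivWithinAt (fun p : E3 => (p, τ)) (ContinuousLinearMap.inl ℝ E3 ℝ) {0}ᶜ
      (β : E3) := (hasFDerivAt_prodMk_left (β : E3) τ).hasFDerivWithinAt
  have h3 := h.comp (β : E3) h2 (show MapsTo (fun p : E3 => (p, τ)) {0}ᶜ (slab T) from
    fun s hs => ⟨hs, hτ⟩)
  exact h3.hasFDerivAt (isOpen_compl_singleton.mem_nhds (S2.coe_ne_zero β))

/-! ### Cross product -/

@[simp] lemma cross_apply_zero (u v : E3) : cross u v 0 = u 1 * v 2 - u 2 * v 1 := by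
  simp [cross, cross_apply]

@[simp] lemma cross_apply_one (u v : E3) : cross u v 1 = u 2 * v 0 - u 0 * v 2 := by
  simp [cross, cross_apply]

@[simp] lemma cross_apply_two (u v : E3) : cross u v 2 = u 0 * v 1 - u 1 * v 0 := by
  simp [cross, cross_apply]

lemma E3.ext {u v : E3} (h0 : u 0 = v 0) (h1 : u 1 = v 1) (h2 : u 2 = v 2) : u = v := by
  ext i; fin_cases i <;> assumption

lemma E3.inner_eq (u v : E3) : ⟪u, v⟫ = u 0 * v 0 + u 1 * v 1 + u 2 * v 2 := by
  simp [PiLp.inner_apply, Fin.sum_univ_three, mul_comm]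

lemma ContDiffOn.cross {n : ℕ∞ω} {f g : G → E3} {s : Set G} (hf : ContDiffOn ℝ n f s)
    (hg : ContDiffOn ℝ n g s) : ContDiffOn ℝ n (fun x => cross (f x) (g x)) s := by
  rw [contDiffOn_euclidean] at *
  intro i
  fin_cases i
  · simpa using ((hf 1).mul (hg 2)).sub ((hf 2).mul (hg 1))
  · simpa using ((hf 2).mul (hg 0)).sub ((hf 0).mul (hg 2))
  · simpa using ((hf 0).mul (hg 1)).sub ((hf 1).mul (hg 0))

/-! ### Regularity of the geometric quantities -/

lemma ContDiffOnSphere.dz {k : ℕ∞} {z : S2 → ℝ → E3} {T : ℝ}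
    (hz : ContDiffOnSphere (k + 1) z (Ico 0 T)) (i : Fin 3) :
    ContDiffOnSphere k (fun β τ => dz z β τ i) (Ico 0 T) := by
  refine (hz.fderivWithin_apply (EuclideanSpace.single i 1, 0)).congr' fun β τ hτ => ?_
  rw [_root_.dz, (hz.hasFDerivAt_space (by simp) β hτ).fderiv]
  simp

lemma ContDiffOnSphere.areaVector {k : ℕ∞} {z : S2 → ℝ → E3} {T : ℝ}
    (hz : ContDiffOnSphere (k + 1) z (Ico 0 T)) :
    ContDiffOnSphere k (areaVector z) (Ico 0 T) := by
  have hc : ∀ i : Fin 3, ContDiffOn ℝ k (fun p : E3 × ℝ => (toS2 p.1 : E3) i) (slab T) := by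
    intro i p hp
    have h := ((contDiffAt_coe_toS2 (n := k) hp.1).comp p contDiffAt_fst)
    exact (contDiffAt_euclidean.mp h i).contDiffWithinAt
  exact (((hc 0).smul ((hz.dz 1).cross (hz.dz 2))).add
    ((hc 1).smul ((hz.dz 2).cross (hz.dz 0)))).add ((hc 2).smul ((hz.dz 0).cross (hz.dz 1)))

lemma ContDiffOnSphere.surfJ {k : ℕ∞} {z : S2 → ℝ → E3} {T : ℝ}
    (hz : ContDiffOnSphere (k + 1) z (Ico 0 T)) (hne : ∀ t ∈ Ico 0 T, ∀ β, _root_.areaVector z β t ≠ 0) :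
    ContDiffOnSphere k (surfJ z) (Ico 0 T) :=
  ContDiffOn.norm ℝ hz.areaVector fun _ hp => hne _ hp.2 _

lemma ContDiffOnSphere.unitNormal {k : ℕ∞} {z : S2 → ℝ → E3} {T : ℝ} (σ : ℝ)
    (hz : ContDiffOnSphere (k + 1) z (Ico 0 T)) (hne : ∀ t ∈ Ico 0 T, ∀ β, _root_.areaVector z β t ≠ 0) :
    ContDiffOnSphere k (unitNormal z σ) (Ico 0 T) :=
  (contDiffOn_const (c := σ)).smul (((hz.surfJ hne).inv fun _ hp =>
    norm_ne_zero_iff.mpr (hne _ hp.2 _)).smul hz.areaVector)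

end SphereCalculus

/-! ### The density of the double-layer potential at the retarded time -/

/-- The standing assumptions. -/
structure IsDoubleLayerSetting (T : ℝ) (c : E3 → ℝ → ℝ) (Ωm : ℝ → Set E3) (z : S2 → ℝ → E3) (σ : ℝ)
    (η A : E3 → ℝ → E3 → ℝ → ℝ) (μ : S2 → ℝ → ℝ) : Prop where
  soundSpeed : IsSoundSpeed T c
  obstacle : IsMovingObstacle T Ωm z σ
  subsonic : Subsonic T c z σ
  travelTime : IsTravelTime T c z η
  amplitude : IsAmplitude T c A
  density : IsCausalDensity T μ

/-- A kernel as a function of the source event, for a fixed observation event. -/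
abbrev srcFun (f : E3 → ℝ → E3 → ℝ → ℝ) (x : E3) (t : ℝ) (q : E3 × ℝ) : ℝ := f x t q.1 q.2

/-- The derivative of `Df(x,t;γ(τ)) X(τ)` along `γ(τ) = (z(β,τ), τ)`, where `X' = X₁`. -/
noncomputable def alongCurve (f : E3 → ℝ → E3 → ℝ → ℝ) (z : S2 → ℝ → E3) (x : E3) (t : ℝ) (β : S2)
    (τ : ℝ) (X X₁ : E3 × ℝ) : ℝ :=
  fderiv ℝ (fderiv ℝ (srcFun f x t)) (z β τ, τ) (velocity z β τ, 1) X
    + fderiv ℝ (srcFun f x t) (z β τ, τ) X₁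

/-- The closed form of the double-layer density in terms of the values and the derivatives, at the
retarded time, of the amplitude `a`, of `g = ∂_N η`, of the travel time `h` and of the weight `m`. -/
noncomputable def kernelForm (aN a a' g g' h h' h'' m m' : ℝ) : ℝ :=
  1 / (4 * Real.pi) * (aN * m / (h * (1 + h'))
    - ((a' * g * m + a * g' * m + a * g * m') / (h * (1 + h')) - a * g * m * h' / (h ^ 2 * (1 + h'))
        - a * g * m * h'' / (h * (1 + h') ^ 2)) / (1 + h')
    - a * g * m / (h ^ 2 * (1 + h')))

/-- The closed form of the double-layer density, as a function of the emission time `τ`. -/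
noncomputable def retardedKernel (z : S2 → ℝ → E3) (σ : ℝ) (η A : E3 → ℝ → E3 → ℝ → ℝ)
    (μ : S2 → ℝ → ℝ) (x : E3) (t : ℝ) (β : S2) (τ : ℝ) : ℝ :=
  kernelForm (fderiv ℝ (srcFun A x t) (z β τ, τ) (unitNormal z σ β τ, 0)) (A x t (z β τ) τ)
    (totalDeriv A z x t β τ) (fderiv ℝ (srcFun η x t) (z β τ, τ) (unitNormal z σ β τ, 0))
    (alongCurve η z x t β τ (unitNormal z σ β τ, 0) (timeDeriv (unitNormal z σ) β τ, 0))
    (η x t (z β τ) τ) (totalDeriv η z x t β τ)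
    (alongCurve η z x t β τ (velocity z β τ, 1) (timeDeriv (velocity z) β τ, 0))
    (μ β τ * surfJ z β τ) (timeDeriv μ β τ * surfJ z β τ + μ β τ * timeDeriv (surfJ z) β τ)

lemma deltaPair_eq_of_unique {t τ₀ : ℝ} {Φ : ℝ → ℝ} (f : ℝ → ℝ)
    (h : {τ | τ ∈ Ioo 0 t ∧ Φ τ = 0} = {τ₀}) : deltaPair t Φ f = f τ₀ / |deriv Φ τ₀| := by
  unfold deltaPair
  rw [h]
  exact finsum_mem_singleton

lemma deltaDerivPair_eq_of_unique {t τ₀ : ℝ} {Φ : ℝ → ℝ} (f : ℝ → ℝ)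
    (h : {τ | τ ∈ Ioo 0 t ∧ Φ τ = 0} = {τ₀}) :
    deltaDerivPair t Φ f = -(deriv (fun s => f s / |deriv Φ s|) τ₀ / deriv Φ τ₀) := by
  unfold deltaDerivPair
  rw [h]
  exact finsum_mem_singleton

/-- Here Φ' = −(1 + h') is negative near the zero, so |Φ'| = 1 + h' there and the δ' pairing is a
quotient-rule derivative. Since |Φ'| is itself differentiated, the formula for Φ' is needed on a
neighbourhood of τ₀. -/
lemma greenDerivPair_eq_of_unique {t τ₀ h'' F' : ℝ} {h h' F : ℝ → ℝ}
    (hz : {τ | τ ∈ Ioo 0 t ∧ t - τ - h τ = 0} = {τ₀}) (hh : ∀ᶠ s in 𝓝 τ₀, HasDerivAt h (h' s) s)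
    (hh' : HasDerivAt h' h'' τ₀) (hF : HasDerivAt F F' τ₀) (h0 : h τ₀ ≠ 0) (hq : 0 < 1 + h' τ₀) :
    greenDerivPair t h F = 1 / (4 * Real.pi) * (-((F' / (h τ₀ * (1 + h' τ₀))
      - F τ₀ * h' τ₀ / (h τ₀ ^ 2 * (1 + h' τ₀)) - F τ₀ * h'' / (h τ₀ * (1 + h' τ₀) ^ 2))
        / (1 + h' τ₀)) - F τ₀ / (h τ₀ ^ 2 * (1 + h' τ₀))) := by
  have hΦ : ∀ s, HasDerivAt h (h' s) s → deriv (fun τ => t - τ - h τ) s = -(1 + h' s) := by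
    intro s hs
    have := (((hasDerivAt_id s).const_sub t).sub hs).deriv
    simp only [id] at this
    rw [show (fun τ => t - τ - h τ) = ((fun τ => t - τ) - h) from rfl, this]; ring
  have hev : (fun s => F s / (4 * Real.pi * h s) / |deriv (fun τ => t - τ - h τ) s|)
      =ᶠ[𝓝 τ₀] fun s => F s / (4 * Real.pi * h s) / (1 + h' s) := by
    have hpos : ∀ᶠ s in 𝓝 τ₀, 0 < 1 + h' s :=
      (continuousAt_const.add hh'.continuousAt).eventually (lt_mem_nhds hq)
    filter_upwards [hh, hpos] with s hs hp
    rw [hΦ s hs, abs_neg, abs_of_pos hp]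
  have hd : HasDerivAt (fun s => F s / (4 * Real.pi * h s) / (1 + h' s))
      (((F' * (4 * Real.pi * h τ₀) - F τ₀ * (4 * Real.pi * h' τ₀)) / (4 * Real.pi * h τ₀) ^ 2
        * (1 + h' τ₀) - F τ₀ / (4 * Real.pi * h τ₀) * h'') / (1 + h' τ₀) ^ 2) τ₀ :=
    (hF.div (hh.self_of_nhds.const_mul _) (by positivity)).div (hh'.const_add 1) hq.ne'
  unfold greenDerivPair
  rw [deltaDerivPair_eq_of_unique _ hz, deltaPair_eq_of_unique _ hz, hev.deriv_eq, hd.deriv,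
    hΦ _ hh.self_of_nhds, abs_neg, abs_of_pos hq]
  have hq' := hq.ne'
  field_simp

lemma greenPair_eq_of_unique {t τ₀ h' : ℝ} {h : ℝ → ℝ} (F : ℝ → ℝ)
    (hz : {τ | τ ∈ Ioo 0 t ∧ t - τ - h τ = 0} = {τ₀}) (hh : HasDerivAt h h' τ₀) (hq : 0 < 1 + h') :
    greenPair t h F = 1 / (4 * Real.pi) * (F τ₀ / (h τ₀ * (1 + h'))) := by
  have hΦ : deriv (fun τ => t - τ - h τ) τ₀ = -(1 + h') := by
    have := (((hasDerivAt_id τ₀).const_sub t).sub hh).deriv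
    simp only [id] at this
    rw [show (fun τ => t - τ - h τ) = ((fun τ => t - τ) - h) from rfl, this]; ring
  unfold greenPair
  rw [deltaPair_eq_of_unique _ hz, hΦ, abs_neg, abs_of_pos hq]
  have hq' := hq.ne'
  field_simp

/-! ### Differentiation along the trajectory of a surface point. -/

section Curve

variable {T t τ : ℝ} {z : S2 → ℝ → E3} {f : E3 → ℝ → E3 → ℝ → ℝ} {x : E3} {β : S2}

lemma hasDerivAt_sourceCurve (hz : ContDiffOnSphere 2 z (Ico 0 T)) (hτ : τ ∈ Ioo 0 T) :
    HasDerivAt (fun s => (z β s, s)) (velocity z β τ, (1 : ℝ)) τ :=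
  (hz.hasDerivAt (by norm_num) β hτ).prodMk (hasDerivAt_id τ)

lemma hasDerivAt_comp_sourceCurve (hz : ContDiffOnSphere 2 z (Ico 0 T)) (hτ : τ ∈ Ioo 0 T)
    (hf : DifferentiableAt ℝ (srcFun f x t) (z β τ, τ)) :
    HasDerivAt (fun s => f x t (z β s) s) (totalDeriv f z x t β τ) τ :=
  HasFDerivAt.comp_hasDerivAt (f := fun s => (z β s, s)) τ hf.hasFDerivAt
    (hasDerivAt_sourceCurve hz hτ)

lemma hasDerivAt_fderiv_sourceCurve (hz : ContDiffOnSphere 2 z (Ico 0 T)) (hτ : τ ∈ Ioo 0 T)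
    (hf : ContDiffAt ℝ 2 (srcFun f x t) (z β τ, τ)) {X : ℝ → E3 × ℝ} {X₁ : E3 × ℝ}
    (hX : HasDerivAt X X₁ τ) :
    HasDerivAt (fun s => fderiv ℝ (srcFun f x t) (z β s, s) (X s))
      (alongCurve f z x t β τ (X τ) X₁) τ := by
  have h1 : DifferentiableAt ℝ (fderiv ℝ (srcFun f x t)) (z β τ, τ) :=
    (hf.fderiv_right (m := 1) (by norm_num)).differentiableAt (by norm_num)
  have h2 := HasFDerivAt.comp_hasDerivAt (f := fun s => (z β s, s)) τ h1.hasFDerivAt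
    (hasDerivAt_sourceCurve hz hτ)
  exact h2.clm_apply hX

lemma sourceNormalDeriv_eq {σ : ℝ} (hf : DifferentiableAt ℝ (srcFun f x t) (z β τ, τ)) :
    sourceNormalDeriv z σ f x t β τ
      = fderiv ℝ (srcFun f x t) (z β τ, τ) (unitNormal z σ β τ, 0) := by
  have h := HasFDerivAt.comp (f := fun y => (y, τ)) (z β τ) hf.hasFDerivAt
    (hasFDerivAt_prodMk_left (z β τ) τ)
  have h' : fderiv ℝ (fun y => f x t y τ) (z β τ) = _ := h.fderiv
  rw [sourceNormalDeriv, h']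
  simp

end Curve

/-! ### Evaluation of the density at a zero of the phase. -/

section Density

variable {T : ℝ} {c : E3 → ℝ → ℝ} {Ωm : ℝ → Set E3} {z : S2 → ℝ → E3} {σ : ℝ}
  {η A : E3 → ℝ → E3 → ℝ → ℝ} {μ : S2 → ℝ → ℝ} {x : E3} {t τ : ℝ} {β : S2}

namespace IsDoubleLayerSetting

lemma contDiff_velocity (H : IsDoubleLayerSetting T c Ωm z σ η A μ) :
    ContDiffOnSphere 1 (velocity z) (Ico 0 T) :=
  ContDiffOnSphere.timeDeriv (k := 1) (H.obstacle.contDiff.of_le' (by norm_num))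

lemma contDiff_normal (H : IsDoubleLayerSetting T c Ωm z σ η A μ) :
    ContDiffOnSphere 1 (unitNormal z σ) (Ico 0 T) :=
  ContDiffOnSphere.unitNormal (k := 1) σ (H.obstacle.contDiff.of_le' (by norm_num))
    H.obstacle.immersion

lemma contDiff_surfJ (H : IsDoubleLayerSetting T c Ωm z σ η A μ) :
    ContDiffOnSphere 1 (surfJ z) (Ico 0 T) :=
  ContDiffOnSphere.surfJ (k := 1) (H.obstacle.contDiff.of_le' (by norm_num))
    H.obstacle.immersion

lemma contDiff_density (H : IsDoubleLayerSetting T c Ωm z σ η A μ) :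
    ContDiffOnSphere 1 μ (Ico 0 T) :=
  ContDiffOn.mono H.density.contDiff (prod_mono_right fun _ h => h.2)

lemma contDiffAt_src_travelTime (H : IsDoubleLayerSetting T c Ωm z σ η A μ) {q : E3 × ℝ}
    (hp : ((x, t), q) ∈ properPairs T) : ContDiffAt ℝ 2 (srcFun η x t) q :=
  (H.travelTime.contDiffAt _ hp).comp q (contDiffAt_const.prodMk contDiffAt_id)

lemma contDiffAt_src_amplitude (H : IsDoubleLayerSetting T c Ωm z σ η A μ) {q : E3 × ℝ}
    (hp : ((x, t), q) ∈ properPairs T) : ContDiffAt ℝ ∞ (srcFun A x t) q :=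
  (H.amplitude.contDiffAt _ hp).comp q (contDiffAt_const.prodMk contDiffAt_id)

lemma ne_of_travelTime_ne (H : IsDoubleLayerSetting T c Ωm z σ η A μ) (ht : t < T)
    (hτ : τ ∈ Icc 0 t) {y : E3} (h : η x t y τ ≠ 0) : x ≠ y :=
  fun hxy => h ((H.travelTime.eq_zero_iff x t y τ hτ.1 hτ.2 ht).2 hxy)

/-- At a zero of the phase the density is given by the closed form. -/
lemma doubleLayerDensity_eq (H : IsDoubleLayerSetting T c Ωm z σ η A μ) (ht : t < T)
    (hτ : τ ∈ Ioo 0 t) (h0 : t - τ - η x t (z β τ) τ = 0) :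
    doubleLayerDensity z σ η A μ x t β = retardedKernel z σ η A μ x t β τ := by
  have hne : η x t (z β τ) τ ≠ 0 := by
    have := hτ.2
    intro h; rw [h] at h0; linarith
  have hx : x ≠ z β τ := H.ne_of_travelTime_ne ht ⟨hτ.1.le, hτ.2.le⟩ hne
  have hτT : τ ∈ Ioo 0 T := ⟨hτ.1, hτ.2.trans ht⟩
  have hz2 := H.obstacle.contDiff
  -- A strictly decreasing phase has at most one zero, so the finite sums reduce to one term.
  have hset : {s | s ∈ Ioo 0 t ∧ t - s - η x t (z β s) s = 0} = {τ} := by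
    ext s
    refine ⟨fun hs => ?_, fun hs => by rw [hs]; exact ⟨hτ, h0⟩⟩
    exact (H.travelTime.strictAnti x t β (hτ.1.trans hτ.2).le ht).injOn
      ⟨hs.1.1.le, hs.1.2.le⟩ ⟨hτ.1.le, hτ.2.le⟩ (hs.2.trans h0.symm)
  have hcz : ContinuousAt (z β) τ := (hz2.hasDerivAt (by norm_num) β hτT).continuousAt
  have hev : ∀ᶠ s in 𝓝 τ, s ∈ Ioo 0 t ∧ ((x, t), (z β s, s)) ∈ properPairs T := by
    filter_upwards [Ioo_mem_nhds hτ.1 hτ.2, hcz.eventually_ne hx.symm] with s hs hs'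
    exact ⟨hs, hs.1.le, hs.2, ht, hs'.symm⟩
  have hp := hev.self_of_nhds.2
  have hη := H.contDiffAt_src_travelTime hp
  have hA := H.contDiffAt_src_amplitude hp
  have hh : ∀ᶠ s in 𝓝 τ, HasDerivAt (fun s => η x t (z β s) s) (totalDeriv η z x t β s) s := by
    filter_upwards [hev] with s hs
    exact hasDerivAt_comp_sourceCurve hz2 ⟨hs.1.1, hs.1.2.trans ht⟩
      ((H.contDiffAt_src_travelTime hs.2).differentiableAt (by norm_num))
  have hh' : HasDerivAt (fun s => totalDeriv η z x t β s)
      (alongCurve η z x t β τ (velocity z β τ, 1) (timeDeriv (velocity z) β τ, 0)) τ :=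
    hasDerivAt_fderiv_sourceCurve hz2 hτT hη (X := fun s => (velocity z β s, 1))
      ((H.contDiff_velocity.hasDerivAt le_rfl β hτT).prodMk (hasDerivAt_const _ _))
  have hg : HasDerivAt (fun s => sourceNormalDeriv z σ η x t β s)
      (alongCurve η z x t β τ (unitNormal z σ β τ, 0) (timeDeriv (unitNormal z σ) β τ, 0)) τ := by
    have := hasDerivAt_fderiv_sourceCurve hz2 hτT hη (X := fun s => (unitNormal z σ β s, 0))
      ((H.contDiff_normal.hasDerivAt le_rfl β hτT).prodMk (hasDerivAt_const _ _))
    refine this.congr_of_eventuallyEq ?_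
    filter_upwards [hev] with s hs
    exact sourceNormalDeriv_eq ((H.contDiffAt_src_travelTime hs.2).differentiableAt (by norm_num))
  have ha : HasDerivAt (fun s => A x t (z β s) s) (totalDeriv A z x t β τ) τ :=
    hasDerivAt_comp_sourceCurve hz2 hτT (hA.differentiableAt (by norm_num))
  have hμ := H.contDiff_density.hasDerivAt le_rfl β hτT
  have hJ := H.contDiff_surfJ.hasDerivAt le_rfl β hτT
  have hq := H.travelTime.nondegenerate x t β τ hτ.1.le hτ.2 ht hx
  have hF : HasDerivAt (fun s => A x t (z β s) s * sourceNormalDeriv z σ η x t β s * μ β s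
      * surfJ z β s) _ τ := ((ha.mul hg).mul hμ).mul hJ
  rw [doubleLayerDensity, greenPair_eq_of_unique _ hset hh.self_of_nhds hq,
    greenDerivPair_eq_of_unique hset hh hh' hF hne hq,
    retardedKernel, kernelForm, sourceNormalDeriv_eq (hA.differentiableAt (by norm_num)),
    sourceNormalDeriv_eq (hη.differentiableAt (by norm_num))]
  simp only [Pi.mul_apply]
  rw [sourceNormalDeriv_eq (hη.differentiableAt (by norm_num))]
  ring

lemma doubleLayerDensity_eq_zero (h : ∀ τ ∈ Ioo 0 t, t - τ - η x t (z β τ) τ ≠ 0) :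
    doubleLayerDensity z σ η A μ x t β = 0 := by
  have hset : {s | s ∈ Ioo 0 t ∧ t - s - η x t (z β s) s = 0} = ∅ := by
    ext s
    simp only [mem_ofPred_eq, mem_empty_iff_false, iff_false, not_and]
    exact h s
  simp only [doubleLayerDensity, greenPair, greenDerivPair, deltaPair, deltaDerivPair, hset]
  simp

end IsDoubleLayerSetting

end Density

/-! ### The retarded time -/

open Classical in
/-- The retarded (emission) time: the zero of the phase in `(0, t)`, or `0` if there is none. -/
noncomputable def retardedTime (z : S2 → ℝ → E3) (η : E3 → ℝ → E3 → ℝ → ℝ) (x : E3) (t : ℝ)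
    (β : S2) : ℝ :=
  if h : ∃ τ ∈ Ioo 0 t, t - τ - η x t (z β τ) τ = 0 then h.choose else 0

/-- The parameter is taken to be the whole pair, so that the base point of the derivative is itself
a function of the parameter and the smooth dependence of derivatives on parameters applies. -/
lemma continuousAt_fderiv_param {E F G : Type*} [NormedAddCommGroup E] [NormedSpace ℝ E]
    [NormedAddCommGroup F] [NormedSpace ℝ F] [NormedAddCommGroup G] [NormedSpace ℝ G]
    {f : E → F → G} {p : E × F} (hf : ContDiffAt ℝ 1 (fun w : E × F => f w.1 w.2) p) :
    ContinuousAt (fun w : E × F => fderiv ℝ (f w.1) w.2) p := by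
  have h : ContDiffAt ℝ 1 (Function.uncurry fun w : E × F => f w.1) (p, p.2) := by
    have h1 : ContDiffAt ℝ 1 (fun u : (E × F) × F => (u.1.1, u.2)) (p, p.2) := by fun_prop
    exact ContDiffAt.comp (g := fun w : E × F => f w.1 w.2) (p, p.2) hf h1
  exact (h.fderiv (m := 0) contDiffAt_snd (by norm_num)).continuousAt

lemma continuousAt_fderiv_fderiv_param {E F G : Type*} [NormedAddCommGroup E] [NormedSpace ℝ E]
    [NormedAddCommGroup F] [NormedSpace ℝ F] [NormedAddCommGroup G] [NormedSpace ℝ G]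
    {f : E → F → G} {p : E × F} (hf : ContDiffAt ℝ 2 (fun w : E × F => f w.1 w.2) p) :
    ContinuousAt (fun w : E × F => fderiv ℝ (fderiv ℝ (f w.1)) w.2) p := by
  have h : ContDiffAt ℝ 2 (Function.uncurry fun w : E × F => f w.1) (p, p.2) := by
    have h1 : ContDiffAt ℝ 2 (fun u : (E × F) × F => (u.1.1, u.2)) (p, p.2) := by fun_prop
    exact ContDiffAt.comp (g := fun w : E × F => f w.1 w.2) (p, p.2) hf h1
  exact continuousAt_fderiv_param (f := fun e => fderiv ℝ (f e))
    (h.fderiv (m := 1) contDiffAt_snd (by norm_num))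

namespace IsDoubleLayerSetting

variable {T : ℝ} {c : E3 → ℝ → ℝ} {Ωm : ℝ → Set E3} {z : S2 → ℝ → E3} {σ : ℝ}
  {η A : E3 → ℝ → E3 → ℝ → ℝ} {μ : S2 → ℝ → ℝ} {x : E3} {t τ : ℝ} {β : S2}

lemma continuousOn_surface (H : IsDoubleLayerSetting T c Ωm z σ η A μ) :
    ContinuousOn (fun q : S2 × ℝ => z q.1 q.2) (univ ×ˢ Ico 0 T) :=
  H.obstacle.contDiff.continuousOn

lemma continuousOn_src (H : IsDoubleLayerSetting T c Ωm z σ η A μ) (ht : t < T) :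
    ContinuousOn (fun w : E3 × S2 × ℝ => η w.1 t (z w.2.1 w.2.2) w.2.2)
      (univ ×ˢ univ ×ˢ Icc 0 t) := by
  have h1 : ContinuousOn (fun w : E3 × S2 × ℝ => z w.2.1 w.2.2) (univ ×ˢ univ ×ˢ Icc 0 t) :=
    H.continuousOn_surface.comp continuousOn_snd
      fun w hw => ⟨mem_univ _, hw.2.2.1, hw.2.2.2.trans_lt ht⟩
  have h2 : ContinuousOn (fun w : E3 × S2 × ℝ => ((w.1, t), (z w.2.1 w.2.2, w.2.2)))
      (univ ×ˢ univ ×ˢ Icc 0 t) :=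
    (continuousOn_fst.prodMk continuousOn_const).prodMk (h1.prodMk (by fun_prop))
  exact H.travelTime.continuousOn.comp h2 fun w hw => ⟨hw.2.2.1, hw.2.2.2, ht⟩

lemma continuous_phase (H : IsDoubleLayerSetting T c Ωm z σ η A μ) (ht : t < T)
    (hτ : τ ∈ Icc 0 t) :
    Continuous (fun w : E3 × S2 => t - τ - η w.1 t (z w.2 τ) τ) := by
  have h : Continuous (fun w : E3 × S2 => η w.1 t (z w.2 τ) τ) := by
    rw [← continuousOn_univ]
    exact (H.continuousOn_src ht).comp (f := fun w : E3 × S2 => (w.1, w.2, τ))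
      (by fun_prop) fun w _ => ⟨mem_univ _, mem_univ _, hτ⟩
  exact continuous_const.sub h

/-- At τ = t the phase equals −η < 0 because x ≠ z(β,t). By the intermediate value theorem a zero in
(0, t) can be missing only if the phase is already nonpositive at τ = 0. -/
lemma retardedTime_cases (H : IsDoubleLayerSetting T c Ωm z σ η A μ) (ht : t ∈ Ioo 0 T)
    (hx : x ≠ z β t) :
    (retardedTime z η x t β ∈ Ioo 0 t ∧
        t - retardedTime z η x t β - η x t (z β (retardedTime z η x t β)) (retardedTime z η x t β)
          = 0) ∨
      (retardedTime z η x t β = 0 ∧ t - 0 - η x t (z β 0) 0 ≤ 0 ∧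
        ∀ τ ∈ Ioo 0 t, t - τ - η x t (z β τ) τ ≠ 0) := by
  by_cases h : ∃ τ ∈ Ioo 0 t, t - τ - η x t (z β τ) τ = 0
  · left
    rw [retardedTime, dif_pos h]
    exact h.choose_spec
  · right
    refine ⟨by rw [retardedTime, dif_neg h], ?_, fun τ hτ h0 => h ⟨τ, hτ, h0⟩⟩
    by_contra! hpos
    apply h
    have hcont : ContinuousOn (fun τ => t - τ - η x t (z β τ) τ) (Icc 0 t) := by
      have : ContinuousOn (fun τ => η x t (z β τ) τ) (Icc 0 t) :=
        (H.continuousOn_src ht.2).comp (f := fun τ => (x, β, τ)) (by fun_prop)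
          fun τ hτ => ⟨mem_univ _, mem_univ _, hτ⟩
      exact (continuousOn_const.sub continuousOn_id).sub this
    have hneg : t - t - η x t (z β t) t < 0 := by
      have h1 := H.travelTime.nonneg x t (z β t) t ht.1.le le_rfl ht.2
      have h2 : η x t (z β t) t ≠ 0 := fun h0 =>
        hx ((H.travelTime.eq_zero_iff x t (z β t) t ht.1.le le_rfl ht.2).1 h0)
      have := lt_of_le_of_ne h1 h2.symm
      linarith
    obtain ⟨τ, hτ, h0⟩ := intermediate_value_Ioo' ht.1.le hcont ⟨hneg, hpos⟩
    exact ⟨τ, hτ, h0⟩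

lemma retardedTime_mem (H : IsDoubleLayerSetting T c Ωm z σ η A μ) (ht : t ∈ Ioo 0 T)
    (hx : x ≠ z β t) : retardedTime z η x t β ∈ Ico 0 t := by
  rcases H.retardedTime_cases ht hx with h | h
  · exact ⟨h.1.1.le, h.1.2⟩
  · rw [h.1]; exact ⟨le_rfl, ht.1⟩

/-- Monotonicity makes the sign of the phase at a fixed τ decide on which side of τ the retarded
time lies. With the companion bound `retardedTime_lt` this takes the place of the implicit function
theorem. -/
lemma lt_retardedTime (H : IsDoubleLayerSetting T c Ωm z σ η A μ) (ht : t ∈ Ioo 0 T)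
    (hx : x ≠ z β t) (hτ : τ ∈ Icc 0 t) (hpos : 0 < t - τ - η x t (z β τ) τ) :
    τ < retardedTime z η x t β := by
  by_contra! hle
  have hm := H.retardedTime_mem ht hx
  have h := (H.travelTime.strictAnti x t β ht.1.le ht.2).antitoneOn ⟨hm.1, hm.2.le⟩ hτ hle
  rcases H.retardedTime_cases ht hx with h' | h'
  · rw [← h'.2] at hpos; exact absurd hpos (not_lt.mpr h)
  · simp only [h'.1] at h
    linarith [h'.2.1]

lemma retardedTime_lt (H : IsDoubleLayerSetting T c Ωm z σ η A μ) (ht : t ∈ Ioo 0 T)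
    (hx : x ≠ z β t) (hτ : 0 < τ) (hneg : t - τ - η x t (z β τ) τ < 0) :
    retardedTime z η x t β < τ := by
  have hm := H.retardedTime_mem ht hx
  rcases lt_or_ge t τ with h | htτ
  · exact hm.2.trans h
  by_contra! hle
  have h := (H.travelTime.strictAnti x t β ht.1.le ht.2).antitoneOn ⟨hτ.le, htτ⟩
    ⟨hm.1, hm.2.le⟩ hle
  rcases H.retardedTime_cases ht hx with h' | h'
  · simp only [h'.2] at h; linarith
  · rw [h'.1] at hle; linarith

lemma ne_retarded (H : IsDoubleLayerSetting T c Ωm z σ η A μ) (ht : t ∈ Ioo 0 T)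
    (hx : x ≠ z β t) : x ≠ z β (retardedTime z η x t β) := by
  have hm := H.retardedTime_mem ht hx
  apply H.ne_of_travelTime_ne ht.2 ⟨hm.1, hm.2.le⟩
  rcases H.retardedTime_cases ht hx with h | h
  · intro h0; rw [h0] at h; linarith [h.2, h.1.2]
  · rw [h.1]; intro h0; rw [h0] at h; linarith [h.2.1, ht.1]

/-- A strict inequality between a fixed time and the retarded time is a strict sign of the phase at
that time, and this sign persists for nearby (x, β). The argument also covers points where the
retarded time is the default value 0. -/
lemma continuousWithinAt_retardedTime (H : IsDoubleLayerSetting T c Ωm z σ η A μ)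
    (ht : t ∈ Ioo 0 T) {w : E3 × S2} (hx : w.1 ≠ z w.2 t) :
    ContinuousWithinAt (fun w : E3 × S2 => retardedTime z η w.1 t w.2)
      {w | w.1 ≠ z w.2 t} w := by
  have hm := H.retardedTime_mem ht hx
  refine tendsto_order.2 ⟨fun a ha => ?_, fun b hb => ?_⟩
  · rcases lt_or_ge a 0 with h0 | h0
    · filter_upwards [self_mem_nhdsWithin] with v hv
      exact h0.trans_le (H.retardedTime_mem ht hv).1
    · have haI : a ∈ Icc 0 t := ⟨h0, (ha.trans hm.2).le⟩
      have hpos : 0 < t - a - η w.1 t (z w.2 a) a := by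
        rcases H.retardedTime_cases ht hx with h' | h'
        · rw [← h'.2]
          exact H.travelTime.strictAnti w.1 t w.2 ht.1.le ht.2 haI ⟨hm.1, hm.2.le⟩ ha
        · simp only [h'.1] at ha; linarith
      filter_upwards [self_mem_nhdsWithin, mem_nhdsWithin_of_mem_nhds
        (((H.continuous_phase ht.2 haI).continuousAt (x := w)).eventually (lt_mem_nhds hpos))]
        with v hv hv'
      exact H.lt_retardedTime ht hv haI hv'
  · rcases lt_or_ge b t with hbt | hbt
    · have hb0 := hm.1.trans_lt hb
      have hneg : t - b - η w.1 t (z w.2 b) b < 0 := by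
        have := H.travelTime.strictAnti w.1 t w.2 ht.1.le ht.2 ⟨hm.1, hm.2.le⟩ ⟨hb0.le, hbt.le⟩ hb
        rcases H.retardedTime_cases ht hx with h' | h'
        · simp only [h'.2] at this; exact this
        · simp only [h'.1] at this; linarith [h'.2.1]
      filter_upwards [self_mem_nhdsWithin, mem_nhdsWithin_of_mem_nhds
        (((H.continuous_phase ht.2 ⟨hb0.le, hbt.le⟩).continuousAt (x := w)).eventually
          (gt_mem_nhds hneg))] with v hv hv'
      exact H.retardedTime_lt ht hv hb0 hv'
    · filter_upwards [self_mem_nhdsWithin] with v hv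
      exact (H.retardedTime_mem ht hv).2.trans_le hbt

/-! ### Continuity of the density away from the singularity -/

/-- The triples `(x, β, τ)` with `0 ≤ τ < t` and `x ≠ z(β, τ)`. -/
def regularSet (z : S2 → ℝ → E3) (t : ℝ) : Set (E3 × S2 × ℝ) :=
  {w | 0 ≤ w.2.2 ∧ w.2.2 < t ∧ w.1 ≠ z w.2.1 w.2.2}

/-- The pair formed by the observation point and the source event. -/
abbrev eventMap (z : S2 → ℝ → E3) (w : E3 × S2 × ℝ) : E3 × (E3 × ℝ) := (w.1, (z w.2.1 w.2.2, w.2.2))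

lemma continuousOn_regularSet (ht : t < T) {F : Type*} [NormedAddCommGroup F] [NormedSpace ℝ F]
    {k : ℕ∞} {f : S2 → ℝ → F} (hf : ContDiffOnSphere k f (Ico 0 T)) :
    ContinuousOn (fun w : E3 × S2 × ℝ => f w.2.1 w.2.2) (regularSet z t) :=
  hf.continuousOn.comp continuousOn_snd fun _ hw => ⟨mem_univ _, hw.1, hw.2.1.trans ht⟩

lemma continuousOn_event (H : IsDoubleLayerSetting T c Ωm z σ η A μ) (ht : t < T) :
    ContinuousOn (eventMap z) (regularSet z t) :=
  continuousOn_fst.prodMk ((continuousOn_regularSet ht H.obstacle.contDiff).prodMk (by fun_prop))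

lemma contDiffAt_param {f : E3 → ℝ → E3 → ℝ → ℝ} {n : ℕ∞ω}
    (hf : ∀ p ∈ properPairs T, ContDiffAt ℝ n (onEvents f) p) (ht : t < T)
    {w : E3 × S2 × ℝ} (hw : w ∈ regularSet z t) :
    ContDiffAt ℝ n (fun v : E3 × (E3 × ℝ) => srcFun f v.1 t v.2)
      (w.1, (z w.2.1 w.2.2, w.2.2)) := by
  have h1 : ContDiffAt ℝ n (fun v : E3 × (E3 × ℝ) => ((v.1, t), v.2))
      (w.1, (z w.2.1 w.2.2, w.2.2)) := by fun_prop
  exact ContDiffAt.comp (g := onEvents f) (f := fun v : E3 × (E3 × ℝ) => ((v.1, t), v.2)) _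
    (hf ((w.1, t), (z w.2.1 w.2.2, w.2.2)) ⟨hw.1, hw.2.1, ht, hw.2.2⟩) h1

lemma continuousOn_fderiv_src (H : IsDoubleLayerSetting T c Ωm z σ η A μ) (ht : t < T)
    {f : E3 → ℝ → E3 → ℝ → ℝ} (hf : ∀ p ∈ properPairs T, ContDiffAt ℝ 1 (onEvents f) p) :
    ContinuousOn (fun w : E3 × S2 × ℝ => fderiv ℝ (srcFun f w.1 t) (z w.2.1 w.2.2, w.2.2))
      (regularSet z t) := by
  intro w hw
  have h := continuousAt_fderiv_param (f := fun x => srcFun f x t) (contDiffAt_param hf ht hw)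
  exact h.comp_continuousWithinAt (f := eventMap z) (H.continuousOn_event ht w hw)

lemma continuousOn_fderiv_fderiv_src (H : IsDoubleLayerSetting T c Ωm z σ η A μ) (ht : t < T)
    {f : E3 → ℝ → E3 → ℝ → ℝ} (hf : ∀ p ∈ properPairs T, ContDiffAt ℝ 2 (onEvents f) p) :
    ContinuousOn (fun w : E3 × S2 × ℝ =>
      fderiv ℝ (fderiv ℝ (srcFun f w.1 t)) (z w.2.1 w.2.2, w.2.2)) (regularSet z t) := by
  intro w hw
  have h := continuousAt_fderiv_fderiv_param (f := fun x => srcFun f x t) (contDiffAt_param hf ht hw)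
  exact h.comp_continuousWithinAt (f := eventMap z) (H.continuousOn_event ht w hw)

lemma continuousOn_kernelForm {X : Type*} [TopologicalSpace X] {s : Set X}
    {aN a a' g g' h h' h'' m m' : X → ℝ} (caN : ContinuousOn aN s) (ca : ContinuousOn a s)
    (ca' : ContinuousOn a' s) (cg : ContinuousOn g s) (cg' : ContinuousOn g' s)
    (ch : ContinuousOn h s) (ch' : ContinuousOn h' s) (ch'' : ContinuousOn h'' s)
    (cm : ContinuousOn m s) (cm' : ContinuousOn m' s) (h0 : ∀ x ∈ s, h x ≠ 0)
    (hq : ∀ x ∈ s, 1 + h' x ≠ 0) :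
    ContinuousOn (fun x => kernelForm (aN x) (a x) (a' x) (g x) (g' x) (h x) (h' x) (h'' x) (m x)
      (m' x)) s := by
  have cq : ContinuousOn (fun x => 1 + h' x) s := continuousOn_const.add ch'
  have hc : ContinuousOn (fun x => h x * (1 + h' x)) s := ch.mul cq
  have hc0 : ∀ x ∈ s, h x * (1 + h' x) ≠ 0 := fun x hx => mul_ne_zero (h0 x hx) (hq x hx)
  have hd : ContinuousOn (fun x => h x ^ 2 * (1 + h' x)) s := (ch.pow 2).mul cq
  have hd0 : ∀ x ∈ s, h x ^ 2 * (1 + h' x) ≠ 0 := fun x hx =>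
    mul_ne_zero (pow_ne_zero 2 (h0 x hx)) (hq x hx)
  have he : ContinuousOn (fun x => h x * (1 + h' x) ^ 2) s := ch.mul (cq.pow 2)
  have he0 : ∀ x ∈ s, h x * (1 + h' x) ^ 2 ≠ 0 := fun x hx =>
    mul_ne_zero (h0 x hx) (pow_ne_zero 2 (hq x hx))
  have hF : ContinuousOn (fun x => a x * g x * m x) s := (ca.mul cg).mul cm
  have hF' : ContinuousOn (fun x => a' x * g x * m x + a x * g' x * m x + a x * g x * m' x) s :=
    (((ca'.mul cg).mul cm).add ((ca.mul cg').mul cm)).add ((ca.mul cg).mul cm')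
  unfold kernelForm
  exact continuousOn_const.mul ((((caN.mul cm).div hc hc0).sub
    ((((hF'.div hc hc0).sub ((hF.mul ch').div hd hd0)).sub ((hF.mul ch'').div he he0)).div cq hq)).sub
      (hF.div hd hd0))

lemma continuousOn_retardedKernel (H : IsDoubleLayerSetting T c Ωm z σ η A μ) (ht : t < T) :
    ContinuousOn (fun w : E3 × S2 × ℝ => retardedKernel z σ η A μ w.1 t w.2.1 w.2.2)
      (regularSet z t) := by
  have hη2 := H.travelTime.contDiffAt
  have hη1 : ∀ p ∈ properPairs T, ContDiffAt ℝ 1 (onEvents η) p :=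
    fun p hp => (hη2 p hp).of_le (by norm_num)
  have hA1 : ∀ p ∈ properPairs T, ContDiffAt ℝ 1 (onEvents A) p :=
    fun p hp => (H.amplitude.contDiffAt p hp).of_le (by exact_mod_cast le_top)
  have cA := H.continuousOn_fderiv_src ht hA1
  have cη := H.continuousOn_fderiv_src ht hη1
  have cηη := H.continuousOn_fderiv_fderiv_src ht hη2
  have cN := continuousOn_regularSet (z := z) ht H.contDiff_normal
  have cV := continuousOn_regularSet (z := z) ht H.contDiff_velocity
  have cJ := continuousOn_regularSet (z := z) ht H.contDiff_surfJ
  have cμ := continuousOn_regularSet (z := z) ht H.contDiff_density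
  have cN' := continuousOn_regularSet (z := z) ht (ContDiffOnSphere.timeDeriv (k := 0) H.contDiff_normal)
  have cV' := continuousOn_regularSet (z := z) ht (ContDiffOnSphere.timeDeriv (k := 0) H.contDiff_velocity)
  have cJ' := continuousOn_regularSet (z := z) ht (ContDiffOnSphere.timeDeriv (k := 0) H.contDiff_surfJ)
  have cμ' := continuousOn_regularSet (z := z) ht (ContDiffOnSphere.timeDeriv (k := 0) H.contDiff_density)
  have ca : ContinuousOn (fun w : E3 × S2 × ℝ => A w.1 t (z w.2.1 w.2.2) w.2.2)
      (regularSet z t) := fun w hw =>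
    (contDiffAt_param hA1 ht hw).continuousAt.comp_continuousWithinAt (f := eventMap z)
      (H.continuousOn_event ht w hw)
  have ch : ContinuousOn (fun w : E3 × S2 × ℝ => η w.1 t (z w.2.1 w.2.2) w.2.2)
      (regularSet z t) := fun w hw =>
    (contDiffAt_param hη1 ht hw).continuousAt.comp_continuousWithinAt (f := eventMap z)
      (H.continuousOn_event ht w hw)
  have hh : ∀ w ∈ regularSet z t, η w.1 t (z w.2.1 w.2.2) w.2.2 ≠ 0 := fun w hw h0 =>
    hw.2.2 ((H.travelTime.eq_zero_iff _ _ _ _ hw.1 hw.2.1.le ht).1 h0)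
  have c1 : ContinuousOn (fun w : E3 × S2 × ℝ => totalDeriv η z w.1 t w.2.1 w.2.2)
      (regularSet z t) := cη.clm_apply (cV.prodMk continuousOn_const)
  have hq : ∀ w ∈ regularSet z t, 1 + totalDeriv η z w.1 t w.2.1 w.2.2 ≠ 0 := fun w hw =>
    (H.travelTime.nondegenerate _ _ _ _ hw.1 hw.2.1 ht hw.2.2).ne'
  have cA1 : ContinuousOn (fun w : E3 × S2 × ℝ => totalDeriv A z w.1 t w.2.1 w.2.2)
      (regularSet z t) := cA.clm_apply (cV.prodMk continuousOn_const)
  have cAN : ContinuousOn (fun w : E3 × S2 × ℝ => fderiv ℝ (srcFun A w.1 t) (z w.2.1 w.2.2, w.2.2)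
      (unitNormal z σ w.2.1 w.2.2, 0)) (regularSet z t) :=
    cA.clm_apply (cN.prodMk continuousOn_const)
  have cg : ContinuousOn (fun w : E3 × S2 × ℝ => fderiv ℝ (srcFun η w.1 t) (z w.2.1 w.2.2, w.2.2)
      (unitNormal z σ w.2.1 w.2.2, 0)) (regularSet z t) :=
    cη.clm_apply (cN.prodMk continuousOn_const)
  have cg' : ContinuousOn (fun w : E3 × S2 × ℝ => alongCurve η z w.1 t w.2.1 w.2.2
      (unitNormal z σ w.2.1 w.2.2, 0) (timeDeriv (unitNormal z σ) w.2.1 w.2.2, 0))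
      (regularSet z t) :=
    ((cηη.clm_apply (cV.prodMk continuousOn_const)).clm_apply (cN.prodMk continuousOn_const)).add
      (cη.clm_apply (cN'.prodMk continuousOn_const))
  have ch' : ContinuousOn (fun w : E3 × S2 × ℝ => alongCurve η z w.1 t w.2.1 w.2.2
      (velocity z w.2.1 w.2.2, 1) (timeDeriv (velocity z) w.2.1 w.2.2, 0)) (regularSet z t) :=
    ((cηη.clm_apply (cV.prodMk continuousOn_const)).clm_apply (cV.prodMk continuousOn_const)).add
      (cη.clm_apply (cV'.prodMk continuousOn_const))
  have cm := cμ.mul cJ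
  have cm' := (cμ'.mul cJ).add (cμ.mul cJ')
  exact continuousOn_kernelForm cAN ca cA1 cg cg' ch c1 ch' cm cm' hh hq

/-- The kernel is linear in the weight and its time derivative, and both vanish at τ = 0: the left
derivative of μ is zero by causality, and μ is differentiable across 0. This is what makes the
default value 0 of the retarded time consistent with a vanishing density. -/
lemma retardedKernel_zero (H : IsDoubleLayerSetting T c Ωm z σ η A μ) (hT : 0 < T) :
    retardedKernel z σ η A μ x t β 0 = 0 := by
  have h0 : μ β 0 = 0 := H.density.causal β 0 le_rfl
  have h1 : timeDeriv μ β 0 = 0 := by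
    have hμ : DifferentiableAt ℝ (μ β) 0 := by
      have h2 : ContDiffAt ℝ 1 (rayExt μ) ((β : E3), 0) :=
        ContDiffOn.contDiffAt H.density.contDiff
          (prod_mem_nhds (isOpen_compl_singleton.mem_nhds (S2.coe_ne_zero β)) (Iio_mem_nhds hT))
      have h3 := (h2.differentiableAt (by norm_num)).comp (0 : ℝ)
        (f := fun s : ℝ => ((β : E3), s)) (by fun_prop)
      simpa [Function.comp_def, rayExt] using h3
    have h4 : derivWithin (μ β) (Iic 0) 0 = 0 := by
      rw [derivWithin_congr (f := fun _ => (0 : ℝ)) (s := Iic 0) (fun s hs => H.density.causal β s hs) h0]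
      simp
    rw [timeDeriv, hμ.derivWithin (uniqueDiffOn_Ici 0 0 self_mem_Ici),
      ← hμ.derivWithin (uniqueDiffOn_Iic 0 0 self_mem_Iic), h4]
  simp [retardedKernel, kernelForm, h0, h1]

/-- Away from the singularity the density is the closed form at the retarded time. -/
lemma doubleLayerDensity_eq_retardedKernel (H : IsDoubleLayerSetting T c Ωm z σ η A μ)
    (ht : t ∈ Ioo 0 T) (hx : x ≠ z β t) : doubleLayerDensity z σ η A μ x t β
      = retardedKernel z σ η A μ x t β (retardedTime z η x t β) := by
  rcases H.retardedTime_cases ht hx with h | h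
  · exact H.doubleLayerDensity_eq ht.2 h.1 h.2
  · rw [doubleLayerDensity_eq_zero h.2.2, h.1, H.retardedKernel_zero (ht.1.trans ht.2)]

lemma continuousOn_doubleLayerDensity (H : IsDoubleLayerSetting T c Ωm z σ η A μ)
    (ht : t ∈ Ioo 0 T) :
    ContinuousOn (fun w : E3 × S2 => doubleLayerDensity z σ η A μ w.1 t w.2)
      {w | w.1 ≠ z w.2 t} := by
  have h : ContinuousOn (fun w : E3 × S2 => (w.1, w.2, retardedTime z η w.1 t w.2))
      {w | w.1 ≠ z w.2 t} := fun w hw => continuousWithinAt_fst.prodMk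
    (continuousWithinAt_snd.prodMk (H.continuousWithinAt_retardedTime ht hw))
  refine ((H.continuousOn_retardedKernel ht.2).comp h fun w hw => ?_).congr fun w hw =>
    H.doubleLayerDensity_eq_retardedKernel ht hw
  have := H.retardedTime_mem ht hw
  exact ⟨this.1, this.2, H.ne_retarded ht hw⟩

end IsDoubleLayerSetting

/-! ### Comparison of functions up to a relative error -/

section CloseTo

open Asymptotics

variable {ι E : Type*} [NormedAddCommGroup E] {l : Filter ι} {r : ι → ℝ}

/-- `f` agrees with the bounded function `f₀` up to `O(r)`. -/
structure CloseTo (l : Filter ι) (r : ι → ℝ) (f f₀ : ι → E) : Prop where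
  sub : (fun w => f w - f₀ w) =O[l] r
  bdd : f₀ =O[l] (fun _ => (1 : ℝ))

namespace CloseTo

lemma isBigO_one (hr : Tendsto r l (𝓝 0)) {f f₀ : ι → E} (h : CloseTo l r f f₀) :
    f =O[l] (fun _ => (1 : ℝ)) := by
  have h1 : r =O[l] (fun _ => (1 : ℝ)) := hr.isBigO_one ℝ
  simpa using (h.sub.trans h1).add h.bdd

lemma refl {f : ι → E} (h : f =O[l] (fun _ => (1 : ℝ))) : CloseTo l r f f :=
  ⟨by simpa using isBigO_zero r l, h⟩

lemma const (a : E) : CloseTo l r (fun _ => a) (fun _ => a) :=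
  refl (isBigO_const_const a one_ne_zero l)

lemma of_isBigO {f : ι → E} (h : f =O[l] r) : CloseTo l r f (fun _ => 0) :=
  ⟨by simpa using h, isBigO_zero _ _⟩

lemma congr_left {f g f₀ : ι → E} (h : CloseTo l r f f₀) (hfg : f =ᶠ[l] g) : CloseTo l r g f₀ :=
  ⟨h.sub.congr' (by filter_upwards [hfg] with w hw; rw [hw]) EventuallyEq.rfl, h.bdd⟩

lemma congr_right {f f₀ g₀ : ι → E} (h : CloseTo l r f f₀) (hfg : f₀ =ᶠ[l] g₀) : CloseTo l r f g₀ :=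
  ⟨h.sub.congr' (by filter_upwards [hfg] with w hw; rw [hw]) EventuallyEq.rfl,
    h.bdd.congr' hfg EventuallyEq.rfl⟩

lemma add {f g f₀ g₀ : ι → E} (hf : CloseTo l r f f₀) (hg : CloseTo l r g g₀) :
    CloseTo l r (fun w => f w + g w) (fun w => f₀ w + g₀ w) :=
  ⟨(hf.sub.add hg.sub).congr_left fun w => by abel, hf.bdd.add hg.bdd⟩

lemma neg {f f₀ : ι → E} (hf : CloseTo l r f f₀) :
    CloseTo l r (fun w => -f w) (fun w => -f₀ w) :=
  ⟨hf.sub.neg_left.congr_left fun w => by abel, hf.bdd.neg_left⟩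

lemma sub' {f g f₀ g₀ : ι → E} (hf : CloseTo l r f f₀) (hg : CloseTo l r g g₀) :
    CloseTo l r (fun w => f w - g w) (fun w => f₀ w - g₀ w) := by
  simpa [sub_eq_add_neg] using hf.add hg.neg

lemma mul (hr : Tendsto r l (𝓝 0)) {f g f₀ g₀ : ι → ℝ} (hf : CloseTo l r f f₀)
    (hg : CloseTo l r g g₀) : CloseTo l r (fun w => f w * g w) (fun w => f₀ w * g₀ w) := by
  refine ⟨?_, by simpa using hf.bdd.mul hg.bdd⟩
  have h1 : (fun w => (f w - f₀ w) * g w) =O[l] r := by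
    simpa using hf.sub.mul (hg.isBigO_one hr)
  have h2 : (fun w => f₀ w * (g w - g₀ w)) =O[l] r := by simpa using hf.bdd.mul hg.sub
  exact (h1.add h2).congr_left fun w => by ring

lemma inner' [InnerProductSpace ℝ E] (hr : Tendsto r l (𝓝 0)) {f g f₀ g₀ : ι → E}
    (hf : CloseTo l r f f₀) (hg : CloseTo l r g g₀) :
    CloseTo l r (fun w => ⟪f w, g w⟫) (fun w => ⟪f₀ w, g₀ w⟫) := by
  have key : ∀ {a b : ι → E} {p q : ι → ℝ}, a =O[l] p → b =O[l] q →
      (fun w => ⟪a w, b w⟫) =O[l] fun w => p w * q w := by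
    intro a b p q ha hb
    refine (IsBigO.of_bound 1 (Eventually.of_forall fun w => ?_)).trans (ha.norm_left.mul hb.norm_left)
    rw [one_mul, norm_mul, norm_norm, norm_norm]
    exact norm_inner_le_norm _ _
  refine ⟨?_, by simpa using key hf.bdd hg.bdd⟩
  have h1 : (fun w => ⟪f w - f₀ w, g w⟫) =O[l] r := by
    simpa using key hf.sub (hg.isBigO_one hr)
  have h2 : (fun w => ⟪f₀ w, g w - g₀ w⟫) =O[l] r := by simpa using key hf.bdd hg.sub
  exact (h1.add h2).congr_left fun w => by simp [inner_sub_left, inner_sub_right]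

lemma eventually_le (hr : Tendsto r l (𝓝 0)) {f f₀ : ι → ℝ} {a b : ℝ} (hab : a < b)
    (hf : CloseTo l r f f₀) (h : ∀ᶠ w in l, b ≤ f₀ w) : ∀ᶠ w in l, a ≤ f w := by
  have h1 : Tendsto (fun w => f w - f₀ w) l (𝓝 0) := hf.sub.trans_tendsto hr
  filter_upwards [h, h1.eventually (lt_mem_nhds (show a - b < 0 by linarith))] with w hw hw'
  linarith

lemma inv (hr : Tendsto r l (𝓝 0)) {f f₀ : ι → ℝ} {b : ℝ} (hb : 0 < b)
    (hf : CloseTo l r f f₀) (h : ∀ᶠ w in l, b ≤ f₀ w) :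
    CloseTo l r (fun w => (f w)⁻¹) (fun w => (f₀ w)⁻¹) := by
  have h1 := hf.eventually_le hr (half_lt_self hb) h
  have hO : ∀ {g : ι → ℝ} {a : ℝ}, 0 < a → (∀ᶠ w in l, a ≤ g w) →
      (fun w => (g w)⁻¹) =O[l] (fun _ => (1 : ℝ)) := by
    intro g a ha hg
    refine IsBigO.of_bound a⁻¹ ?_
    filter_upwards [hg] with w hw
    rw [norm_inv, norm_one, mul_one, Real.norm_of_nonneg (ha.le.trans hw)]
    exact inv_anti₀ ha hw
  refine ⟨?_, hO hb h⟩
  have h2 : (fun w => (f₀ w - f w) * (f w)⁻¹ * (f₀ w)⁻¹) =O[l] r := by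
    simpa using ((hf.sub.neg_left.congr_left fun w => by ring).mul
      (hO (half_pos hb) h1)).mul (hO hb h)
  refine h2.congr' ?_ EventuallyEq.rfl
  filter_upwards [h, h1] with w hw hw'
  have := (hb.trans_le hw).ne'
  have := ((half_pos hb).trans_le hw').ne'
  field_simp

lemma sqrt (hr : Tendsto r l (𝓝 0)) {f f₀ : ι → ℝ} {b : ℝ} (hb : 0 < b)
    (hf : CloseTo l r f f₀) (h : ∀ᶠ w in l, b ≤ f₀ w) :
    CloseTo l r (fun w => √(f w)) (fun w => √(f₀ w)) := by
  have h1 := hf.eventually_le hr (half_lt_self hb) h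
  refine ⟨?_, ?_⟩
  · refine IsBigO.trans (IsBigO.of_bound (√b)⁻¹ ?_) hf.sub
    filter_upwards [h, h1] with w hw hw'
    have h0 : 0 ≤ f w := (half_pos hb).le.trans hw'
    -- Difference of squares: the sum of the two roots is at least √b, so the difference of the
    -- roots is at most |f − f₀|/√b.
    have h2 : f w - f₀ w = (√(f w) - √(f₀ w)) * (√(f w) + √(f₀ w)) := by
      ring_nf; rw [Real.sq_sqrt h0, Real.sq_sqrt (hb.le.trans hw)]
    have h3 : √b ≤ √(f w) + √(f₀ w) := by
      have := Real.sqrt_le_sqrt hw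
      linarith [Real.sqrt_nonneg (f w)]
    have h4 : 0 < √b := Real.sqrt_pos.mpr hb
    rw [h2, norm_mul, Real.norm_of_nonneg (h4.le.trans h3), ← div_eq_inv_mul, le_div_iff₀ h4]
    gcongr
  · have h2 : (fun w => 1 + |f₀ w|) =O[l] (fun _ => (1 : ℝ)) :=
      (isBigO_refl _ _).add hf.bdd.norm_left
    refine IsBigO.trans (IsBigO.of_bound 1 (Eventually.of_forall fun w => ?_)) h2
    rw [one_mul, Real.norm_of_nonneg (Real.sqrt_nonneg _), Real.norm_of_nonneg (by positivity)]
    apply Real.sqrt_le_iff.mpr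
    constructor
    · positivity
    · nlinarith [abs_nonneg (f₀ w), le_abs_self (f₀ w)]

end CloseTo

end CloseTo

/-! ### Second order Taylor estimate -/

/-- The derivative is differentiable at x₀, hence it varies by O(‖y − x₀‖) there; the mean value
inequality on the segment supplies the second power. -/
lemma ContDiffAt.isBigO_sub_sub_fderiv {E F : Type*} [NormedAddCommGroup E] [NormedSpace ℝ E]
    [NormedAddCommGroup F] [NormedSpace ℝ F] {f : E → F} {x₀ : E} (hf : ContDiffAt ℝ 2 f x₀) :
    (fun x => f x - f x₀ - fderiv ℝ f x₀ (x - x₀)) =O[𝓝 x₀] fun x => ‖x - x₀‖ ^ 2 := by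
  have h1 : DifferentiableAt ℝ (fderiv ℝ f) x₀ :=
    (hf.fderiv_right (m := 1) (by norm_num)).differentiableAt (by norm_num)
  obtain ⟨C, hC⟩ := h1.hasFDerivAt.isBigO_sub.bound
  have h2 : ∀ᶠ x in 𝓝 x₀, DifferentiableAt ℝ f x :=
    (hf.eventually (by simp)).mono fun x hx => hx.differentiableAt (by norm_num)
  obtain ⟨ρ, hρ, hball⟩ := Metric.eventually_nhds_iff_ball.1 (hC.and h2)
  refine Asymptotics.IsBigO.of_bound C ?_
  filter_upwards [Metric.ball_mem_nhds x₀ hρ] with x hx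
  have hseg : segment ℝ x₀ x ⊆ Metric.ball x₀ ρ :=
    (convex_ball x₀ ρ).segment_subset (Metric.mem_ball_self hρ) hx
  have h3 := (convex_segment x₀ x).norm_image_sub_le_of_norm_fderiv_le' (𝕜 := ℝ) (f := f)
    (φ := fderiv ℝ f x₀) (C := C * ‖x - x₀‖) (fun y hy => (hball y (hseg hy)).2) (fun y hy => ?_)
    (left_mem_segment ℝ x₀ x) (right_mem_segment ℝ x₀ x)
  · calc _ ≤ C * ‖x - x₀‖ * ‖x - x₀‖ := h3
      _ = _ := by rw [norm_pow, norm_norm]; ring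
  · refine (hball y (hseg hy)).1.trans ?_
    -- The constant extracted from the O-bound need not be nonnegative; a negative one can only
    -- occur where the norms vanish.
    have hC0 : 0 ≤ C ∨ ‖y - x₀‖ = 0 := by
      by_contra! hcon
      have := (norm_nonneg _).trans (hball y (hseg hy)).1
      have h5 : 0 < ‖y - x₀‖ := lt_of_le_of_ne (norm_nonneg _) hcon.2.symm
      nlinarith [hcon.1]
    obtain ⟨a, b, ha, hb, hab, rfl⟩ := hy
    have h4 : a • x₀ + b • x - x₀ = b • (x - x₀) := by
      rw [show a = 1 - b by linarith]; module
    have hb1 : b ≤ 1 := by linarith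
    rcases hC0 with h | h
    · gcongr
      rw [h4, norm_smul, Real.norm_of_nonneg hb]
      exact mul_le_of_le_one_left (norm_nonneg _) hb1
    · rw [h, mul_zero]
      by_contra! hneg
      have hx0 : 0 < ‖x - x₀‖ := by
        rcases (norm_nonneg (x - x₀)).eq_or_lt with h6 | h6
        · rw [← h6] at hneg; simp at hneg
        · exact h6
      have := (norm_nonneg _).trans (hball x hx).1
      nlinarith

/-! ### The model travel time -/

/-- The leading part `κ(y,τ) |x - y|` of the travel time. -/
noncomputable def modelTime (c : E3 → ℝ → ℝ) (x : E3) (_ : ℝ) (y : E3) (τ : ℝ) : ℝ :=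
  slowness c y τ * ‖x - y‖

/-- The remainder of the travel time, as a kernel. -/
noncomputable def remainderTime (c : E3 → ℝ → ℝ) (η : E3 → ℝ → E3 → ℝ → ℝ) (x : E3) (t : ℝ) (y : E3)
    (τ : ℝ) : ℝ :=
  diagRemainder c η x t (y, τ)

section Model

variable {T t τ : ℝ} {c : E3 → ℝ → ℝ} {z : S2 → ℝ → E3} {x : E3} {β : S2}

lemma IsSoundSpeed.contDiffAt_slowness (hc : IsSoundSpeed T c) (y : E3) (hτ : τ ∈ Ico 0 T) :
    ContDiffAt ℝ ∞ (fun q : E3 × ℝ => slowness c q.1 q.2) (y, τ) :=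
  contDiffAt_const.div (hc.smooth y τ hτ) (hc.pos y τ hτ).ne'

lemma hasDerivAt_norm_sub {y : ℝ → E3} {v : E3} (hy : HasDerivAt y v τ) (hne : x ≠ y τ) :
    HasDerivAt (fun s => ‖x - y s‖) (-(⟪x - y τ, v⟫ / ‖x - y τ‖)) τ := by
  have h0 : x - y τ ≠ 0 := sub_ne_zero.mpr hne
  have h := ((hy.const_sub x).norm_sq).sqrt (by positivity)
  have he : (fun s => ‖x - y s‖) = fun s => √(‖x - y s‖ ^ 2) := by
    ext s; rw [Real.sqrt_sq (norm_nonneg _)]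
  rw [he]
  convert h using 1
  rw [Real.sqrt_sq (norm_nonneg _), inner_neg_right]
  have := norm_ne_zero_iff.mpr h0
  field_simp

lemma hasFDerivAt_norm_sub_fst {q : E3 × ℝ} (hne : x ≠ q.1) :
    HasFDerivAt (fun q : E3 × ℝ => ‖x - q.1‖)
      (-(‖x - q.1‖⁻¹ • (innerSL ℝ (x - q.1)).comp (.fst ℝ E3 ℝ))) q := by
  have h0 : x - q.1 ≠ 0 := sub_ne_zero.mpr hne
  have h1 : HasFDerivAt (fun q : E3 × ℝ => x - q.1) (-(ContinuousLinearMap.fst ℝ E3 ℝ)) q :=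
    hasFDerivAt_fst.const_sub x
  have h := (h1.norm_sq).sqrt (by positivity)
  have he : (fun q : E3 × ℝ => ‖x - q.1‖) = fun q => √(‖x - q.1‖ ^ 2) := by
    ext s; rw [Real.sqrt_sq (norm_nonneg _)]
  rw [he]
  refine h.congr_fderiv ?_
  rw [Real.sqrt_sq (norm_nonneg _)]
  have := norm_ne_zero_iff.mpr h0
  ext v
  · simp
    field_simp
    ring
  · simp

lemma contDiffAt_src_modelTime (hc : IsSoundSpeed T c) {q : E3 × ℝ} (hτ : q.2 ∈ Ico 0 T)
    (hne : x ≠ q.1) : ContDiffAt ℝ 2 (srcFun (modelTime c) x t) q := by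
  have h1 : ContDiffAt ℝ 2 (fun q : E3 × ℝ => slowness c q.1 q.2) q :=
    (hc.contDiffAt_slowness q.1 hτ).of_le (WithTop.coe_le_coe.2 (le_top : (2 : ℕ∞) ≤ ⊤))
  have h2 : ContDiffAt ℝ 2 (fun q : E3 × ℝ => ‖x - q.1‖) q :=
    (contDiffAt_const.sub contDiffAt_fst).norm ℝ (sub_ne_zero.mpr hne)
  exact h1.mul h2

lemma fderiv_src_modelTime (hc : IsSoundSpeed T c) {q : E3 × ℝ} (hτ : q.2 ∈ Ico 0 T)
    (hne : x ≠ q.1) (v : E3 × ℝ) :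
    fderiv ℝ (srcFun (modelTime c) x t) q v
      = fderiv ℝ (fun q : E3 × ℝ => slowness c q.1 q.2) q v * ‖x - q.1‖
        - slowness c q.1 q.2 * (⟪x - q.1, v.1⟫ / ‖x - q.1‖) := by
  have h1 : DifferentiableAt ℝ (fun q : E3 × ℝ => slowness c q.1 q.2) q :=
    (hc.contDiffAt_slowness q.1 hτ).differentiableAt (by simp)
  have h := (h1.hasFDerivAt.mul (hasFDerivAt_norm_sub_fst hne)).fderiv
  have h' : fderiv ℝ (srcFun (modelTime c) x t) q = _ := h
  rw [h']
  simp only [_root_.add_apply, _root_.smul_apply, smul_eq_mul,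
    _root_.neg_apply, ContinuousLinearMap.comp_apply, ContinuousLinearMap.coe_fst',
    innerSL_apply_apply]
  ring

/-- The slowness as a kernel that ignores the observation event. -/
noncomputable def slownessKernel (c : E3 → ℝ → ℝ) (_ : E3) (_ : ℝ) (y : E3) (τ : ℝ) : ℝ :=
  slowness c y τ

/-- No Hessian of κ|x − y| is computed. The left side is the derivative at τ of the first
differential applied to (Y, b) along the trajectory; differentiating the closed form
`fderiv_src_modelTime` along the same curve gives the right side, and derivatives are unique. -/
lemma alongCurve_modelTime (hc : IsSoundSpeed T c) (hz : ContDiffOnSphere 2 z (Ico 0 T))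
    (hτ : τ ∈ Ioo 0 T) (hne : x ≠ z β τ) {Y : ℝ → E3} {Y₁ : E3} (hY : HasDerivAt Y Y₁ τ) (b : ℝ) :
    alongCurve (modelTime c) z x t β τ (Y τ, b) (Y₁, 0)
      = alongCurve (slownessKernel c) z x t β τ (Y τ, b) (Y₁, 0) * ‖x - z β τ‖
        - fderiv ℝ (srcFun (slownessKernel c) x t) (z β τ, τ) (Y τ, b)
            * (⟪x - z β τ, velocity z β τ⟫ / ‖x - z β τ‖)
        - totalDeriv (slownessKernel c) z x t β τ * (⟪x - z β τ, Y τ⟫ / ‖x - z β τ‖)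
        - slowness c (z β τ) τ * ((⟪x - z β τ, Y₁⟫ - ⟪velocity z β τ, Y τ⟫) / ‖x - z β τ‖
            + ⟪x - z β τ, Y τ⟫ * ⟪x - z β τ, velocity z β τ⟫ / ‖x - z β τ‖ ^ 3) := by
  have hzd : HasDerivAt (z β) (velocity z β τ) τ := hz.hasDerivAt (by norm_num) β hτ
  have h0 : ‖x - z β τ‖ ≠ 0 := norm_ne_zero_iff.mpr (sub_ne_zero.mpr hne)
  have hX : HasDerivAt (fun s => (Y s, b)) (Y₁, 0) τ := hY.prodMk (hasDerivAt_const _ _)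
  have hτ' : τ ∈ Ico 0 T := ⟨hτ.1.le, hτ.2⟩
  have hκ : ContDiffAt ℝ 2 (srcFun (slownessKernel c) x t) (z β τ, τ) :=
    (hc.contDiffAt_slowness (z β τ) hτ').of_le (WithTop.coe_le_coe.2 (le_top : (2 : ℕ∞) ≤ ⊤))
  have hm := hasDerivAt_fderiv_sourceCurve hz hτ
    (contDiffAt_src_modelTime (t := t) (q := (z β τ, τ)) hc hτ' hne) hX
  have hK := hasDerivAt_fderiv_sourceCurve hz hτ hκ hX
  have hr := hasDerivAt_norm_sub hzd hne
  have hk := hasDerivAt_comp_sourceCurve hz hτ (hκ.differentiableAt (by norm_num))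
  have hi : HasDerivAt (fun s => ⟪x - z β s, Y s⟫) (⟪x - z β τ, Y₁⟫ - ⟪velocity z β τ, Y τ⟫) τ := by
    have := (hzd.const_sub x).inner ℝ hY
    simpa [sub_eq_add_neg] using this
  have hall := (hK.mul hr).sub (hk.mul (hi.div hr h0))
  have hev : ∀ᶠ s in 𝓝 τ, s ∈ Ico 0 T ∧ x ≠ z β s :=
    (show ∀ᶠ s in 𝓝 τ, s ∈ Ico 0 T from Ico_mem_nhds hτ.1 hτ.2).and
      ((hzd.continuousAt.eventually_ne hne.symm).mono fun _ h => h.symm)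
  have hu := hm.unique (hall.congr_of_eventuallyEq (by
    filter_upwards [hev] with s hs
    exact fderiv_src_modelTime hc (q := (z β s, s)) hs.1 hs.2 _))
  rw [hu]
  simp only [slownessKernel, Pi.div_apply]
  field_simp
  ring

end Model

/-! ### The frame of the surface at a point -/

section Frame

variable {T t : ℝ} {z : S2 → ℝ → E3} {σ : ℝ} {α : S2}

/-- The derivative at `α` of the radially constant extension of `z(·, t)`. -/
noncomputable def surfDeriv (z : S2 → ℝ → E3) (α : S2) (t : ℝ) : E3 →L[ℝ] E3 :=
  fderiv ℝ (fun p : E3 => z (toS2 p) t) (α : E3)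

/-- The linear map with `v ↦ Dz v` on the tangent plane of the sphere and `α ↦ N`. -/
noncomputable def frameMap (z : S2 → ℝ → E3) (σ : ℝ) (α : S2) (t : ℝ) : E3 →L[ℝ] E3 :=
  surfDeriv z α t + (innerSL ℝ (α : E3)).smulRight (unitNormal z σ α t)

lemma frameMap_apply (v : E3) :
    frameMap z σ α t v = surfDeriv z α t v + ⟪(α : E3), v⟫ • unitNormal z σ α t := by
  simp [frameMap]

lemma S2.inner_self (α : S2) : ⟪(α : E3), (α : E3)⟫ = 1 := by
  rw [real_inner_self_eq_norm_sq, S2.norm_coe]; norm_num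

lemma cross_inner_left (u v : E3) : ⟪cross u v, u⟫ = 0 := by
  rw [E3.inner_eq]; simp; ring

lemma cross_inner_right (u v : E3) : ⟪cross u v, v⟫ = 0 := by
  rw [E3.inner_eq]; simp; ring

lemma norm_sq_cross (u v : E3) : ‖cross u v‖ ^ 2 = ‖u‖ ^ 2 * ‖v‖ ^ 2 - ⟪u, v⟫ ^ 2 := by
  simp only [← real_inner_self_eq_norm_sq, E3.inner_eq]; simp; ring

/-- The extension is constant along the ray through α. -/
lemma surfDeriv_self (hz : ContDiffOnSphere 2 z (Ico 0 T)) (ht : t ∈ Ico 0 T) :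
    surfDeriv z α t (α : E3) = 0 := by
  have h := (hz.hasFDerivAt_space (by norm_num) α ht).differentiableAt.hasFDerivAt
  have h1 : HasDerivAt (fun s : ℝ => s • (α : E3)) (α : E3) 1 := by
    simpa using (hasDerivAt_id (1 : ℝ)).smul_const (α : E3)
  have h2 := HasFDerivAt.comp_hasDerivAt_of_eq (1 : ℝ) h h1 (by simp)
  have h3 : ((fun p : E3 => z (toS2 p) t) ∘ fun s : ℝ => s • (α : E3)) =ᶠ[𝓝 1] fun _ => z α t := by
    filter_upwards [lt_mem_nhds (zero_lt_one (α := ℝ))] with s hs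
    simp [toS2_smul hs (S2.coe_ne_zero α)]
  exact (h2.congr_of_eventuallyEq h3.symm).unique (hasDerivAt_const _ _)

lemma surfDeriv_apply (v : E3) :
    surfDeriv z α t v = v 0 • dz z α t 0 + v 1 • dz z α t 1 + v 2 • dz z α t 2 := by
  have hv : v = v 0 • EuclideanSpace.single 0 (1 : ℝ) + v 1 • EuclideanSpace.single 1 (1 : ℝ)
      + v 2 • EuclideanSpace.single 2 (1 : ℝ) := by
    apply E3.ext <;> simp
  conv_lhs => rw [hv]
  simp only [map_add, map_smul]
  rfl

/-- The relation Dz(α) = 0 is a linear dependence among the three partial derivatives with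
coefficients α. It forces each coordinate of their pairwise cross products to form a vector parallel
to α, so only the component of u × v along α survives. -/
lemma cross_surfDeriv (hz : ContDiffOnSphere 2 z (Ico 0 T)) (ht : t ∈ Ico 0 T) (u v : E3) :
    cross (surfDeriv z α t u) (surfDeriv z α t v) = ⟪cross u v, (α : E3)⟫ • areaVector z α t := by
  have h0 := surfDeriv_self (α := α) hz ht
  have h1 := S2.inner_self α
  rw [surfDeriv_apply] at h0
  rw [E3.inner_eq] at h1
  simp only [surfDeriv_apply, areaVector, E3.inner_eq, cross_apply_zero, cross_apply_one,
    cross_apply_two]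
  generalize dz z α t 0 = a at *
  generalize dz z α t 1 = b at *
  generalize dz z α t 2 = d at *
  generalize (α : E3) = n at *
  have e0 := congrArg (fun w : E3 => w 0) h0
  have e1 := congrArg (fun w : E3 => w 1) h0
  have e2 := congrArg (fun w : E3 => w 2) h0
  simp only [PiLp.add_apply, PiLp.smul_apply, smul_eq_mul, PiLp.zero_apply] at e0 e1 e2
  -- For C parallel to the unit vector n, w · C = (w · n)(n · C).
  have key : ∀ {w₀ w₁ w₂ C₀ C₁ C₂ : ℝ}, n 1 * C₀ = n 0 * C₁ → n 2 * C₀ = n 0 * C₂ →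
      n 2 * C₁ = n 1 * C₂ → w₀ * C₀ + w₁ * C₁ + w₂ * C₂
        = (w₀ * n 0 + w₁ * n 1 + w₂ * n 2) * (n 0 * C₀ + n 1 * C₁ + n 2 * C₂) := by
    intro w₀ w₁ w₂ C₀ C₁ C₂ r01 r02 r12
    linear_combination -(w₀ * C₀ + w₁ * C₁ + w₂ * C₂) * h1 + (w₀ * n 1 - w₁ * n 0) * r01
      + (w₀ * n 2 - w₂ * n 0) * r02 + (w₁ * n 2 - w₂ * n 1) * r12
  apply E3.ext
  · have r01 : n 1 * cross b d 0 = n 0 * cross d a 0 := by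
      simp; linear_combination d 2 * e1 - d 1 * e2
    have r02 : n 2 * cross b d 0 = n 0 * cross a b 0 := by
      simp; linear_combination b 1 * e2 - b 2 * e1
    have r12 : n 2 * cross d a 0 = n 1 * cross a b 0 := by
      simp; linear_combination a 2 * e1 - a 1 * e2
    have := key (w₀ := u 1 * v 2 - u 2 * v 1) (w₁ := u 2 * v 0 - u 0 * v 2)
      (w₂ := u 0 * v 1 - u 1 * v 0) r01 r02 r12
    simp only [cross_apply_zero, PiLp.add_apply, PiLp.smul_apply, smul_eq_mul] at this ⊢
    linear_combination this
  · have r01 : n 1 * cross b d 1 = n 0 * cross d a 1 := by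
      simp; linear_combination d 0 * e2 - d 2 * e0
    have r02 : n 2 * cross b d 1 = n 0 * cross a b 1 := by
      simp; linear_combination b 2 * e0 - b 0 * e2
    have r12 : n 2 * cross d a 1 = n 1 * cross a b 1 := by
      simp; linear_combination a 0 * e2 - a 2 * e0
    have := key (w₀ := u 1 * v 2 - u 2 * v 1) (w₁ := u 2 * v 0 - u 0 * v 2)
      (w₂ := u 0 * v 1 - u 1 * v 0) r01 r02 r12
    simp only [cross_apply_one, PiLp.add_apply, PiLp.smul_apply, smul_eq_mul] at this ⊢
    linear_combination this
  · have r01 : n 1 * cross b d 2 = n 0 * cross d a 2 := by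
      simp; linear_combination d 1 * e0 - d 0 * e1
    have r02 : n 2 * cross b d 2 = n 0 * cross a b 2 := by
      simp; linear_combination b 0 * e1 - b 1 * e0
    have r12 : n 2 * cross d a 2 = n 1 * cross a b 2 := by
      simp; linear_combination a 1 * e0 - a 0 * e1
    have := key (w₀ := u 1 * v 2 - u 2 * v 1) (w₁ := u 2 * v 0 - u 0 * v 2)
      (w₂ := u 0 * v 1 - u 1 * v 0) r01 r02 r12
    simp only [cross_apply_two, PiLp.add_apply, PiLp.smul_apply, smul_eq_mul] at this ⊢
    linear_combination this

/-- Every unit vector is the last vector of a positively oriented orthonormal basis. -/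
lemma exists_oriented_frame (α : S2) : ∃ e₁ e₂ : E3, ⟪e₁, e₁⟫ = 1 ∧ ⟪e₂, e₂⟫ = 1 ∧ ⟪e₁, e₂⟫ = 0 ∧
    ⟪(α : E3), e₁⟫ = 0 ∧ ⟪(α : E3), e₂⟫ = 0 ∧ cross e₁ e₂ = α := by
  obtain ⟨v, hv⟩ : ∃ v : E3, v ≠ 0 ∧ ⟪(α : E3), v⟫ = 0 := by
    have h1 : Module.finrank ℝ E3 = 3 := by simp
    have h : (ℝ ∙ (α : E3))ᗮ ≠ ⊥ := by
      intro h0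
      have h3 := Submodule.finrank_add_finrank_orthogonal (ℝ ∙ (α : E3))
      rw [h0, finrank_span_singleton (S2.coe_ne_zero α), h1] at h3
      simp at h3
    obtain ⟨v, hv, hv0⟩ := Submodule.exists_mem_ne_zero_of_ne_bot h
    exact ⟨v, hv0, Submodule.mem_orthogonal_singleton_iff_inner_right.1 hv⟩
  have hn := norm_ne_zero_iff.mpr hv.1
  have h11 : ⟪‖v‖⁻¹ • v, ‖v‖⁻¹ • v⟫ = 1 := by
    rw [real_inner_self_eq_norm_sq, norm_smul, norm_inv, norm_norm, inv_mul_cancel₀ hn, one_pow]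
  have h12 : ⟪(α : E3), ‖v‖⁻¹ • v⟫ = 0 := by rw [inner_smul_right, hv.2, mul_zero]
  have hα := S2.inner_self α
  generalize ‖v‖⁻¹ • v = e at h11 h12
  refine ⟨e, cross α e, h11, ?_, ?_, h12, ?_, ?_⟩
  · rw [real_inner_self_eq_norm_sq, norm_sq_cross, ← real_inner_self_eq_norm_sq,
      ← real_inner_self_eq_norm_sq, hα, h11, h12]; norm_num
  · rw [real_inner_comm]; exact cross_inner_right _ _
  · rw [real_inner_comm]; exact cross_inner_left _ _
  · rw [E3.inner_eq] at h11 h12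
    generalize (α : E3) = n at *
    apply E3.ext <;> simp
    · linear_combination n 0 * h11 - e 0 * h12
    · linear_combination n 1 * h11 - e 1 * h12
    · linear_combination n 2 * h11 - e 2 * h12

lemma exists_oriented_basis (α : S2) : ∃ b : OrthonormalBasis (Fin 3) ℝ E3, b 2 = (α : E3) ∧
    cross (b 0) (b 1) = α := by
  obtain ⟨e₁, e₂, h11, h22, h12, h1, h2, hc⟩ := exists_oriented_frame α
  have hα := S2.inner_self α
  have hon : Orthonormal ℝ ![e₁, e₂, (α : E3)] := by
    have n1 : ‖e₁‖ = 1 := by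
      rwa [real_inner_self_eq_norm_sq, pow_eq_one_iff_of_nonneg (norm_nonneg _) two_ne_zero] at h11
    have n2 : ‖e₂‖ = 1 := by
      rwa [real_inner_self_eq_norm_sq, pow_eq_one_iff_of_nonneg (norm_nonneg _) two_ne_zero] at h22
    have h21 := h12
    have h1' := h1
    have h2' := h2
    rw [real_inner_comm] at h21 h1' h2'
    rw [orthonormal_iff_ite]
    intro i j
    fin_cases i <;> fin_cases j <;> simp [n1, n2, h12, h21, h1, h2, h1', h2']
  have hb := coe_basisOfOrthonormalOfCardEqFinrank hon (by simp)
  have hb' : Orthonormal ℝ (basisOfOrthonormalOfCardEqFinrank hon (by simp)) := by rwa [hb]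
  refine ⟨(basisOfOrthonormalOfCardEqFinrank hon (by simp)).toOrthonormalBasis hb', ?_, ?_⟩
  · simp
  · simpa using hc

lemma areaVector_eq_cross (hz : ContDiffOnSphere 2 z (Ico 0 T)) (ht : t ∈ Ico 0 T) {e₁ e₂ : E3}
    (h : cross e₁ e₂ = α) :
    areaVector z α t = cross (surfDeriv z α t e₁) (surfDeriv z α t e₂) := by
  rw [cross_surfDeriv hz ht, h, S2.inner_self, one_smul]

lemma surfDeriv_eq (hz : ContDiffOnSphere 2 z (Ico 0 T)) (ht : t ∈ Ico 0 T)
    (b : OrthonormalBasis (Fin 3) ℝ E3) (hb : b 2 = α) (v : E3) :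
    surfDeriv z α t v = ⟪b 0, v⟫ • surfDeriv z α t (b 0) + ⟪b 1, v⟫ • surfDeriv z α t (b 1) := by
  conv_lhs => rw [← b.sum_repr' v]
  simp [Fin.sum_univ_three, hb, surfDeriv_self hz ht]

lemma inner_unitNormal_surfDeriv (hz : ContDiffOnSphere 2 z (Ico 0 T)) (ht : t ∈ Ico 0 T) (v : E3) :
    ⟪unitNormal z σ α t, surfDeriv z α t v⟫ = 0 := by
  obtain ⟨b, hb, hc⟩ := exists_oriented_basis α
  rw [surfDeriv_eq hz ht b hb, unitNormal, areaVector_eq_cross hz ht hc]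
  simp [inner_smul_left, inner_add_right, inner_smul_right, cross_inner_left, cross_inner_right]

lemma norm_unitNormal (hσ : σ = 1 ∨ σ = -1) (h : areaVector z α t ≠ 0) :
    ‖unitNormal z σ α t‖ = 1 := by
  have h1 := norm_ne_zero_iff.mpr h
  have h2 : ‖σ‖ = 1 := by rcases hσ with rfl | rfl <;> simp
  rw [unitNormal, norm_smul, norm_smul, h2, norm_inv, norm_norm, inv_mul_cancel₀ h1, one_mul]

lemma frameMap_self (hz : ContDiffOnSphere 2 z (Ico 0 T)) (ht : t ∈ Ico 0 T) :
    frameMap z σ α t α = unitNormal z σ α t := by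
  rw [frameMap_apply, surfDeriv_self hz ht, S2.inner_self, zero_add, one_smul]

/-- If v is in the kernel, the normal component gives v ⊥ α and then Dz v = 0. By `cross_surfDeriv`
and the immersion condition, ⟪u × v, α⟫ = 0 for all u; the choice u = α × v gives α × v = 0, so v =
0. -/
lemma frameMap_injective (hz : ContDiffOnSphere 2 z (Ico 0 T)) (ht : t ∈ Ico 0 T)
    (hσ : σ = 1 ∨ σ = -1) (h : areaVector z α t ≠ 0) :
    Function.Injective (frameMap z σ α t) := by
  obtain ⟨b, hb, hc⟩ := exists_oriented_basis α
  rw [injective_iff_map_eq_zero]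
  intro v hv
  rw [frameMap_apply] at hv
  have h1 : ⟪(α : E3), v⟫ = 0 := by
    have := congrArg (fun w => ⟪unitNormal z σ α t, w⟫) hv
    simpa [inner_add_right, inner_unitNormal_surfDeriv hz ht, inner_smul_right,
      norm_unitNormal hσ h] using this
  rw [h1, zero_smul, add_zero] at hv
  have key : ∀ u : E3, ⟪cross u v, (α : E3)⟫ = 0 := by
    intro u
    have h2 := cross_surfDeriv (α := α) hz ht u v
    rw [hv] at h2
    have h3 : cross (surfDeriv z α t u) 0 = 0 := by apply E3.ext <;> simp
    rw [h3] at h2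
    exact (smul_eq_zero.1 h2.symm).resolve_right h
  have h4 : cross (α : E3) v = 0 := by
    rw [← norm_eq_zero, ← sq_eq_zero_iff, ← real_inner_self_eq_norm_sq]
    have h5 := key (cross (α : E3) v)
    have h6 : ⟪cross (cross (α : E3) v) v, (α : E3)⟫ = -⟪cross (α : E3) v, cross (α : E3) v⟫ := by
      simp only [E3.inner_eq]; simp; ring
    linarith
  have h7 := norm_sq_cross (α : E3) v
  rw [h4, h1, S2.norm_coe] at h7
  have h8 : ‖v‖ ^ 2 = 0 := by simpa using h7.symm
  simpa using h8

lemma exists_frameMap_lower_bound (hz : ContDiffOnSphere 2 z (Ico 0 T)) (ht : t ∈ Ico 0 T)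
    (hσ : σ = 1 ∨ σ = -1) (h : areaVector z α t ≠ 0) :
    ∃ C > 0, ∀ v, ‖v‖ ≤ C * ‖frameMap z σ α t v‖ := by
  obtain ⟨K, hK, hL⟩ := LinearMap.exists_antilipschitzWith (frameMap z σ α t : E3 →ₗ[ℝ] E3)
    (LinearMap.ker_eq_bot.2 (frameMap_injective hz ht hσ h))
  exact ⟨K, hK, fun v => hL.le_mul_norm (map_zero _) v⟩

end Frame

/-! ### The approach to a boundary point -/

/-- The observation point `z(α,t) + ε N(α,t)`. -/
noncomputable def obsPt (z : S2 → ℝ → E3) (σ : ℝ) (α : S2) (t ε : ℝ) : E3 :=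
  z α t + ε • unitNormal z σ α t

/-- `(ε, β) → (0, α)` with `ε ≥ 0` and `(ε, β) ≠ (0, α)`. -/
def approach (α : S2) : Filter (ℝ × S2) := 𝓝[{w | 0 ≤ w.1 ∧ w ≠ (0, α)}] (0, α)

/-- The emission time on the trajectory of `β` of the signal arriving at `z(α,t) + ε N(α,t)`. -/
noncomputable def emT (z : S2 → ℝ → E3) (σ : ℝ) (η : E3 → ℝ → E3 → ℝ → ℝ) (α : S2) (t : ℝ)
    (w : ℝ × S2) : ℝ :=
  retardedTime z η (obsPt z σ α t w.1) t w.2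

/-- The vector from the emission point to the observation point. -/
noncomputable def sep (z : S2 → ℝ → E3) (σ : ℝ) (η : E3 → ℝ → E3 → ℝ → ℝ) (α : S2) (t : ℝ)
    (w : ℝ × S2) : E3 :=
  obsPt z σ α t w.1 - z w.2 (emT z σ η α t w)

/-- The distance from the emission point to the observation point. -/
noncomputable def gap (z : S2 → ℝ → E3) (σ : ℝ) (η : E3 → ℝ → E3 → ℝ → ℝ) (α : S2) (t : ℝ)
    (w : ℝ × S2) : ℝ :=
  ‖sep z σ η α t w‖

namespace IsDoubleLayerSetting

open Asymptotics

variable {T : ℝ} {c : E3 → ℝ → ℝ} {Ωm : ℝ → Set E3} {z : S2 → ℝ → E3} {σ : ℝ}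
  {η A : E3 → ℝ → E3 → ℝ → ℝ} {μ : S2 → ℝ → ℝ} {t : ℝ} {α : S2}

/-- For small ε > 0 the point lies outside the closure of Ω⁻(t), which contains Γ(t); for ε = 0 the
parametrization is injective. -/
lemma exists_obsPt_ne (H : IsDoubleLayerSetting T c Ωm z σ η A μ) (ht : t ∈ Ico 0 T) (α : S2) :
    ∃ ε₀ > 0, ∀ ε ∈ Icc 0 ε₀, ∀ β, (ε, β) ≠ (0, α) → obsPt z σ α t ε ≠ z β t := by
  obtain ⟨ε₁, h1, h2⟩ := mem_nhdsGT_iff_exists_Ioo_subset.1 (H.obstacle.outward t ht α)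
  refine ⟨ε₁ / 2, half_pos h1, fun ε hε β hne hz => ?_⟩
  rcases hε.1.eq_or_lt with h0 | h0
  · subst h0
    simp only [obsPt, zero_smul, add_zero] at hz
    exact hne (by rw [H.obstacle.injective t ht hz])
  · have h3 := (h2 ⟨h0, hε.2.trans_lt (half_lt_self h1)⟩).1
    apply h3
    have h4 : z β t ∈ frontier (Ωm t) := by rw [H.obstacle.frontier_eq t ht]; exact ⟨β, rfl⟩
    change obsPt z σ α t ε ∈ _
    rw [hz]
    exact frontier_subset_closure h4

lemma approach_le (α : S2) : approach α ≤ 𝓝 (0, α) := nhdsWithin_le_nhds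

lemma eventually_obsPt_ne (H : IsDoubleLayerSetting T c Ωm z σ η A μ) (ht : t ∈ Ico 0 T) :
    ∀ᶠ w in approach α, obsPt z σ α t w.1 ≠ z w.2 t := by
  obtain ⟨ε₀, h0, h⟩ := H.exists_obsPt_ne ht α
  have h1 : ∀ᶠ w : ℝ × S2 in approach α, w.1 < ε₀ :=
    approach_le α (continuousAt_fst.eventually (gt_mem_nhds h0))
  filter_upwards [self_mem_nhdsWithin, h1] with w hw hw1
  exact h w.1 ⟨hw.1, hw1.le⟩ w.2 hw.2

lemma continuous_obsPt : Continuous (obsPt z σ α t) := by unfold obsPt; fun_prop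

lemma obsPt_zero : obsPt z σ α t 0 = z α t := by simp [obsPt]

lemma tendsto_obsPt : Tendsto (fun w : ℝ × S2 => obsPt z σ α t w.1) (approach α) (𝓝 (z α t)) := by
  have h : Continuous (fun w : ℝ × S2 => obsPt z σ α t w.1) := continuous_obsPt.comp continuous_fst
  have := (h.tendsto (0, α)).mono_left (approach_le α)
  simpa [obsPt_zero] using this

/-- At x = z(α,t), β = α the phase vanishes at τ = t, so it is positive at every earlier time a.
Positivity at a persists nearby and pushes the emission time above a. -/
lemma tendsto_emT (H : IsDoubleLayerSetting T c Ωm z σ η A μ) (ht : t ∈ Ioo 0 T) :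
    Tendsto (emT z σ η α t) (approach α) (𝓝 t) := by
  have ht' : t ∈ Ico 0 T := ⟨ht.1.le, ht.2⟩
  refine tendsto_order.2 ⟨fun a ha => ?_, fun b hb => ?_⟩
  · rcases lt_or_ge a 0 with h0 | h0
    · filter_upwards [H.eventually_obsPt_ne ht'] with w hw
      exact h0.trans_le (H.retardedTime_mem ht hw).1
    · have hpos : 0 < t - a - η (z α t) t (z α a) a := by
        have h1 := H.travelTime.strictAnti (z α t) t α ht.1.le ht.2 ⟨h0, ha.le⟩
          ⟨ht.1.le, le_rfl⟩ ha
        have h2 := (H.travelTime.eq_zero_iff (z α t) t (z α t) t ht.1.le le_rfl ht.2).2 rfl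
        simpa [h2] using h1
      have h3 : Tendsto (fun w : ℝ × S2 => (obsPt z σ α t w.1, w.2)) (approach α)
          (𝓝 (z α t, α)) :=
        tendsto_obsPt.prodMk_nhds ((continuous_snd.tendsto (0, α)).mono_left (approach_le α))
      have h4 := h3.eventually (((H.continuous_phase ht.2 ⟨h0, ha.le⟩).continuousAt
        (x := (z α t, α))).eventually (lt_mem_nhds hpos))
      filter_upwards [H.eventually_obsPt_ne ht', h4] with w hw hw'
      exact H.lt_retardedTime ht hw ⟨h0, ha.le⟩ hw'
  · filter_upwards [H.eventually_obsPt_ne ht'] with w hw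
    exact (H.retardedTime_mem ht hw).2.trans hb

/-- As the emission time tends to t > 0, the default value 0 is excluded near the singularity, and a
genuine zero of the phase remains. -/
lemma eventually_emT (H : IsDoubleLayerSetting T c Ωm z σ η A μ) (ht : t ∈ Ioo 0 T) :
    ∀ᶠ w in approach α, emT z σ η α t w ∈ Ioo 0 t ∧
      t - emT z σ η α t w
        = η (obsPt z σ α t w.1) t (z w.2 (emT z σ η α t w)) (emT z σ η α t w) := by
  filter_upwards [H.eventually_obsPt_ne ⟨ht.1.le, ht.2⟩,
    (H.tendsto_emT (α := α) ht).eventually (lt_mem_nhds ht.1)] with w hw hw'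
  rcases H.retardedTime_cases ht hw with h | h
  · exact ⟨h.1, sub_eq_zero.1 h.2⟩
  · rw [emT, h.1] at hw'; exact absurd hw' (lt_irrefl _)

lemma tendsto_event (H : IsDoubleLayerSetting T c Ωm z σ η A μ) (ht : t ∈ Ioo 0 T) :
    Tendsto (fun w => (w.2, emT z σ η α t w)) (approach α) (𝓝 (α, t)) :=
  ((continuous_snd.tendsto (0, α)).mono_left (approach_le α)).prodMk_nhds (H.tendsto_emT ht)

lemma tendsto_sphere (H : IsDoubleLayerSetting T c Ωm z σ η A μ) (ht : t ∈ Ioo 0 T)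
    {F : Type*} [NormedAddCommGroup F] [NormedSpace ℝ F] {k : ℕ∞} {f : S2 → ℝ → F}
    (hf : ContDiffOnSphere k f (Ico 0 T)) :
    Tendsto (fun w => f w.2 (emT z σ η α t w)) (approach α) (𝓝 (f α t)) := by
  have h : ContinuousAt (fun q : S2 × ℝ => f q.1 q.2) (α, t) :=
    hf.continuousOn.continuousAt (prod_mem_nhds univ_mem (Ico_mem_nhds ht.1 ht.2))
  exact h.tendsto.comp (H.tendsto_event ht)

lemma tendsto_sep (H : IsDoubleLayerSetting T c Ωm z σ η A μ) (ht : t ∈ Ioo 0 T) :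
    Tendsto (sep z σ η α t) (approach α) (𝓝 0) := by
  have := (tendsto_obsPt (z := z) (σ := σ) (t := t)).sub (H.tendsto_sphere (α := α) ht H.obstacle.contDiff)
  rwa [sub_self] at this

lemma tendsto_gap (H : IsDoubleLayerSetting T c Ωm z σ η A μ) (ht : t ∈ Ioo 0 T) :
    Tendsto (gap z σ η α t) (approach α) (𝓝 0) := by
  have := (H.tendsto_sep (α := α) ht).norm
  rwa [norm_zero] at this

lemma eventually_gap_pos (H : IsDoubleLayerSetting T c Ωm z σ η A μ) (ht : t ∈ Ioo 0 T) :
    ∀ᶠ w in approach α, 0 < gap z σ η α t w := by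
  filter_upwards [H.eventually_obsPt_ne ⟨ht.1.le, ht.2⟩] with w hw
  exact norm_pos_iff.2 (sub_ne_zero.2 (H.ne_retarded ht hw))

lemma eventually_proper (H : IsDoubleLayerSetting T c Ωm z σ η A μ) (ht : t ∈ Ioo 0 T) :
    ∀ᶠ w in approach α, ((obsPt z σ α t w.1, t), (z w.2 (emT z σ η α t w), emT z σ η α t w))
      ∈ properPairs T := by
  filter_upwards [H.eventually_obsPt_ne ⟨ht.1.le, ht.2⟩, H.eventually_emT ht] with w hw hw'
  exact ⟨hw'.1.1.le, hw'.1.2, ht.2, H.ne_retarded ht hw⟩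

lemma tendsto_pair (H : IsDoubleLayerSetting T c Ωm z σ η A μ) (ht : t ∈ Ioo 0 T) :
    Tendsto (fun w => ((obsPt z σ α t w.1, t), (z w.2 (emT z σ η α t w), emT z σ η α t w)))
      (approach α) (𝓝 ((z α t, t), (z α t, t))) :=
  (tendsto_obsPt.prodMk_nhds tendsto_const_nhds).prodMk_nhds
    ((H.tendsto_sphere ht H.obstacle.contDiff).prodMk_nhds (H.tendsto_emT ht))

end IsDoubleLayerSetting

namespace IsDoubleLayerSetting

open Asymptotics

variable {T : ℝ} {c : E3 → ℝ → ℝ} {Ωm : ℝ → Set E3} {z : S2 → ℝ → E3} {σ : ℝ}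
  {η A : E3 → ℝ → E3 → ℝ → ℝ} {μ : S2 → ℝ → ℝ} {t : ℝ} {α : S2}

/-! ### Size of the retardation, of the travel time remainder and of the parameters -/

lemma exists_expansion_bound (H : IsDoubleLayerSetting T c Ωm z σ η A μ) (ht : t ∈ Ioo 0 T) :
    ∃ M : ℝ, ∀ᶠ w in approach α, ∀ j ≤ 2,
      ‖iteratedFDeriv ℝ j (diagRemainder c η (obsPt z σ α t w.1) t)
        (z w.2 (emT z σ η α t w), emT z σ η α t w)‖ * gap z σ η α t w ^ j
        ≤ M * (gap z σ η α t w ^ 2 + (t - emT z σ η α t w) * gap z σ η α t w) := by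
  obtain ⟨M, hM⟩ := H.travelTime.expansion (z α t) t ⟨ht.1.le, ht.2⟩
  refine ⟨M, ?_⟩
  filter_upwards [(H.tendsto_pair (α := α) ht).eventually hM, H.eventually_proper ht,
    H.eventually_emT ht] with w hw hp he j hj
  have := hw hp j hj
  rwa [abs_of_pos (show 0 < t - emT z σ η α t w by linarith [he.1.2])] at this

lemma tendsto_slowness (H : IsDoubleLayerSetting T c Ωm z σ η A μ) (ht : t ∈ Ioo 0 T) :
    Tendsto (fun w => slowness c (z w.2 (emT z σ η α t w)) (emT z σ η α t w)) (approach α)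
      (𝓝 (slowness c (z α t) t)) :=
  (H.soundSpeed.contDiffAt_slowness (z α t) ⟨ht.1.le, ht.2⟩).continuousAt.tendsto.comp
    ((H.tendsto_sphere ht H.obstacle.contDiff).prodMk_nhds (H.tendsto_emT ht))

/-- With s = t − τ, the expansion reads s = κr + e with e ≤ |M|(r + s)r. Since r + s tends to 0,
eventually e < r and κ is below its limit plus one, whence the constant κ + 2. -/
lemma isBigO_delay (H : IsDoubleLayerSetting T c Ωm z σ η A μ) (ht : t ∈ Ioo 0 T) :
    (fun w => t - emT z σ η α t w) =O[approach α] gap z σ η α t := by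
  obtain ⟨M, hM⟩ := H.exists_expansion_bound (α := α) ht
  have h0 : Tendsto (fun w => |M| * (gap z σ η α t w + (t - emT z σ η α t w))) (approach α)
      (𝓝 0) := by
    have := ((H.tendsto_gap (α := α) ht).add ((H.tendsto_emT (α := α) ht).const_sub t)).const_mul |M|
    simpa using this
  refine IsBigO.of_bound (slowness c (z α t) t + 2) ?_
  filter_upwards [hM, H.eventually_emT ht, H.eventually_gap_pos ht,
    h0.eventually (gt_mem_nhds one_pos),
    (H.tendsto_slowness (α := α) ht).eventually (gt_mem_nhds (lt_add_one _))] with w h1 h2 h3 h4 h5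
  have h6 := h1 0 (by norm_num)
  rw [norm_iteratedFDeriv_zero, pow_zero, mul_one, diagRemainder, ← h2.2] at h6
  have hs : 0 < t - emT z σ η α t w := by linarith [h2.1.2]
  have h7 := (le_abs_self _).trans h6
  have h8 : ‖obsPt z σ α t w.1 - z w.2 (emT z σ η α t w)‖ = gap z σ η α t w := rfl
  simp only [h8] at h7
  rw [Real.norm_of_nonneg hs.le, Real.norm_of_nonneg h3.le]
  nlinarith [mul_le_mul_of_nonneg_right (le_abs_self M)
    (show 0 ≤ gap z σ η α t w ^ 2 + (t - emT z σ η α t w) * gap z σ η α t w by positivity),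
    mul_lt_mul_of_pos_right h4 h3, mul_lt_mul_of_pos_right h5 h3]

/-- Once the delay is O(r), the bound r² + (t − τ)r is O(r²). Thus the remainder, its first and its
second derivatives are O(r²), O(r) and O(1). -/
lemma isBigO_iteratedFDeriv_rem (H : IsDoubleLayerSetting T c Ωm z σ η A μ) (ht : t ∈ Ioo 0 T)
    {j : ℕ} (hj : j ≤ 2) :
    (fun w => ‖iteratedFDeriv ℝ j (diagRemainder c η (obsPt z σ α t w.1) t)
        (z w.2 (emT z σ η α t w), emT z σ η α t w)‖ * gap z σ η α t w ^ j)
      =O[approach α] fun w => gap z σ η α t w ^ 2 := by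
  obtain ⟨M, hM⟩ := H.exists_expansion_bound (α := α) ht
  have h1 : (fun w => M * (gap z σ η α t w ^ 2 + (t - emT z σ η α t w) * gap z σ η α t w))
      =O[approach α] fun w => gap z σ η α t w ^ 2 :=
    ((isBigO_refl _ _).add (((H.isBigO_delay ht).mul (isBigO_refl _ _)).congr_right
      fun w => by ring)).const_mul_left M
  refine IsBigO.trans (IsBigO.of_bound 1 ?_) h1
  filter_upwards [hM, H.eventually_gap_pos ht] with w hw hp
  rw [one_mul, Real.norm_of_nonneg (by positivity)]
  exact (hw j hj).trans (le_abs_self _)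

lemma isBigO_rem (H : IsDoubleLayerSetting T c Ωm z σ η A μ) (ht : t ∈ Ioo 0 T) :
    (fun w => diagRemainder c η (obsPt z σ α t w.1) t
        (z w.2 (emT z σ η α t w), emT z σ η α t w))
      =O[approach α] fun w => gap z σ η α t w ^ 2 := by
  have h := H.isBigO_iteratedFDeriv_rem (α := α) ht (zero_le_two)
  simp only [norm_iteratedFDeriv_zero, pow_zero, mul_one] at h
  exact h.of_norm_left

lemma isBigO_fderiv_rem (H : IsDoubleLayerSetting T c Ωm z σ η A μ) (ht : t ∈ Ioo 0 T) :
    (fun w => fderiv ℝ (diagRemainder c η (obsPt z σ α t w.1) t)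
        (z w.2 (emT z σ η α t w), emT z σ η α t w))
      =O[approach α] gap z σ η α t := by
  have h := (H.isBigO_iteratedFDeriv_rem (α := α) ht (one_le_two)).mul
    (isBigO_refl (fun w => (gap z σ η α t w)⁻¹) _)
  have h1 : (fun w => gap z σ η α t w ^ 2 * (gap z σ η α t w)⁻¹) =ᶠ[approach α] gap z σ η α t := by
    filter_upwards [H.eventually_gap_pos ht] with w hw
    field_simp
  rw [← isBigO_norm_left]
  refine h.congr' ?_ h1
  filter_upwards [H.eventually_gap_pos ht] with w hw
  rw [norm_iteratedFDeriv_one]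
  field_simp

lemma isBigO_fderiv_fderiv_rem (H : IsDoubleLayerSetting T c Ωm z σ η A μ) (ht : t ∈ Ioo 0 T) :
    (fun w => fderiv ℝ (fderiv ℝ (diagRemainder c η (obsPt z σ α t w.1) t))
        (z w.2 (emT z σ η α t w), emT z σ η α t w))
      =O[approach α] fun _ => (1 : ℝ) := by
  have h := (H.isBigO_iteratedFDeriv_rem (α := α) ht le_rfl).mul
    (isBigO_refl (fun w => (gap z σ η α t w ^ 2)⁻¹) _)
  have h1 : (fun w => gap z σ η α t w ^ 2 * (gap z σ η α t w ^ 2)⁻¹) =ᶠ[approach α]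
      fun _ => (1 : ℝ) := by
    filter_upwards [H.eventually_gap_pos ht] with w hw
    field_simp
  refine IsBigO.of_norm_left (E' := (E3 × ℝ) →L[ℝ] (E3 × ℝ) →L[ℝ] ℝ) (h.congr' ?_ h1)
  filter_upwards [H.eventually_gap_pos ht] with w hw
  have h2 : ∀ (f : E3 × ℝ → ℝ) q, ‖iteratedFDeriv ℝ 2 f q‖ = ‖fderiv ℝ (fderiv ℝ f) q‖ := by
    intro f q
    rw [← norm_iteratedFDeriv_one, norm_iteratedFDeriv_fderiv]
  rw [h2]
  field_simp

lemma contDiffAt_rayExt {F : Type*} [NormedAddCommGroup F] [NormedSpace ℝ F] {k : ℕ∞}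
    {f : S2 → ℝ → F} (hf : ContDiffOnSphere k f (Ico 0 T)) (ht : t ∈ Ioo 0 T) :
    ContDiffAt ℝ k (rayExt f) ((α : E3), t) :=
  ContDiffOn.contDiffAt hf (slab_mem_nhds α ht)

lemma fderiv_rayExt (H : IsDoubleLayerSetting T c Ωm z σ η A μ) (ht : t ∈ Ioo 0 T) (v : E3) (s : ℝ) :
    fderiv ℝ (rayExt z) ((α : E3), t) (v, s) = surfDeriv z α t v + s • velocity z α t := by
  have ht' : t ∈ Ico 0 T := ⟨ht.1.le, ht.2⟩
  have hw := fderivWithin_of_mem_nhds (𝕜 := ℝ) (f := rayExt z) (slab_mem_nhds α ht)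
  have h1 := (H.obstacle.contDiff.hasFDerivAt_space (by norm_num) α ht').fderiv
  have h2 := H.obstacle.contDiff.timeDeriv_eq (by norm_num) α ht'
  rw [hw] at h1 h2
  have h3 : velocity z α t = _ := h2
  rw [surfDeriv, h1, h3, show (v, s) = (v, (0 : ℝ)) + s • ((0 : E3), (1 : ℝ)) by simp, map_add,
    map_smul]
  simp

lemma tendsto_event_coe (H : IsDoubleLayerSetting T c Ωm z σ η A μ) (ht : t ∈ Ioo 0 T) :
    Tendsto (fun w : ℝ × S2 => ((w.2 : E3), emT z σ η α t w)) (approach α) (𝓝 ((α : E3), t)) := by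
  have h : Continuous (fun q : S2 × ℝ => ((q.1 : E3), q.2)) := by fun_prop
  exact (h.tendsto (α, t)).comp (H.tendsto_event ht)

lemma isBigO_taylor (H : IsDoubleLayerSetting T c Ωm z σ η A μ) (ht : t ∈ Ioo 0 T) :
    (fun w : ℝ × S2 => z w.2 (emT z σ η α t w) - z α t - surfDeriv z α t ((w.2 : E3) - α)
        - (emT z σ η α t w - t) • velocity z α t)
      =O[approach α] fun w => (‖(w.2 : E3) - α‖ + |emT z σ η α t w - t|) ^ 2 := by
  have h := (contDiffAt_rayExt (α := α) H.obstacle.contDiff ht).isBigO_sub_sub_fderiv.comp_tendsto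
    (H.tendsto_event_coe ht)
  refine (h.congr_left (fun w => ?_)).trans (IsBigO.of_bound 1
    (Eventually.of_forall fun w => ?_))
  · simp only [Function.comp_apply, rayExt, toS2_coe, Prod.mk_sub_mk, H.fderiv_rayExt ht]
    abel
  · simp only [Function.comp_apply, Prod.mk_sub_mk, one_mul, norm_pow, norm_norm]
    rw [Real.norm_of_nonneg (show 0 ≤ ‖(w.2 : E3) - α‖ + |emT z σ η α t w - t| by positivity)]
    gcongr
    rw [Prod.norm_mk, Real.norm_eq_abs]
    exact max_le (by linarith [abs_nonneg (emT z σ η α t w - t)])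
      (by linarith [norm_nonneg ((w.2 : E3) - α)])

lemma tendsto_param (α : S2) :
    Tendsto (fun w : ℝ × S2 => ‖(w.2 : E3) - α‖) (approach α) (𝓝 0) := by
  have h : Continuous (fun w : ℝ × S2 => ‖(w.2 : E3) - α‖) := by fun_prop
  have := (h.tendsto (0, α)).mono_left (approach_le α)
  simpa using this

lemma eventually_nonneg (α : S2) : ∀ᶠ w : ℝ × S2 in approach α, 0 ≤ w.1 := by
  filter_upwards [self_mem_nhdsWithin] with w hw using hw.1

lemma inner_sub_self (α β : S2) : ⟪(α : E3), (β : E3) - α⟫ = -(‖(β : E3) - α‖ ^ 2 / 2) := by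
  rw [← real_inner_self_eq_norm_sq]
  simp only [inner_sub_left, inner_sub_right, S2.inner_self, real_inner_comm (α : E3) (β : E3)]
  ring

/-- Invertibility of the frame map bounds the parameters by its image of εα − (β − α). That image is
the separation vector up to the displacement sV during the delay, which is O(r), and up to errors
that are a small multiple of |β − α| + s and can be absorbed. -/
lemma isBigO_param (H : IsDoubleLayerSetting T c Ωm z σ η A μ) (ht : t ∈ Ioo 0 T) :
    (fun w : ℝ × S2 => w.1 + ‖(w.2 : E3) - α‖) =O[approach α] gap z σ η α t := by
  have ht' : t ∈ Ico 0 T := ⟨ht.1.le, ht.2⟩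
  obtain ⟨C, hC, hL⟩ := exists_frameMap_lower_bound (α := α) H.obstacle.contDiff ht'
    H.obstacle.orientation (H.obstacle.immersion t ht' α)
  obtain ⟨K, hK⟩ := (H.isBigO_delay (α := α) ht).bound
  have hlim : Tendsto (fun w : ℝ × S2 => ‖(w.2 : E3) - α‖ + |emT z σ η α t w - t|) (approach α)
      (𝓝 0) := by
    have h1 := ((H.tendsto_emT (α := α) ht).sub_const t).abs
    simpa using (tendsto_param α).add h1
  have hE : (fun w : ℝ × S2 => z w.2 (emT z σ η α t w) - z α t - surfDeriv z α t ((w.2 : E3) - α)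
        - (emT z σ η α t w - t) • velocity z α t)
      =o[approach α] fun w => ‖(w.2 : E3) - α‖ + |emT z σ η α t w - t| := by
    refine (H.isBigO_taylor ht).trans_isLittleO ?_
    have : (fun w : ℝ × S2 => ‖(w.2 : E3) - α‖ + |emT z σ η α t w - t|) =o[approach α]
        (fun _ => (1 : ℝ)) := (isLittleO_one_iff ℝ).2 hlim
    have h2 := this.mul_isBigO (isBigO_refl (fun w : ℝ × S2 =>
      ‖(w.2 : E3) - α‖ + |emT z σ η α t w - t|) (approach α))
    simpa [sq] using h2
  -- With this δ the Taylor error contributes |β − α|/4 and the quadratic normal term at most |β −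
  -- α|/8 to the final bound, so both are absorbed on the left.
  set δ : ℝ := 1 / (8 * C) with hδ
  have hδ0 : 0 < δ := by positivity
  have hCδ : C * δ = 1 / 8 := by rw [hδ]; field_simp
  refine IsBigO.of_bound (4 * C * (1 + (‖velocity z α t‖ + δ) * K)) ?_
  filter_upwards [hE.bound hδ0, hK, H.eventually_emT ht, H.eventually_gap_pos ht,
    (tendsto_param α).eventually (gt_mem_nhds hδ0), eventually_nonneg α] with w h1 h2 h3 h4 h5 h6
  have hN : ‖unitNormal z σ α t‖ = 1 :=
    norm_unitNormal H.obstacle.orientation (H.obstacle.immersion t ht' α)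
  have hs : 0 < t - emT z σ η α t w := by linarith [h3.1.2]
  set s := t - emT z σ η α t w with hs_def
  set b := ‖(w.2 : E3) - α‖ with hb
  have hb0 : 0 ≤ b := norm_nonneg _
  have habs : |emT z σ η α t w - t| = s := by rw [abs_sub_comm, abs_of_pos hs]
  rw [Real.norm_of_nonneg hs.le, Real.norm_of_nonneg h4.le] at h2
  rw [habs, Real.norm_of_nonneg (show 0 ≤ b + s by positivity)] at h1
  -- the vector of parameters
  have hp : w.1 + b ≤ 2 * ‖w.1 • (α : E3) - ((w.2 : E3) - α)‖ := by
    have hsq : ‖w.1 • (α : E3) - ((w.2 : E3) - α)‖ ^ 2 = w.1 ^ 2 + b ^ 2 + w.1 * b ^ 2 := by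
      rw [norm_sub_sq_real, norm_smul, S2.norm_coe, real_inner_smul_left, inner_sub_self,
        Real.norm_of_nonneg h6]
      ring
    have : (w.1 + b) ^ 2 ≤ (2 * ‖w.1 • (α : E3) - ((w.2 : E3) - α)‖) ^ 2 := by
      rw [mul_pow, hsq]
      nlinarith [sq_nonneg (w.1 - b), mul_nonneg h6 (sq_nonneg b)]
    exact (pow_le_pow_iff_left₀ (by positivity) (by positivity) two_ne_zero).1 this
  -- The chord β − α is not tangent at α: its component along α is −|β − α|²/2, which produces the
  -- last normal term.
  have hdecomp : frameMap z σ α t (w.1 • (α : E3) - ((w.2 : E3) - α))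
      = sep z σ η α t w - s • velocity z α t
        + (z w.2 (emT z σ η α t w) - z α t - surfDeriv z α t ((w.2 : E3) - α)
            - (emT z σ η α t w - t) • velocity z α t)
        + (b ^ 2 / 2) • unitNormal z σ α t := by
    rw [map_sub, map_smul, frameMap_self H.obstacle.contDiff ht', frameMap_apply, inner_sub_self,
      sep, obsPt, hs_def, hb]
    module
  have h7 := hL (w.1 • (α : E3) - ((w.2 : E3) - α))
  have h8 : ‖frameMap z σ α t (w.1 • (α : E3) - ((w.2 : E3) - α))‖
      ≤ gap z σ η α t w + s * ‖velocity z α t‖ + δ * (b + s) + b ^ 2 / 2 := by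
    rw [hdecomp]
    refine (norm_add_le _ _).trans (add_le_add ((norm_add_le _ _).trans (add_le_add
      ((norm_sub_le _ _).trans (add_le_add le_rfl ?_)) h1)) ?_)
    · rw [norm_smul, Real.norm_of_nonneg hs.le]
    · rw [norm_smul, hN, Real.norm_of_nonneg (by positivity), mul_one]
  rw [Real.norm_of_nonneg (by positivity), Real.norm_of_nonneg h4.le]
  have h9 : w.1 + b ≤ 2 * C * (gap z σ η α t w + s * ‖velocity z α t‖ + δ * (b + s) + b ^ 2 / 2) := by
    calc w.1 + b ≤ 2 * (C * ‖frameMap z σ α t (w.1 • (α : E3) - ((w.2 : E3) - α))‖) :=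
          hp.trans (by gcongr)
      _ ≤ 2 * (C * (gap z σ η α t w + s * ‖velocity z α t‖ + δ * (b + s) + b ^ 2 / 2)) := by gcongr
      _ = _ := by ring
  have h10 : C * b ^ 2 ≤ 1 / 8 * b := by
    rw [← hCδ]; nlinarith [mul_nonneg hC.le hb0]
  have h11 : 2 * C * δ * b = 1 / 4 * b := by linear_combination 2 * b * hCδ
  have h12 : C * (‖velocity z α t‖ + δ) * s ≤ C * (‖velocity z α t‖ + δ) * (K * gap z σ η α t w) := by
    gcongr
  nlinarith

end IsDoubleLayerSetting

/-- The unit vector from the emission point to the observation point. -/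
noncomputable def sepDir (z : S2 → ℝ → E3) (σ : ℝ) (η : E3 → ℝ → E3 → ℝ → ℝ) (α : S2) (t : ℝ)
    (w : ℝ × S2) : E3 :=
  (gap z σ η α t w)⁻¹ • sep z σ η α t w

lemma alongCurve_add {f g : E3 → ℝ → E3 → ℝ → ℝ} {z : S2 → ℝ → E3} {x : E3} {t τ : ℝ} {β : S2}
    (hf : ContDiffAt ℝ 2 (srcFun f x t) (z β τ, τ)) (hg : ContDiffAt ℝ 2 (srcFun g x t) (z β τ, τ))
    (X X₁ : E3 × ℝ) :
    alongCurve (fun x t y τ => f x t y τ + g x t y τ) z x t β τ X X₁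
      = alongCurve f z x t β τ X X₁ + alongCurve g z x t β τ X X₁ := by
  have h1 : ∀ {u : E3 × ℝ → ℝ}, ContDiffAt ℝ 2 u (z β τ, τ) →
      ∀ᶠ q in 𝓝 (z β τ, τ), DifferentiableAt ℝ u q := fun hu =>
    (hu.eventually (by simp)).mono fun q hq => hq.differentiableAt (by norm_num)
  have h2 : ∀ {u : E3 × ℝ → ℝ}, ContDiffAt ℝ 2 u (z β τ, τ) →
      DifferentiableAt ℝ (fderiv ℝ u) (z β τ, τ) := fun hu =>
    (hu.fderiv_right (m := 1) (by norm_num)).differentiableAt (by norm_num)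
  have h3 : fderiv ℝ (srcFun (fun x t y τ => f x t y τ + g x t y τ) x t) =ᶠ[𝓝 (z β τ, τ)]
      fun q => fderiv ℝ (srcFun f x t) q + fderiv ℝ (srcFun g x t) q := by
    filter_upwards [h1 hf, h1 hg] with q hfq hgq
    exact fderiv_fun_add hfq hgq
  unfold alongCurve
  rw [h3.fderiv_eq, h3.self_of_nhds, fderiv_fun_add (h2 hf) (h2 hg)]
  simp only [_root_.add_apply]
  ring

namespace IsDoubleLayerSetting

open Asymptotics

variable {T : ℝ} {c : E3 → ℝ → ℝ} {Ωm : ℝ → Set E3} {z : S2 → ℝ → E3} {σ : ℝ}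
  {η A : E3 → ℝ → E3 → ℝ → ℝ} {μ : S2 → ℝ → ℝ} {t : ℝ} {α : S2}
  {F : Type*} [NormedAddCommGroup F] [NormedSpace ℝ F]

/-! ### Frozen coefficients -/

lemma isBigO_sub_coe (H : IsDoubleLayerSetting T c Ωm z σ η A μ) (ht : t ∈ Ioo 0 T) :
    (fun w : ℝ × S2 => (w.2 : E3) - α) =O[approach α] gap z σ η α t := by
  refine IsBigO.trans (IsBigO.of_bound 1 ?_) (H.isBigO_param ht)
  filter_upwards [eventually_nonneg α] with w hw
  rw [one_mul, Real.norm_of_nonneg (by positivity)]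
  linarith

lemma isBigO_emT_sub (H : IsDoubleLayerSetting T c Ωm z σ η A μ) (ht : t ∈ Ioo 0 T) :
    (fun w : ℝ × S2 => emT z σ η α t w - t) =O[approach α] gap z σ η α t :=
  (H.isBigO_delay ht).neg_left.congr_left fun w => by ring

lemma isBigO_event_coe (H : IsDoubleLayerSetting T c Ωm z σ η A μ) (ht : t ∈ Ioo 0 T) :
    (fun w : ℝ × S2 => ((w.2 : E3), emT z σ η α t w) - ((α : E3), t)) =O[approach α]
      gap z σ η α t :=
  (H.isBigO_sub_coe ht).prod_left (H.isBigO_emT_sub ht)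

/-- Freezing a C¹ field at (α,t) costs the distance of the source parameters to (α,t), which is O(r)
by `isBigO_param` and `isBigO_delay`. -/
lemma isBigO_sphere (H : IsDoubleLayerSetting T c Ωm z σ η A μ) (ht : t ∈ Ioo 0 T) {f : S2 → ℝ → F}
    (hf : ContDiffOnSphere 1 f (Ico 0 T)) :
    (fun w : ℝ × S2 => f w.2 (emT z σ η α t w) - f α t) =O[approach α] gap z σ η α t := by
  have h := ((contDiffAt_rayExt (α := α) hf ht).differentiableAt
    (by norm_num)).hasFDerivAt.isBigO_sub.comp_tendsto (H.tendsto_event_coe (α := α) ht)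
  exact (h.congr_left fun w => by simp [rayExt]).trans (H.isBigO_event_coe ht)

lemma closeTo_sphere (H : IsDoubleLayerSetting T c Ωm z σ η A μ) (ht : t ∈ Ioo 0 T)
    {f : S2 → ℝ → F} (hf : ContDiffOnSphere 1 f (Ico 0 T)) :
    CloseTo (approach α) (gap z σ η α t) (fun w => f w.2 (emT z σ η α t w)) (fun _ => f α t) :=
  ⟨H.isBigO_sphere ht hf, isBigO_const_const _ one_ne_zero _⟩

lemma contDiff_surface (H : IsDoubleLayerSetting T c Ωm z σ η A μ) :
    ContDiffOnSphere 1 z (Ico 0 T) := H.obstacle.contDiff.of_le' (by norm_num)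

lemma isBigO_source (H : IsDoubleLayerSetting T c Ωm z σ η A μ) (ht : t ∈ Ioo 0 T) :
    (fun w : ℝ × S2 => (z w.2 (emT z σ η α t w), emT z σ η α t w) - (z α t, t)) =O[approach α]
      gap z σ η α t :=
  (H.isBigO_sphere ht H.contDiff_surface).prod_left (H.isBigO_emT_sub ht)

lemma tendsto_source (H : IsDoubleLayerSetting T c Ωm z σ η A μ) (ht : t ∈ Ioo 0 T) :
    Tendsto (fun w => (z w.2 (emT z σ η α t w), emT z σ η α t w)) (approach α) (𝓝 (z α t, t)) :=
  (H.tendsto_sphere ht H.obstacle.contDiff).prodMk_nhds (H.tendsto_emT ht)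

lemma closeTo_slowness (H : IsDoubleLayerSetting T c Ωm z σ η A μ) (ht : t ∈ Ioo 0 T) :
    CloseTo (approach α) (gap z σ η α t)
      (fun w => slowness c (z w.2 (emT z σ η α t w)) (emT z σ η α t w))
      (fun _ => slowness c (z α t) t) := by
  have hd := (H.soundSpeed.contDiffAt_slowness (z α t) ⟨ht.1.le, ht.2⟩).differentiableAt (by simp)
  exact ⟨(hd.hasFDerivAt.isBigO_sub.comp_tendsto (H.tendsto_source ht)).trans (H.isBigO_source ht),
    isBigO_const_const _ one_ne_zero _⟩

lemma eventually_norm_sepDir (H : IsDoubleLayerSetting T c Ωm z σ η A μ) (ht : t ∈ Ioo 0 T) :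
    ∀ᶠ w in approach α, ‖sepDir z σ η α t w‖ = 1 := by
  filter_upwards [H.eventually_gap_pos ht] with w hw
  rw [sepDir, norm_smul, norm_inv, Real.norm_of_nonneg hw.le]
  exact inv_mul_cancel₀ hw.ne'

lemma isBigO_sepDir (H : IsDoubleLayerSetting T c Ωm z σ η A μ) (ht : t ∈ Ioo 0 T) :
    sepDir z σ η α t =O[approach α] (fun _ => (1 : ℝ)) := by
  refine IsBigO.of_bound 1 ?_
  filter_upwards [H.eventually_norm_sepDir ht] with w hw
  simp [hw]

lemma inner_sep_div (w : ℝ × S2) (v : E3) :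
    ⟪sep z σ η α t w, v⟫ / gap z σ η α t w = ⟪sepDir z σ η α t w, v⟫ := by
  rw [sepDir, real_inner_smul_left]; ring

/-- At the emission time the delay equals η = κr + O(r²); this is divided by r. -/
lemma closeTo_delay (H : IsDoubleLayerSetting T c Ωm z σ η A μ) (ht : t ∈ Ioo 0 T) :
    CloseTo (approach α) (gap z σ η α t) (fun w => (t - emT z σ η α t w) / gap z σ η α t w)
      (fun _ => slowness c (z α t) t) := by
  have h1 : (fun w => diagRemainder c η (obsPt z σ α t w.1) t
        (z w.2 (emT z σ η α t w), emT z σ η α t w) * (gap z σ η α t w)⁻¹)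
      =O[approach α] gap z σ η α t := by
    refine ((H.isBigO_rem ht).mul (isBigO_refl (fun w => (gap z σ η α t w)⁻¹) _)).congr'
      EventuallyEq.rfl ?_
    filter_upwards [H.eventually_gap_pos ht] with w hw
    field_simp
  refine (((H.closeTo_slowness ht).add (CloseTo.of_isBigO h1)).congr_left ?_).congr_right
    (Eventually.of_forall fun w => add_zero _)
  filter_upwards [H.eventually_gap_pos ht, H.eventually_emT ht] with w hw he
  rw [he.2, diagRemainder]
  have : ‖obsPt z σ α t w.1 - z w.2 (emT z σ η α t w)‖ = gap z σ η α t w := rfl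
  simp only [this]
  field_simp
  ring

lemma srcFun_eq_add (x : E3) :
    srcFun η x t = fun q => srcFun (modelTime c) x t q + diagRemainder c η x t q := by
  ext q
  simp [srcFun, modelTime, diagRemainder]

lemma isBigO_fderiv_slowness (H : IsDoubleLayerSetting T c Ωm z σ η A μ) (ht : t ∈ Ioo 0 T) :
    (fun w => fderiv ℝ (fun q : E3 × ℝ => slowness c q.1 q.2)
      (z w.2 (emT z σ η α t w), emT z σ η α t w)) =O[approach α] (fun _ => (1 : ℝ)) := by
  have h := ((H.soundSpeed.contDiffAt_slowness (z α t) ⟨ht.1.le, ht.2⟩).fderiv_right (m := 0)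
    (by simp)).continuousAt
  exact (h.tendsto.comp (H.tendsto_source (α := α) ht)).isBigO_one ℝ

lemma isBigO_fderiv_fderiv_slowness (H : IsDoubleLayerSetting T c Ωm z σ η A μ)
    (ht : t ∈ Ioo 0 T) :
    (fun w => fderiv ℝ (fderiv ℝ (fun q : E3 × ℝ => slowness c q.1 q.2))
      (z w.2 (emT z σ η α t w), emT z σ η α t w)) =O[approach α] (fun _ => (1 : ℝ)) := by
  have h := (((H.soundSpeed.contDiffAt_slowness (z α t) ⟨ht.1.le, ht.2⟩).fderiv_right (m := 1)
    (WithTop.coe_le_coe.2 (le_top : (2 : ℕ∞) ≤ ⊤))).fderiv_right (m := 0) (by simp)).continuousAt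
  exact (h.tendsto.comp (H.tendsto_source (α := α) ht)).isBigO_one ℝ

lemma isBigO_clm_apply {ι E : Type*} [NormedAddCommGroup E] [NormedSpace ℝ E] {l : Filter ι}
    {L : ι → E →L[ℝ] F} {v : ι → E} {f : ι → ℝ} (hL : L =O[l] f) (hv : v =O[l] fun _ => (1 : ℝ)) :
    (fun w => L w (v w)) =O[l] f := by
  have h := (hL.norm_left.mul hv.norm_left)
  simp only [mul_one] at h
  refine IsBigO.trans (IsBigO.of_bound 1 (Eventually.of_forall fun w => ?_)) h
  rw [one_mul, norm_mul, norm_norm, norm_norm]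
  exact (L w).le_opNorm _

lemma isBigO_field (H : IsDoubleLayerSetting T c Ωm z σ η A μ) (ht : t ∈ Ioo 0 T) {k : ℕ∞}
    {Y : S2 → ℝ → F} (hY : ContDiffOnSphere k Y (Ico 0 T)) (b : ℝ) :
    (fun w => (Y w.2 (emT z σ η α t w), b)) =O[approach α] (fun _ => (1 : ℝ)) :=
  ((H.tendsto_sphere ht hY).isBigO_one ℝ).prod_left (isBigO_const_const _ one_ne_zero _)

/-- In Dη = r Dκ + κ Dr + De the outer terms are O(r), and Dr applied to (Y, b) is −⟪ν, Y⟫. -/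
lemma closeTo_fderiv_travelTime (H : IsDoubleLayerSetting T c Ωm z σ η A μ) (ht : t ∈ Ioo 0 T)
    {Y : S2 → ℝ → E3} (hY : ContDiffOnSphere 1 Y (Ico 0 T)) (b : ℝ) :
    CloseTo (approach α) (gap z σ η α t)
      (fun w => fderiv ℝ (srcFun η (obsPt z σ α t w.1) t)
        (z w.2 (emT z σ η α t w), emT z σ η α t w) (Y w.2 (emT z σ η α t w), b))
      (fun w => -(slowness c (z α t) t * ⟪sepDir z σ η α t w, Y α t⟫)) := by
  have hg := H.tendsto_gap (α := α) ht
  have hb := H.isBigO_field (α := α) ht hY b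
  have h1 := isBigO_clm_apply (H.isBigO_fderiv_slowness ht) hb
  have h2 := isBigO_clm_apply (H.isBigO_fderiv_rem ht) hb
  have h3 : (fun w => fderiv ℝ (fun q : E3 × ℝ => slowness c q.1 q.2)
      (z w.2 (emT z σ η α t w), emT z σ η α t w) (Y w.2 (emT z σ η α t w), b) * gap z σ η α t w)
      =O[approach α] gap z σ η α t := by simpa using h1.mul (isBigO_refl (gap z σ η α t) _)
  have h4 := (H.closeTo_slowness ht).mul hg
    ((CloseTo.refl (H.isBigO_sepDir ht)).inner' hg (H.closeTo_sphere ht hY))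
  refine (((CloseTo.of_isBigO h3).sub' h4).add (CloseTo.of_isBigO h2)).congr_left ?_
    |>.congr_right (Eventually.of_forall fun w => by ring)
  filter_upwards [H.eventually_proper ht] with w hw
  have hs : (emT z σ η α t w) ∈ Ico 0 T := ⟨hw.1, hw.2.1.trans ht.2⟩
  have hm : DifferentiableAt ℝ (srcFun (modelTime c) (obsPt z σ α t w.1) t)
      (z w.2 (emT z σ η α t w), emT z σ η α t w) :=
    (contDiffAt_src_modelTime H.soundSpeed hs hw.2.2.2).differentiableAt (by norm_num)
  have hη := (H.contDiffAt_src_travelTime hw).differentiableAt (by norm_num)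
  have hr : DifferentiableAt ℝ (diagRemainder c η (obsPt z σ α t w.1) t)
      (z w.2 (emT z σ η α t w), emT z σ η α t w) := by
    have : diagRemainder c η (obsPt z σ α t w.1) t = fun q => srcFun η (obsPt z σ α t w.1) t q
        - srcFun (modelTime c) (obsPt z σ α t w.1) t q := rfl
    rw [this]; exact hη.fun_sub hm
  rw [srcFun_eq_add (c := c), fderiv_fun_add hm hr]
  simp only [_root_.add_apply]
  rw [fderiv_src_modelTime H.soundSpeed hs hw.2.2.2]
  have e1 := inner_sep_div (z := z) (σ := σ) (η := η) (α := α) (t := t) w (Y w.2 (emT z σ η α t w))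
  simp only [sep, gap] at e1 ⊢
  rw [← e1]

/-- Only the Hessian of |x − y| has size 1/r. All other second order contributions, including that
of the remainder, are bounded and become O(r) after multiplication by r. -/
lemma closeTo_alongCurve_travelTime (H : IsDoubleLayerSetting T c Ωm z σ η A μ) (ht : t ∈ Ioo 0 T)
    {Y : S2 → ℝ → E3} (hY : ContDiffOnSphere 1 Y (Ico 0 T)) (b : ℝ) :
    CloseTo (approach α) (gap z σ η α t)
      (fun w => gap z σ η α t w * alongCurve η z (obsPt z σ α t w.1) t w.2 (emT z σ η α t w)
        (Y w.2 (emT z σ η α t w), b) (timeDeriv Y w.2 (emT z σ η α t w), 0))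
      (fun w => slowness c (z α t) t * (⟪velocity z α t, Y α t⟫
        - ⟪sepDir z σ η α t w, Y α t⟫ * ⟪sepDir z σ η α t w, velocity z α t⟫)) := by
  have hg := H.tendsto_gap (α := α) ht
  have hY' : ContDiffOnSphere 0 (timeDeriv Y) (Ico 0 T) := ContDiffOnSphere.timeDeriv (k := 0) hY
  have hb := H.isBigO_field (α := α) ht hY b
  have hb' := H.isBigO_field (α := α) ht hY' 0
  have hV := H.isBigO_field (α := α) ht H.contDiff_velocity 1
  have hν := CloseTo.refl (r := gap z σ η α t) (H.isBigO_sepDir (α := α) ht)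
  have cV := H.closeTo_sphere (α := α) ht H.contDiff_velocity
  have cY := H.closeTo_sphere (α := α) ht hY
  have mulGap : ∀ {f : ℝ × S2 → ℝ}, f =O[approach α] (fun _ => (1 : ℝ)) →
      CloseTo (approach α) (gap z σ η α t) (fun w => gap z σ η α t w * f w) (fun _ => 0) :=
    fun hf => CloseTo.of_isBigO (by simpa using (isBigO_refl (gap z σ η α t) _).mul hf)
  have hVν := (hν.inner' hg cV)
  have hYν := (hν.inner' hg cY)
  have hdY := isBigO_clm_apply (H.isBigO_fderiv_slowness (α := α) ht) hb
  have hdV := isBigO_clm_apply (H.isBigO_fderiv_slowness (α := α) ht) hV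
  have hd2 : (fun w => alongCurve (slownessKernel c) z (obsPt z σ α t w.1) t w.2 (emT z σ η α t w)
        (Y w.2 (emT z σ η α t w), b) (timeDeriv Y w.2 (emT z σ η α t w), 0) * gap z σ η α t w)
      =O[approach α] (fun _ => (1 : ℝ)) := by
    have := ((isBigO_clm_apply (isBigO_clm_apply (H.isBigO_fderiv_fderiv_slowness (α := α) ht) hV)
      hb).add (isBigO_clm_apply (H.isBigO_fderiv_slowness (α := α) ht) hb')).mul (hg.isBigO_one ℝ)
    simp only [mul_one] at this
    exact this
  have hrem : (fun w => alongCurve (remainderTime c η) z (obsPt z σ α t w.1) t w.2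
        (emT z σ η α t w) (Y w.2 (emT z σ η α t w), b) (timeDeriv Y w.2 (emT z σ η α t w), 0))
      =O[approach α] (fun _ => (1 : ℝ)) :=
    (isBigO_clm_apply (isBigO_clm_apply (H.isBigO_fderiv_fderiv_rem (α := α) ht) hV) hb).add
      (isBigO_clm_apply ((H.isBigO_fderiv_rem (α := α) ht).trans (hg.isBigO_one ℝ)) hb')
  have hνY' : (fun w => ⟪sepDir z σ η α t w, timeDeriv Y w.2 (emT z σ η α t w)⟫)
      =O[approach α] (fun _ => (1 : ℝ)) := by
    have h1 := ((H.isBigO_sepDir (α := α) ht).norm_left.mul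
      ((H.tendsto_sphere (α := α) ht hY').isBigO_one ℝ).norm_left)
    simp only [mul_one] at h1
    refine IsBigO.trans (IsBigO.of_bound 1 (Eventually.of_forall fun w => ?_)) h1
    rw [one_mul, norm_mul, norm_norm, norm_norm]
    exact norm_inner_le_norm _ _
  have hbd := (hdY.mul (hVν.isBigO_one hg)).add (hdV.mul (hYν.isBigO_one hg))
  simp only [mul_one] at hbd
  have hmain := (mulGap hd2).sub' (mulGap hbd) |>.sub' ((H.closeTo_slowness ht).mul hg
    (((mulGap hνY').sub' (cV.inner' hg cY)).add (hYν.mul hg hVν))) |>.add (mulGap hrem)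
  refine (hmain.congr_left ?_).congr_right (Eventually.of_forall fun w => by ring)
  filter_upwards [H.eventually_proper ht, H.eventually_emT ht, H.eventually_gap_pos ht]
    with w hw he hp
  have hs : (emT z σ η α t w) ∈ Ioo 0 T := ⟨he.1.1, hw.2.1.trans ht.2⟩
  have hs' : (emT z σ η α t w) ∈ Ico 0 T := ⟨hs.1.le, hs.2⟩
  have hm := contDiffAt_src_modelTime (t := t) (q := (z w.2 (emT z σ η α t w), emT z σ η α t w))
    H.soundSpeed hs' hw.2.2.2
  have hr : ContDiffAt ℝ 2 (srcFun (remainderTime c η) (obsPt z σ α t w.1) t)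
      (z w.2 (emT z σ η α t w), emT z σ η α t w) :=
    (H.contDiffAt_src_travelTime hw).sub hm
  have hsplit : η = fun x t y τ => modelTime c x t y τ + remainderTime c η x t y τ := by
    ext x t y τ
    simp [modelTime, remainderTime, diagRemainder]
  have e := alongCurve_add hm hr (Y w.2 (emT z σ η α t w), b)
    (timeDeriv Y w.2 (emT z σ η α t w), 0)
  rw [← hsplit, alongCurve_modelTime H.soundSpeed H.obstacle.contDiff hs hw.2.2.2
    (hY.hasDerivAt le_rfl w.2 hs)] at e
  rw [e]
  have e1 := inner_sep_div (z := z) (σ := σ) (η := η) (α := α) (t := t) w (Y w.2 (emT z σ η α t w))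
  have e2 := inner_sep_div (z := z) (σ := σ) (η := η) (α := α) (t := t) w
    (timeDeriv Y w.2 (emT z σ η α t w))
  have e3 := inner_sep_div (z := z) (σ := σ) (η := η) (α := α) (t := t) w
    (velocity z w.2 (emT z σ η α t w))
  have hgap : ‖obsPt z σ α t w.1 - z w.2 (emT z σ η α t w)‖ = gap z σ η α t w := rfl
  have hsep : obsPt z σ α t w.1 - z w.2 (emT z σ η α t w) = sep z σ η α t w := rfl
  have ht1 : totalDeriv (slownessKernel c) z (obsPt z σ α t w.1) t w.2 (emT z σ η α t w)
    = fderiv ℝ (fun q : E3 × ℝ => slowness c q.1 q.2) (z w.2 (emT z σ η α t w), emT z σ η α t w)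
      (velocity z w.2 (emT z σ η α t w), 1) := rfl
  have ht2 : srcFun (slownessKernel c) (obsPt z σ α t w.1) t
    = fun q : E3 × ℝ => slowness c q.1 q.2 := rfl
  rw [hgap, hsep, ht1, ht2, ← e1, ← e2, ← e3]
  field_simp
  ring

end IsDoubleLayerSetting

/-! ### The leading part of the density near the singularity -/

/-- The field of a uniformly moving dipole layer: a solid angle form, homogeneous of degree `-2`. -/
noncomputable def leadForm (κ : ℝ) (N V Q : E3) : ℝ :=
  ((1 - κ ^ 2 * ‖V‖ ^ 2) * ⟪N, Q⟫ + κ ^ 2 * ⟪N, V⟫ * ⟪V, Q⟫)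
    / √(κ ^ 2 * ⟪V, Q⟫ ^ 2 + (1 - κ ^ 2 * ‖V‖ ^ 2) * ‖Q‖ ^ 2) ^ 3

lemma leadForm_smul {κ s : ℝ} (hs : 0 < s) (N V Q : E3) :
    leadForm κ N V (s • Q) = (s ^ 2)⁻¹ * leadForm κ N V Q := by
  unfold leadForm
  have h : κ ^ 2 * ⟪V, s • Q⟫ ^ 2 + (1 - κ ^ 2 * ‖V‖ ^ 2) * ‖s • Q‖ ^ 2
      = s ^ 2 * (κ ^ 2 * ⟪V, Q⟫ ^ 2 + (1 - κ ^ 2 * ‖V‖ ^ 2) * ‖Q‖ ^ 2) := by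
    rw [real_inner_smul_right, norm_smul, mul_pow, mul_pow, Real.norm_eq_abs, sq_abs]; ring
  rw [h, Real.sqrt_mul (by positivity), Real.sqrt_sq hs.le, real_inner_smul_right,
    real_inner_smul_right, mul_pow]
  -- No sign of the radicand is assumed; where its root vanishes both sides are 0 by the convention
  -- for division.
  by_cases h0 : √(κ ^ 2 * ⟪V, Q⟫ ^ 2 + (1 - κ ^ 2 * ‖V‖ ^ 2) * ‖Q‖ ^ 2) = 0
  · simp [h0]
  · field_simp

/-- For a unit vector `ν`, the radicand of `leadForm` at `ν - κ V` is a perfect square. -/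
lemma leadForm_radicand {κ : ℝ} {V ν : E3} (hν : ‖ν‖ = 1) :
    κ ^ 2 * ⟪V, ν - κ • V⟫ ^ 2 + (1 - κ ^ 2 * ‖V‖ ^ 2) * ‖ν - κ • V‖ ^ 2
      = (1 - κ * ⟪ν, V⟫) ^ 2 := by
  rw [norm_sub_sq_real, inner_sub_right, real_inner_smul_right, real_inner_smul_right, norm_smul,
    mul_pow, Real.norm_eq_abs, sq_abs, hν, real_inner_self_eq_norm_sq, real_inner_comm]
  ring

/-- The passage from retarded to present position. The left side is what survives of r² times the
density when h ≈ κr. A source seen at unit distance in direction ν has moved by κV during the delay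
κ, so its present separation is ν − κV. -/
lemma leadForm_retarded {κ : ℝ} {N V ν : E3} (hκ : κ ≠ 0) (hν : ‖ν‖ = 1)
    (hq : 0 < 1 - κ * ⟪ν, V⟫) :
    κ * (-(κ * (⟪V, N⟫ - ⟪ν, N⟫ * ⟪ν, V⟫)) * κ⁻¹ * (1 - κ * ⟪ν, V⟫)⁻¹ ^ 2
        + -(κ * ⟪ν, N⟫) * -(κ * ⟪ν, V⟫) * κ⁻¹ ^ 2 * (1 - κ * ⟪ν, V⟫)⁻¹ ^ 2
        + -(κ * ⟪ν, N⟫) * (κ * (⟪V, V⟫ - ⟪ν, V⟫ * ⟪ν, V⟫)) * κ⁻¹ * (1 - κ * ⟪ν, V⟫)⁻¹ ^ 3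
        - -(κ * ⟪ν, N⟫) * κ⁻¹ ^ 2 * (1 - κ * ⟪ν, V⟫)⁻¹)
      = leadForm κ N V (ν - κ • V) := by
  unfold leadForm
  rw [leadForm_radicand hν, Real.sqrt_sq hq.le]
  simp only [inner_sub_right, real_inner_smul_right, real_inner_self_eq_norm_sq,
    real_inner_comm ν N, real_inner_comm ν V, real_inner_comm V N]
  have := hq.ne'
  rw [real_inner_comm] at this
  field_simp
  ring

/-- The linearization at `(0, α)` of the vector from the surface point to the observation point. -/
noncomputable def modelVec (z : S2 → ℝ → E3) (σ : ℝ) (α : S2) (t : ℝ) (w : ℝ × S2) : E3 :=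
  (w.1 * ⟪(α : E3), (w.2 : E3)⟫) • unitNormal z σ α t - surfDeriv z α t (w.2 : E3)

/-- The leading part of the density. -/
noncomputable def modelKernel (c : E3 → ℝ → ℝ) (z : S2 → ℝ → E3) (σ : ℝ) (μ : S2 → ℝ → ℝ) (α : S2)
    (t : ℝ) (w : ℝ × S2) : ℝ :=
  μ α t * surfJ z α t / (4 * Real.pi) * (⟪(α : E3), (w.2 : E3)⟫⁻¹ *
    leadForm (slowness c (z α t) t) (unitNormal z σ α t) (velocity z α t) (modelVec z σ α t w))

/-! ### Freezing of the amplitude and linearization of the separation. -/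

namespace IsDoubleLayerSetting

open Asymptotics

variable {T : ℝ} {c : E3 → ℝ → ℝ} {Ωm : ℝ → Set E3} {z : S2 → ℝ → E3} {σ : ℝ}
  {η A : E3 → ℝ → E3 → ℝ → ℝ} {μ : S2 → ℝ → ℝ} {t : ℝ} {α : S2}

lemma slowness_pos (H : IsDoubleLayerSetting T c Ωm z σ η A μ) (ht : t ∈ Ico 0 T) (y : E3) :
    0 < slowness c y t := one_div_pos.2 (H.soundSpeed.pos y t ht)

/-- Non-degeneracy in the direction of the velocity itself: the full speed is subsonic, not only its
normal part. This makes the quadratic form under the root of `leadForm` positive definite. -/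
lemma slowness_mul_speed_lt (H : IsDoubleLayerSetting T c Ωm z σ η A μ) (ht : t ∈ Ico 0 T)
    (α : S2) : slowness c (z α t) t * ‖velocity z α t‖ < 1 := by
  by_cases h : velocity z α t = 0
  · simp [h]
  · have h1 := norm_ne_zero_iff.mpr h
    have h2 := H.travelTime.nondegenerate_diag α t ht (‖velocity z α t‖⁻¹ • velocity z α t) (by
      rw [norm_smul, norm_inv, norm_norm, inv_mul_cancel₀ h1])
    rw [real_inner_smul_right, real_inner_self_eq_norm_sq] at h2
    have h3 : ‖velocity z α t‖⁻¹ * ‖velocity z α t‖ ^ 2 = ‖velocity z α t‖ := by field_simp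
    rw [h3] at h2
    linarith

lemma le_one_sub_inner (H : IsDoubleLayerSetting T c Ωm z σ η A μ) (ht : t ∈ Ico 0 T) (α : S2)
    {ν : E3} (hν : ‖ν‖ = 1) : 1 - slowness c (z α t) t * ‖velocity z α t‖
      ≤ 1 - slowness c (z α t) t * ⟪ν, velocity z α t⟫ := by
  have h1 := real_inner_le_norm ν (velocity z α t)
  rw [hν, one_mul] at h1
  have := mul_le_mul_of_nonneg_left h1 (H.slowness_pos ht (z α t)).le
  linarith

lemma isBigO_obsPt (H : IsDoubleLayerSetting T c Ωm z σ η A μ) (ht : t ∈ Ioo 0 T) :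
    (fun w : ℝ × S2 => w.1) =O[approach α] gap z σ η α t := by
  refine IsBigO.trans (IsBigO.of_bound 1 ?_) (H.isBigO_param ht)
  filter_upwards [eventually_nonneg α] with w hw
  rw [one_mul, Real.norm_of_nonneg hw, Real.norm_of_nonneg (by positivity)]
  linarith [norm_nonneg ((w.2 : E3) - α)]

lemma isBigO_fderiv_amplitude (H : IsDoubleLayerSetting T c Ωm z σ η A μ) (ht : t ∈ Ioo 0 T) :
    (fun w => fderiv ℝ (srcFun A (obsPt z σ α t w.1) t)
      (z w.2 (emT z σ η α t w), emT z σ η α t w)) =O[approach α] (fun _ => (1 : ℝ)) := by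
  obtain ⟨M, hM⟩ := H.amplitude.deriv_bounded (z α t) t ⟨ht.1.le, ht.2⟩
  refine IsBigO.of_bound M ?_
  filter_upwards [(H.tendsto_pair (α := α) ht).eventually hM, H.eventually_proper ht] with w hw hp
  rw [norm_one, mul_one]
  exact hw hp

/-- Mean value theorem on the segment from the observation event to the source event. The open
segment avoids the diagonal, so the amplitude is differentiable along it. -/
lemma amplitude_sub_le (H : IsDoubleLayerSetting T c Ωm z σ η A μ) {x y : E3} {τ M : ℝ}
    (hp : ((x, t), (y, τ)) ∈ properPairs T)
    (hM : ∀ s ∈ Ioo (0 : ℝ) 1,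
      ‖fderiv ℝ (srcFun A x t) ((x, t) + s • ((y, τ) - (x, t)))‖ ≤ M) :
    |A x t y τ - slowness c x t| ≤ M * ‖(y, τ) - (x, t)‖ := by
  have ht : t ∈ Ico 0 T := ⟨hp.1.trans hp.2.1.le, hp.2.2.1⟩
  have hτt : τ < t := hp.2.1
  have hτ0 : 0 ≤ τ := hp.1
  have hxy : x ≠ y := hp.2.2.2
  set q : ℝ → E3 × ℝ := fun s => (x, t) + s • ((y, τ) - (x, t)) with hq
  have hq1 : ∀ s, (q s).1 = x + s • (y - x) := fun s => rfl
  have hq2 : ∀ s, (q s).2 = t + s * (τ - t) := fun s => rfl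
  have hprop : ∀ s ∈ Ioc (0 : ℝ) 1, ((x, t), q s) ∈ properPairs T := by
    intro s hs
    refine ⟨?_, ?_, ht.2, ?_⟩
    · rw [hq2]; nlinarith [hs.1, hs.2]
    · rw [hq2]; nlinarith [hs.1]
    · rw [hq1]
      intro h
      have : s • (y - x) = 0 := by simpa using h
      rcases smul_eq_zero.1 this with h0 | h0
      · exact hs.1.ne' h0
      · exact hxy (sub_eq_zero.1 h0).symm
  have hder : ∀ s ∈ Ioc (0 : ℝ) 1, HasDerivAt (fun s => srcFun A x t (q s))
      (fderiv ℝ (srcFun A x t) (q s) ((y, τ) - (x, t))) s := by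
    intro s hs
    have h1 := ((H.contDiffAt_src_amplitude (hprop s hs)).differentiableAt (by simp)).hasFDerivAt
    have h2 : HasDerivAt q ((y, τ) - (x, t)) s := by
      have := ((hasDerivAt_id s).smul_const ((y, τ) - (x, t))).const_add (x, t)
      rwa [one_smul] at this
    exact h1.comp_hasDerivAt s h2
  have hcont : ContinuousOn (fun s => srcFun A x t (q s)) (Icc 0 1) := by
    intro s hs
    -- The endpoint s = 0 lies on the diagonal, where only continuity through causal pairs is
    -- available.
    rcases hs.1.eq_or_lt with h0 | h0
    · subst h0
      have h1 : Continuous fun s => ((x, t), q s) := by fun_prop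
      have h2 : ContinuousWithinAt (fun s => ((x, t), q s)) (Icc 0 1) 0 :=
        h1.continuousWithinAt
      have h3 := H.amplitude.continuous_diag x t ht
      have h4 : ((x, t), q 0) = ((x, t), (x, t)) := by simp [hq]
      rw [← h4] at h3
      refine h3.comp (g := onEvents A) (f := fun s => ((x, t), q s)) h2 fun s hs => ⟨?_, ?_, ht.2⟩
      · rw [hq2]; nlinarith [hs.1, hs.2]
      · rw [hq2]; nlinarith [hs.1]
    · exact (hder s ⟨h0, hs.2⟩).continuousAt.continuousWithinAt
  obtain ⟨s, hs, he⟩ := exists_deriv_eq_slope _ one_pos hcont fun s hs =>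
    (hder s ⟨hs.1, hs.2.le⟩).differentiableAt.differentiableWithinAt
  rw [(hder s ⟨hs.1, hs.2.le⟩).deriv] at he
  have e1 : srcFun A x t (q 1) = A x t y τ := by simp [hq, srcFun]
  have e0 : srcFun A x t (q 0) = slowness c x t := by
    simp [hq, srcFun, H.amplitude.diag x t ht]
  rw [e1, e0, sub_zero, div_one] at he
  rw [← he, ← Real.norm_eq_abs]
  exact (ContinuousLinearMap.le_opNorm _ _).trans
    (mul_le_mul_of_nonneg_right (hM s hs) (norm_nonneg _))

/-- The amplitude is compared with its diagonal value κ(x,t) at the observation event, and this with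
κ(z(α,t),t). Both events lie within O(r) of (z(α,t),t), and a ball, being convex, contains the
segment between them. -/
lemma closeTo_amplitude (H : IsDoubleLayerSetting T c Ωm z σ η A μ) (ht : t ∈ Ioo 0 T) :
    CloseTo (approach α) (gap z σ η α t)
      (fun w => A (obsPt z σ α t w.1) t (z w.2 (emT z σ η α t w)) (emT z σ η α t w))
      (fun _ => slowness c (z α t) t) := by
  have ht' : t ∈ Ico 0 T := ⟨ht.1.le, ht.2⟩
  have hobs : (fun w : ℝ × S2 => (obsPt z σ α t w.1, t) - (z α t, t)) =O[approach α]
      gap z σ η α t := by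
    have h1 : (fun w : ℝ × S2 => obsPt z σ α t w.1 - z α t) =O[approach α] gap z σ η α t := by
      refine IsBigO.trans (IsBigO.of_bound ‖unitNormal z σ α t‖ (Eventually.of_forall fun w => ?_))
        (H.isBigO_obsPt ht)
      rw [obsPt, add_sub_cancel_left, norm_smul, mul_comm]
    exact h1.prod_left ((isBigO_zero _ _).congr_left fun w => by simp)
  have hκ : (fun w : ℝ × S2 => slowness c (obsPt z σ α t w.1) t - slowness c (z α t) t)
      =O[approach α] gap z σ η α t := by
    have hd := (H.soundSpeed.contDiffAt_slowness (z α t) ht').differentiableAt (by simp)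
    have hl : Tendsto (fun w : ℝ × S2 => (obsPt z σ α t w.1, t)) (approach α) (𝓝 (z α t, t)) :=
      tendsto_obsPt.prodMk_nhds tendsto_const_nhds
    exact (hd.hasFDerivAt.isBigO_sub.comp_tendsto hl).trans hobs
  obtain ⟨M, hM⟩ := H.amplitude.deriv_bounded (z α t) t ht'
  obtain ⟨ρ, hρ, hball⟩ := Metric.eventually_nhds_iff_ball.1 hM
  have hdiff : (fun w : ℝ × S2 => (z w.2 (emT z σ η α t w), emT z σ η α t w)
      - (obsPt z σ α t w.1, t)) =O[approach α] gap z σ η α t :=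
    ((H.isBigO_source ht).sub hobs).congr_left fun w => by abel
  have hA : (fun w => A (obsPt z σ α t w.1) t (z w.2 (emT z σ η α t w)) (emT z σ η α t w)
      - slowness c (obsPt z σ α t w.1) t) =O[approach α] gap z σ η α t := by
    refine IsBigO.trans (IsBigO.of_bound M ?_) hdiff
    have hl : Tendsto (fun w : ℝ × S2 => (((obsPt z σ α t w.1, t), (obsPt z σ α t w.1, t)) :
        (E3 × ℝ) × (E3 × ℝ))) (approach α) (𝓝 ((z α t, t), (z α t, t))) := by
      have : Tendsto (fun w : ℝ × S2 => (obsPt z σ α t w.1, t)) (approach α) (𝓝 (z α t, t)) :=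
        tendsto_obsPt.prodMk_nhds tendsto_const_nhds
      exact this.prodMk_nhds this
    filter_upwards [H.eventually_proper ht, (H.tendsto_pair (α := α) ht).eventually
      (Metric.ball_mem_nhds _ hρ), hl.eventually (Metric.ball_mem_nhds _ hρ)] with w hp h1 h0
    refine H.amplitude_sub_le hp fun s hs => ?_
    have hconv := (convex_ball (((z α t, t), (z α t, t)) : (E3 × ℝ) × (E3 × ℝ)) ρ).add_smul_sub_mem
      h0 h1 ⟨hs.1.le, hs.2.le⟩
    have hmem := hball _ hconv
    simp only [Prod.mk_sub_mk, sub_self, Prod.smul_mk, smul_zero, Prod.mk_add_mk, add_zero] at hmem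
    refine hmem ⟨?_, ?_, ht.2, ?_⟩
    · have := hp.1; have := hp.2.1
      simp only [smul_eq_mul] at *
      nlinarith [hs.1, hs.2, ht.1]
    · have := hp.2.1
      simp only [smul_eq_mul] at *
      nlinarith [hs.1, hs.2]
    · intro h
      have h3 : s • (z w.2 (emT z σ η α t w) - obsPt z σ α t w.1) = 0 := by simpa using h
      rcases smul_eq_zero.1 h3 with h4 | h4
      · exact hs.1.ne' h4
      · exact hp.2.2.2 (sub_eq_zero.1 h4).symm
  exact ⟨(hA.add hκ).congr_left fun w => by ring, isBigO_const_const _ one_ne_zero _⟩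

/-- The difference between `modelVec` and the present separation r(ν − κV) consists of ε(⟪α, β⟫ −
1)N, the Taylor error of z and the error of t − τ ≈ κr times V. Each is O(r²). -/
lemma closeTo_modelVec (H : IsDoubleLayerSetting T c Ωm z σ η A μ) (ht : t ∈ Ioo 0 T) :
    CloseTo (approach α) (gap z σ η α t) (fun w => (gap z σ η α t w)⁻¹ • modelVec z σ α t w)
      (fun w => sepDir z σ η α t w - slowness c (z α t) t • velocity z α t) := by
  have hg := H.tendsto_gap (α := α) ht
  have ht' : t ∈ Ico 0 T := ⟨ht.1.le, ht.2⟩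
  have hν := CloseTo.refl (r := gap z σ η α t) (H.isBigO_sepDir (α := α) ht)
  refine ⟨?_, (hν.sub' (CloseTo.const _)).bdd⟩
  have hb : (fun w : ℝ × S2 => ‖(w.2 : E3) - α‖ + |emT z σ η α t w - t|) =O[approach α]
      gap z σ η α t :=
    (H.isBigO_sub_coe ht).norm_left.add (H.isBigO_emT_sub ht).norm_left
  have hE := (H.isBigO_taylor (α := α) ht).trans (hb.pow 2)
  have hs : (fun w => (t - emT z σ η α t w - slowness c (z α t) t * gap z σ η α t w)
      • velocity z α t) =O[approach α] fun w => gap z σ η α t w ^ 2 := by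
    have h1 := ((H.closeTo_delay (α := α) ht).sub.mul (isBigO_refl (gap z σ η α t) _)).congr_right
      (g₂ := fun w => gap z σ η α t w ^ 2) fun w => by ring
    have h2 := (h1.smul (isBigO_const_const (velocity z α t) (one_ne_zero (α := ℝ)) (approach α)))
    refine (h2.congr' ?_ (Eventually.of_forall fun w => by simp))
    filter_upwards [H.eventually_gap_pos ht] with w hw
    congr 1
    field_simp
  have hn : (fun w : ℝ × S2 => (w.1 * (⟪(α : E3), (w.2 : E3)⟫ - 1)) • unitNormal z σ α t)
      =O[approach α] fun w => gap z σ η α t w ^ 2 := by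
    have h0 : (fun w : ℝ × S2 => ⟪(α : E3), (w.2 : E3)⟫ - 1) =O[approach α] gap z σ η α t := by
      have h1 := ((H.isBigO_sub_coe (α := α) ht).norm_left.mul
        ((tendsto_param α).isBigO_one ℝ)).const_mul_left (-1 / 2)
      refine h1.congr (fun w => ?_) fun w => by simp
      have := inner_sub_self α w.2
      rw [inner_sub_right, S2.inner_self] at this
      rw [this]
      change -1 / 2 * (‖(w.2 : E3) - α‖ * ‖(w.2 : E3) - α‖) = _
      ring
    have h2 := ((H.isBigO_obsPt ht).mul h0).smul
      (isBigO_const_const (unitNormal z σ α t) (one_ne_zero (α := ℝ)) (approach α))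
    exact h2.congr_right fun w => by simp [sq]
  have hall := (isBigO_refl (fun w => (gap z σ η α t w)⁻¹) (approach α)).smul ((hn.add hE).sub hs)
  refine hall.congr' ?_ ?_
  · filter_upwards [H.eventually_gap_pos ht] with w hw
    have e : modelVec z σ α t w - sep z σ η α t w
        + (slowness c (z α t) t * gap z σ η α t w) • velocity z α t
        = (w.1 * (⟪(α : E3), (w.2 : E3)⟫ - 1)) • unitNormal z σ α t
          + (z w.2 (emT z σ η α t w) - z α t - surfDeriv z α t ((w.2 : E3) - α)
              - (emT z σ η α t w - t) • velocity z α t)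
          - (t - emT z σ η α t w - slowness c (z α t) t * gap z σ η α t w) • velocity z α t := by
      rw [modelVec, sep, obsPt, map_sub, surfDeriv_self H.obstacle.contDiff ht']
      module
    rw [← e, sepDir, smul_add, smul_sub, smul_smul,
      show (gap z σ η α t w)⁻¹ * (slowness c (z α t) t * gap z σ η α t w) = slowness c (z α t) t by
        field_simp]
    abel
  · filter_upwards [H.eventually_gap_pos ht] with w hw
    simp only [smul_eq_mul]
    field_simp

end IsDoubleLayerSetting

/-! ### Comparison of the density with its leading part. -/

namespace IsDoubleLayerSetting

open Asymptotics

variable {T : ℝ} {c : E3 → ℝ → ℝ} {Ωm : ℝ → Set E3} {z : S2 → ℝ → E3} {σ : ℝ}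
  {η A : E3 → ℝ → E3 → ℝ → ℝ} {μ : S2 → ℝ → ℝ} {t : ℝ} {α : S2}

/-- At ν − κV the radicand is (1 − κ⟪ν, V⟫)² ≥ (1 − κ‖V‖)², a positive bound uniform in the
direction; hence root and inverse preserve closeness. -/
lemma closeTo_leadForm (H : IsDoubleLayerSetting T c Ωm z σ η A μ) (ht : t ∈ Ioo 0 T) :
    CloseTo (approach α) (gap z σ η α t)
      (fun w => leadForm (slowness c (z α t) t) (unitNormal z σ α t) (velocity z α t)
        ((gap z σ η α t w)⁻¹ • modelVec z σ α t w))
      (fun w => leadForm (slowness c (z α t) t) (unitNormal z σ α t) (velocity z α t)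
        (sepDir z σ η α t w - slowness c (z α t) t • velocity z α t)) := by
  have ht' : t ∈ Ico 0 T := ⟨ht.1.le, ht.2⟩
  have hg := H.tendsto_gap (α := α) ht
  have hQ := H.closeTo_modelVec (α := α) ht
  have hN := (CloseTo.const (l := approach α) (r := gap z σ η α t) (unitNormal z σ α t)).inner' hg hQ
  have hV := (CloseTo.const (l := approach α) (r := gap z σ η α t) (velocity z α t)).inner' hg hQ
  have hQQ := hQ.inner' hg hQ
  simp only [real_inner_self_eq_norm_sq] at hQQ
  have k : ∀ a : ℝ, CloseTo (approach α) (gap z σ η α t) (fun _ => a) (fun _ => a) := CloseTo.const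
  have hrad := ((k (slowness c (z α t) t ^ 2)).mul hg (hV.mul hg hV)).add
    ((k (1 - slowness c (z α t) t ^ 2 * ‖velocity z α t‖ ^ 2)).mul hg hQQ)
  simp only [← sq] at hrad
  have hδ : 0 < 1 - slowness c (z α t) t * ‖velocity z α t‖ := by
    linarith [H.slowness_mul_speed_lt ht' α]
  have hlow : ∀ᶠ w in approach α, (1 - slowness c (z α t) t * ‖velocity z α t‖) ^ 2
      ≤ slowness c (z α t) t ^ 2
        * ⟪velocity z α t, sepDir z σ η α t w - slowness c (z α t) t • velocity z α t⟫ ^ 2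
        + (1 - slowness c (z α t) t ^ 2 * ‖velocity z α t‖ ^ 2)
          * ‖sepDir z σ η α t w - slowness c (z α t) t • velocity z α t‖ ^ 2 := by
    filter_upwards [H.eventually_norm_sepDir ht] with w hw
    rw [leadForm_radicand hw]
    exact pow_le_pow_left₀ hδ.le (H.le_one_sub_inner ht' α hw) 2
  have hsq := hrad.sqrt hg (by positivity) hlow
  have hsq_low : ∀ᶠ w in approach α, (1 - slowness c (z α t) t * ‖velocity z α t‖)
      ≤ √(slowness c (z α t) t ^ 2
        * ⟪velocity z α t, sepDir z σ η α t w - slowness c (z α t) t • velocity z α t⟫ ^ 2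
        + (1 - slowness c (z α t) t ^ 2 * ‖velocity z α t‖ ^ 2)
          * ‖sepDir z σ η α t w - slowness c (z α t) t • velocity z α t‖ ^ 2) := by
    filter_upwards [hlow] with w hw
    exact Real.le_sqrt_of_sq_le hw
  have hinv := hsq.inv hg hδ hsq_low
  have hnum := ((k (1 - slowness c (z α t) t ^ 2 * ‖velocity z α t‖ ^ 2)).mul hg hN).add
    ((k (slowness c (z α t) t ^ 2 * ⟪unitNormal z σ α t, velocity z α t⟫)).mul hg hV)
  have hall := hnum.mul hg (hinv.mul hg (hinv.mul hg hinv))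
  refine (hall.congr_left (Eventually.of_forall fun w => ?_)).congr_right
    (Eventually.of_forall fun w => ?_)
  all_goals
    unfold leadForm
    beta_reduce
    rw [div_eq_mul_inv, ← inv_pow]
    ring

/-- Count powers of 1/r, with h ≈ κr and second derivatives of η of size 1/r. The terms of order r⁻²
are frozen and combined by `leadForm_retarded`; all others are O(1/r). -/
lemma closeTo_retardedKernel (H : IsDoubleLayerSetting T c Ωm z σ η A μ) (ht : t ∈ Ioo 0 T) :
    CloseTo (approach α) (gap z σ η α t)
      (fun w => gap z σ η α t w ^ 2 * (4 * Real.pi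
        * retardedKernel z σ η A μ (obsPt z σ α t w.1) t w.2 (emT z σ η α t w)))
      (fun w => μ α t * surfJ z α t * leadForm (slowness c (z α t) t) (unitNormal z σ α t)
        (velocity z α t) (sepDir z σ η α t w - slowness c (z α t) t • velocity z α t)) := by
  have ht' : t ∈ Ico 0 T := ⟨ht.1.le, ht.2⟩
  have hg := H.tendsto_gap (α := α) ht
  have hκ := H.slowness_pos ht' (z α t)
  have hδ : 0 < 1 - slowness c (z α t) t * ‖velocity z α t‖ := by
    linarith [H.slowness_mul_speed_lt ht' α]
  have k : ∀ a : ℝ, CloseTo (approach α) (gap z σ η α t) (fun _ => a) (fun _ => a) := CloseTo.const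
  have ca := H.closeTo_amplitude (α := α) ht
  have cg := H.closeTo_fderiv_travelTime (α := α) ht H.contDiff_normal 0
  have ch1 := H.closeTo_fderiv_travelTime (α := α) ht H.contDiff_velocity 1
  have cG := H.closeTo_alongCurve_travelTime (α := α) ht H.contDiff_normal 0
  have cH := H.closeTo_alongCurve_travelTime (α := α) ht H.contDiff_velocity 1
  have cm := (H.closeTo_sphere (α := α) ht H.contDiff_density).mul hg
    (H.closeTo_sphere ht H.contDiff_surfJ)
  have chi := (H.closeTo_delay (α := α) ht).inv hg hκ (Eventually.of_forall fun _ => le_rfl)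
  have hqlow : ∀ᶠ w in approach α, 1 - slowness c (z α t) t * ‖velocity z α t‖
      ≤ 1 + -(slowness c (z α t) t * ⟪sepDir z σ η α t w, velocity z α t⟫) := by
    filter_upwards [H.eventually_norm_sepDir ht] with w hw
    simpa [sub_eq_add_neg] using H.le_one_sub_inner ht' α hw
  have cqi := ((k 1).add ch1).inv hg hδ hqlow
  have hm1 : (fun w => timeDeriv μ w.2 (emT z σ η α t w) * surfJ z w.2 (emT z σ η α t w)
      + μ w.2 (emT z σ η α t w) * timeDeriv (surfJ z) w.2 (emT z σ η α t w))
      =O[approach α] (fun _ => (1 : ℝ)) :=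
    (((H.tendsto_sphere ht (ContDiffOnSphere.timeDeriv (k := 0) H.contDiff_density)).mul
      (H.tendsto_sphere ht H.contDiff_surfJ)).add ((H.tendsto_sphere ht H.contDiff_density).mul
        (H.tendsto_sphere ht (ContDiffOnSphere.timeDeriv (k := 0) H.contDiff_surfJ)))).isBigO_one ℝ
  have haN := isBigO_clm_apply (H.isBigO_fderiv_amplitude (α := α) ht)
    (H.isBigO_field ht H.contDiff_normal 0)
  have ha1 := isBigO_clm_apply (H.isBigO_fderiv_amplitude (α := α) ht)
    (H.isBigO_field ht H.contDiff_velocity 1)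
  have mulO : ∀ {f g : ℝ × S2 → ℝ}, f =O[approach α] (fun _ => (1 : ℝ)) →
      g =O[approach α] (fun _ => (1 : ℝ)) →
      (fun w => f w * g w) =O[approach α] (fun _ => (1 : ℝ)) := fun hf h => by
    have := hf.mul h
    simp only [mul_one] at this
    exact this
  have bg := cg.isBigO_one hg
  have bm := cm.isBigO_one hg
  have ba := ca.isBigO_one hg
  have bhi := chi.isBigO_one hg
  have bqi := cqi.isBigO_one hg
  -- The lower order terms: those with a derivative of the amplitude or of the weight carry a single
  -- inverse power of h.
  have hlow := ((mulO (mulO haN bm) (mulO bhi bqi)).sub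
    (mulO ((mulO (mulO ha1 bg) bm).add (mulO (mulO ba bg) hm1)) (mulO bhi (mulO bqi bqi))))
  have clow : CloseTo (approach α) (gap z σ η α t) (fun w => gap z σ η α t w * _) (fun _ => 0) :=
    CloseTo.of_isBigO (by
      have := (isBigO_refl (gap z σ η α t) (approach α)).mul hlow
      simp only [mul_one] at this
      exact this)
  have cq2 := cqi.mul hg cqi
  have cq3 := cqi.mul hg cq2
  have ch2 := chi.mul hg chi
  have cmain := (ca.mul hg cm).mul hg ((((cG.neg.mul hg chi).mul hg cq2).add
    (((cg.mul hg ch1).mul hg ch2).mul hg cq2)).add (((cg.mul hg cH).mul hg chi).mul hg cq3) |>.sub'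
      ((cg.mul hg ch2).mul hg cqi))
  refine ((clow.add cmain).congr_left ?_).congr_right ?_
  · filter_upwards [H.eventually_proper ht, H.eventually_emT ht, H.eventually_gap_pos ht]
      with w hw he hp
    have hq := H.travelTime.nondegenerate _ _ w.2 _ hw.1 hw.2.1 ht.2 hw.2.2.2
    have hh : 0 < η (obsPt z σ α t w.1) t (z w.2 (emT z σ η α t w)) (emT z σ η α t w) := by
      rw [← he.2]; linarith [he.1.2]
    unfold retardedKernel kernelForm
    rw [he.2]
    simp only [totalDeriv] at hq ⊢
    have hπ := Real.pi_pos.ne'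
    have hq' := hq.ne'
    have hh' := hh.ne'
    generalize alongCurve η z (obsPt z σ α t w.1) t w.2 (emT z σ η α t w) _ _ = G
    generalize alongCurve η z (obsPt z σ α t w.1) t w.2 (emT z σ η α t w) _ _ = G'
    generalize fderiv ℝ (srcFun A (obsPt z σ α t w.1) t) _ _ = A1 at *
    generalize fderiv ℝ (fun q : E3 × ℝ => A (obsPt z σ α t w.1) t q.1 q.2) _ _ = A2 at *
    generalize fderiv ℝ (srcFun η (obsPt z σ α t w.1) t) _ _ = B1 at *
    generalize fderiv ℝ (fun q : E3 × ℝ => η (obsPt z σ α t w.1) t q.1 q.2) _ _ = B2 at *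
    field_simp
    ring
  · filter_upwards [H.eventually_norm_sepDir ht] with w hw
    rw [← leadForm_retarded hκ.ne' hw (hδ.trans_le (H.le_one_sub_inner ht' α hw))]
    simp only [← sub_eq_add_neg]
    ring

lemma closeTo_inner_coe (H : IsDoubleLayerSetting T c Ωm z σ η A μ) (ht : t ∈ Ioo 0 T) :
    CloseTo (approach α) (gap z σ η α t) (fun w : ℝ × S2 => ⟪(α : E3), (w.2 : E3)⟫)
      (fun _ => 1) := by
  refine ⟨?_, isBigO_const_const _ one_ne_zero _⟩
  have h := ((isBigO_const_const (‖(α : E3)‖) (one_ne_zero (α := ℝ)) (approach α)).mul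
    (H.isBigO_sub_coe (α := α) ht).norm_left)
  simp only [one_mul] at h
  refine IsBigO.trans (IsBigO.of_bound 1 (Eventually.of_forall fun w => ?_)) h
  have h1 : ⟪(α : E3), (w.2 : E3)⟫ - 1 = ⟪(α : E3), (w.2 : E3) - α⟫ := by
    rw [inner_sub_right, S2.inner_self]
  rw [h1, one_mul, norm_mul, norm_norm, norm_norm]
  exact norm_inner_le_norm _ _

/-- Near the singularity the density differs from its leading part by an integrable error. -/
lemma isBigO_density_sub_model (H : IsDoubleLayerSetting T c Ωm z σ η A μ) (ht : t ∈ Ioo 0 T) :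
    (fun w : ℝ × S2 => doubleLayerDensity z σ η A μ (obsPt z σ α t w.1) t w.2
        - modelKernel c z σ μ α t w)
      =O[approach α] fun w => (w.1 + ‖(w.2 : E3) - α‖)⁻¹ := by
  have ht' : t ∈ Ico 0 T := ⟨ht.1.le, ht.2⟩
  have hg := H.tendsto_gap (α := α) ht
  have h1 := H.closeTo_retardedKernel (α := α) ht
  have hi := (H.closeTo_inner_coe (α := α) ht).inv hg one_pos (Eventually.of_forall fun _ => le_rfl)
  have h2 := ((CloseTo.const (l := approach α) (r := gap z σ η α t) (μ α t * surfJ z α t)).mul hg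
    (hi.mul hg (H.closeTo_leadForm (α := α) ht)))
  have h3 : (fun w => gap z σ η α t w ^ 2 * (4 * Real.pi
        * retardedKernel z σ η A μ (obsPt z σ α t w.1) t w.2 (emT z σ η α t w))
      - μ α t * surfJ z α t * (⟪(α : E3), (w.2 : E3)⟫⁻¹ * leadForm (slowness c (z α t) t)
        (unitNormal z σ α t) (velocity z α t) ((gap z σ η α t w)⁻¹ • modelVec z σ α t w)))
      =O[approach α] gap z σ η α t :=
    (h1.sub.sub h2.sub).congr_left fun w => by ring
  have h4 := (h3.mul (isBigO_refl (fun w => (gap z σ η α t w ^ 2)⁻¹) _)).const_mul_left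
    (1 / (4 * Real.pi))
  have h5 : (fun w : ℝ × S2 => doubleLayerDensity z σ η A μ (obsPt z σ α t w.1) t w.2
        - modelKernel c z σ μ α t w) =O[approach α] fun w => (gap z σ η α t w)⁻¹ := by
    refine h4.congr' ?_ ?_
    · filter_upwards [H.eventually_obsPt_ne ht', H.eventually_gap_pos ht] with w hw hp
      rw [H.doubleLayerDensity_eq_retardedKernel ht hw, leadForm_smul (inv_pos.2 hp), modelKernel,
        emT]
      have hp' : retardedTime z η (obsPt z σ α t w.1) t w.2 = emT z σ η α t w := rfl
      have := hp.ne'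
      field_simp
    · filter_upwards [H.eventually_gap_pos ht] with w hp
      field_simp
  -- Inverting the comparison requires ε + |β − α| ≠ 0, which holds because (0, α) is excluded from
  -- the approach.
  refine h5.trans ((H.isBigO_param ht).inv_rev ?_)
  filter_upwards [self_mem_nhdsWithin] with w hw h0
  exfalso
  have h6 := hw.1
  have h7 : ‖(w.2 : E3) - α‖ = 0 := by linarith [norm_nonneg ((w.2 : E3) - α)]
  have h8 : w.1 = 0 := by linarith
  exact hw.2 (Prod.ext h8 (Subtype.ext (sub_eq_zero.1 (norm_eq_zero.1 h7))))

end IsDoubleLayerSetting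

/-! ### The gnomonic chart of a hemisphere -/

section Chart

open scoped ENNReal Pointwise

lemma measurable_toS2 : Measurable toS2 :=
  measurable_of_continuousOn_compl_singleton 0 fun _ hp => (continuousAt_toS2 hp).continuousWithinAt

/-- The point with coordinate `w.1` along `b 2` and coordinates `w.2` along `b 0` and `b 1`. -/
noncomputable def heightPt (b : OrthonormalBasis (Fin 3) ℝ E3) (w : ℝ × (ℝ × ℝ)) : E3 :=
  w.1 • b 2 + (w.2.1 • b 0 + w.2.2 • b 1)

lemma continuous_heightPt (b : OrthonormalBasis (Fin 3) ℝ E3) : Continuous (heightPt b) := by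
  unfold heightPt; fun_prop

lemma measurePreserving_heightPt (b : OrthonormalBasis (Fin 3) ℝ E3) :
    MeasurePreserving (heightPt b) := by
  have h1 := (volume_preserving_piFinSuccAbove (fun _ : Fin 3 => ℝ) 2).symm
  have h2 := (MeasurePreserving.id (volume : Measure ℝ)).prod
    (volume_preserving_finTwoArrow ℝ).symm
  have h3 := (b.measurePreserving_repr_symm.comp
    (PiLp.volume_preserving_toLp (Fin 3))).comp (h1.comp h2)
  have h4 : heightPt b = (b.repr.symm ∘ WithLp.toLp 2)
      ∘ ((MeasurableEquiv.piFinSuccAbove (fun _ : Fin 3 => ℝ) 2).symm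
        ∘ Prod.map id MeasurableEquiv.finTwoArrow.symm) := by
    funext w
    simp only [Function.comp_apply]
    rw [← OrthonormalBasis.sum_repr_symm, Fin.sum_univ_three]
    change _ = w.2.1 • b 0 + w.2.2 • b 1 + w.1 • b 2
    rw [heightPt, add_comm]
  rw [h4]
  exact h3

lemma heightPt_smul (b : OrthonormalBasis (Fin 3) ℝ E3) (s : ℝ) (w : ℝ × (ℝ × ℝ)) :
    heightPt b (s • w) = s • heightPt b w := by
  simp [heightPt, mul_smul, smul_add]

lemma inner_heightPt_two (b : OrthonormalBasis (Fin 3) ℝ E3) (w : ℝ × (ℝ × ℝ)) :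
    ⟪b 2, heightPt b w⟫ = w.1 := by
  simp [heightPt, inner_add_right, real_inner_smul_right, b.inner_eq_ite]

lemma inner_heightPt_zero (b : OrthonormalBasis (Fin 3) ℝ E3) (w : ℝ × (ℝ × ℝ)) :
    ⟪b 0, heightPt b w⟫ = w.2.1 := by
  simp [heightPt, inner_add_right, real_inner_smul_right, b.inner_eq_ite]

lemma inner_heightPt_one (b : OrthonormalBasis (Fin 3) ℝ E3) (w : ℝ × (ℝ × ℝ)) :
    ⟪b 1, heightPt b w⟫ = w.2.2 := by
  simp [heightPt, inner_add_right, real_inner_smul_right, b.inner_eq_ite]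

lemma norm_heightPt (b : OrthonormalBasis (Fin 3) ℝ E3) (w : ℝ × (ℝ × ℝ)) :
    ‖heightPt b w‖ = √(w.1 ^ 2 + w.2.1 ^ 2 + w.2.2 ^ 2) := by
  rw [norm_eq_sqrt_real_inner]
  congr 1
  conv_lhs => rw [heightPt]
  simp only [inner_add_left, real_inner_smul_left]
  rw [← heightPt, inner_heightPt_two, inner_heightPt_zero, inner_heightPt_one]
  ring

/-- The central projection of the plane tangent to the sphere at `b 2`. -/
noncomputable def gnomonic (b : OrthonormalBasis (Fin 3) ℝ E3) (u : ℝ × ℝ) : S2 :=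
  toS2 (heightPt b (1, u))

/-- The distance to the origin of a point of the plane tangent to the sphere. -/
noncomputable def planeNorm (u : ℝ × ℝ) : ℝ := √(1 + u.1 ^ 2 + u.2 ^ 2)

lemma planeNorm_pos (u : ℝ × ℝ) : 0 < planeNorm u := Real.sqrt_pos.2 (by positivity)

lemma one_le_planeNorm (u : ℝ × ℝ) : 1 ≤ planeNorm u :=
  Real.one_le_sqrt.2 (by nlinarith [sq_nonneg u.1, sq_nonneg u.2])

lemma continuous_planeNorm : Continuous planeNorm := by unfold planeNorm; fun_prop

lemma norm_heightPt_one (b : OrthonormalBasis (Fin 3) ℝ E3) (u : ℝ × ℝ) :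
    ‖heightPt b (1, u)‖ = planeNorm u := by
  rw [norm_heightPt, planeNorm, one_pow]

lemma heightPt_one_ne_zero (b : OrthonormalBasis (Fin 3) ℝ E3) (u : ℝ × ℝ) :
    heightPt b (1, u) ≠ 0 := by
  rw [← norm_ne_zero_iff, norm_heightPt_one]; exact (planeNorm_pos u).ne'

lemma coe_gnomonic (b : OrthonormalBasis (Fin 3) ℝ E3) (u : ℝ × ℝ) :
    (gnomonic b u : E3) = (planeNorm u)⁻¹ • heightPt b (1, u) := by
  rw [gnomonic, coe_toS2 (heightPt_one_ne_zero b u), norm_heightPt_one]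

lemma measurable_gnomonic (b : OrthonormalBasis (Fin 3) ℝ E3) : Measurable (gnomonic b) :=
  measurable_toS2.comp ((continuous_heightPt b).measurable.comp (measurable_prodMk_left))

/-- Radial integral over a ray inside the unit ball: a ray through a plane point at distance R
leaves the ball at height 1/R. -/
lemma lintegral_sq_indicator {R : ℝ} (hR : 0 < R) :
    ∫⁻ s in Ioi (0 : ℝ), {s : ℝ | s * R < 1}.indicator (fun s => ENNReal.ofReal (s ^ 2)) s
      = ENNReal.ofReal ((R ^ 3)⁻¹ / 3) := by
  have h1 : {s : ℝ | s * R < 1} = Iio R⁻¹ := by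
    ext s; rw [mem_ofPred_eq, mem_Iio, ← lt_div_iff₀ hR, one_div]
  rw [h1, lintegral_indicator measurableSet_Iio, Measure.restrict_restrict measurableSet_Iio,
    inter_comm, Ioi_inter_Iio, setLIntegral_congr Ioo_ae_eq_Ioc, ← ofReal_integral_eq_lintegral_ofReal]
  · rw [← intervalIntegral.integral_of_le (by positivity), integral_pow]
    congr 1
    norm_num
  · exact (continuous_pow 2).integrableOn_Ioc
  · exact Eventually.of_forall fun s => by positivity

/-- The surface measure of the hemisphere about `b 2` in the gnomonic chart. -/
lemma sphereMeasure_hemisphere (b : OrthonormalBasis (Fin 3) ℝ E3) :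
    sphereMeasure.restrict {β : S2 | 0 < ⟪b 2, (β : E3)⟫}
      = ((volume : Measure (ℝ × ℝ)).withDensity
        fun u => ENNReal.ofReal (planeNorm u ^ 3)⁻¹).map (gnomonic b) := by
  have hH : MeasurableSet {β : S2 | 0 < ⟪b 2, (β : E3)⟫} :=
    (isOpen_lt continuous_const
      ((continuous_const (y := b 2)).inner continuous_subtype_val)).measurableSet
  ext A hA
  rw [Measure.restrict_apply hA, Measure.map_apply (measurable_gnomonic b) hA,
    withDensity_apply _ (measurable_gnomonic b hA), Measure.toSphere_apply' _ (hA.inter hH)]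
  -- The surface measure is three times the volume of this cone inside the unit ball, which is then
  -- sliced by height along `b 2`.
  set V : Set E3 := {p | 0 < ⟪b 2, p⟫ ∧ ‖p‖ < 1 ∧ toS2 p ∈ A} with hV
  have hVm : MeasurableSet V := by
    have e1 : IsOpen {p : E3 | 0 < ⟪b 2, p⟫} := isOpen_lt continuous_const
      ((innerSL ℝ (b 2)).continuous)
    have e2 : IsOpen {p : E3 | ‖p‖ < 1} := isOpen_lt continuous_norm continuous_const
    exact e1.measurableSet.inter (e2.measurableSet.inter (measurable_toS2 hA))
  have h1 : Ioo (0 : ℝ) 1 • ((↑) '' (A ∩ {β : S2 | 0 < ⟪b 2, (β : E3)⟫}) : Set E3)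
      = V := by
    ext p
    rw [Set.mem_smul]
    constructor
    · rintro ⟨s, hs, _, ⟨β, hβ, rfl⟩, rfl⟩
      refine ⟨?_, ?_, ?_⟩
      · rw [real_inner_smul_right]; exact mul_pos hs.1 hβ.2
      · rw [norm_smul, S2.norm_coe, mul_one, Real.norm_of_nonneg hs.1.le]; exact hs.2
      · rw [toS2_smul hs.1 (S2.coe_ne_zero β), toS2_coe]; exact hβ.1
    · rintro ⟨h1, h2, h3⟩
      have hp : p ≠ 0 := by rintro rfl; simp at h1
      have hp' := norm_pos_iff.2 hp
      refine ⟨‖p‖, ⟨hp', h2⟩, _, ⟨toS2 p, ⟨h3, ?_⟩, rfl⟩, ?_⟩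
      · rw [mem_ofPred_eq, coe_toS2 hp, real_inner_smul_right]; positivity
      · rw [coe_toS2 hp, smul_smul, mul_inv_cancel₀ hp'.ne', one_smul]
  rw [h1, ← (measurePreserving_heightPt b).measure_preimage hVm.nullMeasurableSet,
    Measure.volume_eq_prod, Measure.prod_apply ((continuous_heightPt b).measurable hVm)]
  set B : ℝ → Set (ℝ × ℝ) := fun s => {u | s * planeNorm u < 1 ∧ gnomonic b u ∈ A} with hB
  -- The slice at height s > 0 is the planar set `B s` dilated by s, whence the factor s².
  have h2 : ∀ s : ℝ, volume (Prod.mk s ⁻¹' (heightPt b ⁻¹' V))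
      = (Ioi 0).indicator (fun s => ENNReal.ofReal (s ^ 2) * volume (B s)) s := by
    intro s
    by_cases hs : 0 < s
    · rw [indicator_of_mem (mem_Ioi.2 hs)]
      have h3 : Prod.mk s ⁻¹' (heightPt b ⁻¹' V) = (fun v : ℝ × ℝ => s⁻¹ • v) ⁻¹' (B s) := by
        ext v
        have h4 : heightPt b (s, v) = s • heightPt b (1, s⁻¹ • v) := by
          rw [← heightPt_smul]
          congr 1
          ext <;> simp [hs.ne']
        simp only [mem_preimage, hV, hB, mem_ofPred_eq, inner_heightPt_two]
        rw [h4, toS2_smul hs (heightPt_one_ne_zero b _), norm_smul, norm_heightPt_one,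
          Real.norm_of_nonneg hs.le, gnomonic]
        simp [hs]
      rw [h3, Measure.addHaar_preimage_smul _ (inv_ne_zero hs.ne')]
      simp
    · rw [indicator_of_notMem (by simpa using hs)]
      have h3 : Prod.mk s ⁻¹' (heightPt b ⁻¹' V) = ∅ := by
        ext v
        simp only [mem_preimage, hV, mem_ofPred_eq, inner_heightPt_two, mem_empty_iff_false,
          iff_false]
        exact fun h => hs h.1
      rw [h3, measure_empty]
  have hC : MeasurableSet {q : ℝ × (ℝ × ℝ) | q.1 * planeNorm q.2 < 1} :=
    (isOpen_lt (continuous_fst.mul (continuous_planeNorm.comp continuous_snd))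
      continuous_const).measurableSet
  have hBm : MeasurableSet {q : ℝ × (ℝ × ℝ) | q.1 * planeNorm q.2 < 1 ∧ gnomonic b q.2 ∈ A} :=
    hC.inter (measurable_snd (measurable_gnomonic b hA))
  simp_rw [h2]
  rw [lintegral_indicator measurableSet_Ioi]
  have h5 : ∀ s : ℝ, ENNReal.ofReal (s ^ 2) * volume (B s)
      = ∫⁻ u, {q : ℝ × (ℝ × ℝ) | q.1 * planeNorm q.2 < 1 ∧ gnomonic b q.2 ∈ A}.indicator
        (fun q => ENNReal.ofReal (q.1 ^ 2)) (s, u) := by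
    intro s
    rw [← setLIntegral_const,
      ← lintegral_indicator (show MeasurableSet (B s) from measurable_prodMk_left hBm)]
    rfl
  simp_rw [h5]
  -- Integration over the height first yields `(planeNorm u ^ 3)⁻¹ / 3`, and the 3 cancels the
  -- dimension factor.
  rw [lintegral_lintegral_swap]
  · have h6 : ∀ u : ℝ × ℝ, ∫⁻ s in Ioi (0 : ℝ),
        {q : ℝ × (ℝ × ℝ) | q.1 * planeNorm q.2 < 1 ∧ gnomonic b q.2 ∈ A}.indicator
          (fun q => ENNReal.ofReal (q.1 ^ 2)) (s, u)
        = (gnomonic b ⁻¹' A).indicator (fun u => ENNReal.ofReal ((planeNorm u ^ 3)⁻¹ / 3)) u := by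
      intro u
      by_cases hu : gnomonic b u ∈ A
      · rw [indicator_of_mem (by exact hu), ← lintegral_sq_indicator (planeNorm_pos u)]
        refine lintegral_congr fun s => ?_
        simp only [indicator, mem_ofPred_eq, hu, and_true]
      · rw [indicator_of_notMem (by exact hu)]
        simp [indicator, hu]
    simp_rw [h6]
    rw [lintegral_indicator (measurable_gnomonic b hA), ← lintegral_const_mul']
    · refine lintegral_congr fun u => ?_
      have := planeNorm_pos u
      rw [finrank_euclideanSpace_fin, ENNReal.ofReal_div_of_pos (by norm_num)]
      simp only [Nat.cast_ofNat, ENNReal.ofReal_ofNat]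
      exact ENNReal.mul_div_cancel (by norm_num) (by norm_num)
    · simp
  · exact ((measurable_fst.pow_const 2).ennreal_ofReal.indicator hBm).aemeasurable

variable {F : Type*} [NormedAddCommGroup F] [NormedSpace ℝ F]

lemma integral_hemisphere (b : OrthonormalBasis (Fin 3) ℝ E3) {f : S2 → F}
    (hf : AEStronglyMeasurable f (sphereMeasure.restrict {β : S2 | 0 < ⟪b 2, (β : E3)⟫})) :
    ∫ β in {β : S2 | 0 < ⟪b 2, (β : E3)⟫}, f β ∂sphereMeasure
      = ∫ u : ℝ × ℝ, (planeNorm u ^ 3)⁻¹ • f (gnomonic b u) := by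
  rw [sphereMeasure_hemisphere] at hf ⊢
  rw [integral_map (measurable_gnomonic b).aemeasurable hf,
    integral_withDensity_eq_integral_toReal_smul]
  · refine integral_congr_ae (Eventually.of_forall fun u => ?_)
    have := planeNorm_pos u
    simp only
    rw [ENNReal.toReal_ofReal (by positivity)]
  · exact ((continuous_planeNorm.pow 3).measurable.inv).ennreal_ofReal
  · exact Eventually.of_forall fun u => ENNReal.ofReal_lt_top

lemma integrableOn_hemisphere_iff (b : OrthonormalBasis (Fin 3) ℝ E3) {f : S2 → F}
    (hf : AEStronglyMeasurable f (sphereMeasure.restrict {β : S2 | 0 < ⟪b 2, (β : E3)⟫})) :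
    IntegrableOn f {β : S2 | 0 < ⟪b 2, (β : E3)⟫} sphereMeasure
      ↔ Integrable fun u : ℝ × ℝ => (planeNorm u ^ 3)⁻¹ • f (gnomonic b u) := by
  rw [IntegrableOn]
  rw [sphereMeasure_hemisphere] at hf ⊢
  rw [integrable_map_measure hf (measurable_gnomonic b).aemeasurable,
    integrable_withDensity_iff_integrable_smul']
  · refine integrable_congr (Eventually.of_forall fun u => ?_)
    have := planeNorm_pos u
    simp only [Function.comp_apply]
    rw [ENNReal.toReal_ofReal (by positivity)]
  · exact ((continuous_planeNorm.pow 3).measurable.inv).ennreal_ofReal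
  · exact Eventually.of_forall fun u => ENNReal.ofReal_lt_top

end Chart

/-! ### Two integrals of rational type -/

section ExplicitIntegrals

lemma hasDerivAt_quadratic (X Y Z v : ℝ) :
    HasDerivAt (fun v : ℝ => X + Y * v + Z * v ^ 2) (Y + Z * (2 * v)) v := by
  have h := (((hasDerivAt_id v).const_mul Y).const_add X).add
    (((hasDerivAt_id v).pow 2).const_mul Z)
  refine h.congr_deriv ?_
  simp

lemma tendsto_div_sqrt_quadratic (p q X Y : ℝ) {Z : ℝ} (hZ : 0 < Z) :
    Tendsto (fun v : ℝ => (p * v + q) / √(X + 2 * Y * v + Z * v ^ 2)) atTop (𝓝 (p / √Z)) := by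
  have hi : Tendsto (fun v : ℝ => v⁻¹) atTop (𝓝 0) := tendsto_inv_atTop_zero
  have h1 : Tendsto (fun v : ℝ => (p + q * v⁻¹) / √(X * v⁻¹ ^ 2 + 2 * Y * v⁻¹ + Z)) atTop
      (𝓝 ((p + q * 0) / √(X * 0 ^ 2 + 2 * Y * 0 + Z))) := by
    refine (tendsto_const_nhds.add (hi.const_mul q)).div
      (((((hi.pow 2).const_mul X).add (hi.const_mul (2 * Y))).add_const Z).sqrt) ?_
    simpa using (Real.sqrt_pos.2 hZ).ne'
  simp only [mul_zero, add_zero, ne_eq, OfNat.ofNat_ne_zero, not_false_eq_true, zero_pow,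
    zero_add] at h1
  refine h1.congr' ?_
  filter_upwards [eventually_gt_atTop 0] with v hv
  have h2 : X + 2 * Y * v + Z * v ^ 2 = v ^ 2 * (X * v⁻¹ ^ 2 + 2 * Y * v⁻¹ + Z) := by
    field_simp
  rw [h2, Real.sqrt_mul (by positivity), Real.sqrt_sq hv.le,
    show p * v + q = v * (p + q * v⁻¹) by field_simp, mul_div_mul_left _ _ hv.ne']

/-- A primitive is (pv + q)/√W, where W is the quadratic and p, q solve pX − qY = m, pY − qZ = l.
Its limits at ±∞ are ±p/√Z. -/
lemma integral_linear_div_sqrt_quadratic_cube {m l X Y Z : ℝ} (hZ : 0 < Z)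
    (hΔ : 0 < X * Z - Y ^ 2)
    (hint : Integrable fun v : ℝ => (m + l * v) / √(X + 2 * Y * v + Z * v ^ 2) ^ 3) :
    ∫ v : ℝ, (m + l * v) / √(X + 2 * Y * v + Z * v ^ 2) ^ 3
      = 2 / √Z * ((m * Z - l * Y) / (X * Z - Y ^ 2)) := by
  set p := (m * Z - l * Y) / (X * Z - Y ^ 2) with hp
  set q := (m * Y - l * X) / (X * Z - Y ^ 2) with hq
  have hW : ∀ v : ℝ, 0 < X + 2 * Y * v + Z * v ^ 2 := fun v => by
    have h1 : Z * (X + 2 * Y * v + Z * v ^ 2) = (X * Z - Y ^ 2) + (Z * v + Y) ^ 2 := by ring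
    have h2 : 0 < Z * (X + 2 * Y * v + Z * v ^ 2) := by rw [h1]; positivity
    exact pos_of_mul_pos_right h2 hZ.le
  have hd : ∀ v : ℝ, HasDerivAt (fun v : ℝ => (p * v + q) / √(X + 2 * Y * v + Z * v ^ 2))
      ((m + l * v) / √(X + 2 * Y * v + Z * v ^ 2) ^ 3) v := by
    intro v
    have h1 : HasDerivAt (fun v : ℝ => X + 2 * Y * v + Z * v ^ 2) (2 * Y + Z * (2 * v)) v :=
      hasDerivAt_quadratic X (2 * Y) Z v
    have h2 : HasDerivAt (fun v : ℝ => p * v + q) p v := by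
      simpa using ((hasDerivAt_id v).const_mul p).add_const q
    have hs := Real.sqrt_pos.2 (hW v)
    refine (h2.div (h1.sqrt (hW v).ne') hs.ne').congr_deriv ?_
    have h3 : √(X + 2 * Y * v + Z * v ^ 2) ^ 2 = X + 2 * Y * v + Z * v ^ 2 :=
      Real.sq_sqrt (hW v).le
    have h4 : p * X - q * Y = m := by
      rw [hp, hq, div_mul_eq_mul_div, div_mul_eq_mul_div, ← sub_div, div_eq_iff hΔ.ne']; ring
    have h5 : p * Y - q * Z = l := by
      rw [hp, hq, div_mul_eq_mul_div, div_mul_eq_mul_div, ← sub_div, div_eq_iff hΔ.ne']; ring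
    rw [← h4, ← h5]
    set S := √(X + 2 * Y * v + Z * v ^ 2) with hS
    rw [div_eq_div_iff (by positivity) (by positivity)]
    field_simp
    rw [h3]
    ring
  have h1 := tendsto_div_sqrt_quadratic p q X Y hZ
  have h2 : Tendsto (fun v : ℝ => (p * v + q) / √(X + 2 * Y * v + Z * v ^ 2)) atBot
      (𝓝 (-p / √Z)) := by
    have h3 := (tendsto_div_sqrt_quadratic (-p) q X (-Y) hZ).comp tendsto_neg_atBot_atTop
    refine h3.congr fun v => ?_
    simp only [Function.comp_apply]
    congr 1
    · ring
    · congr 1; ring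
  rw [integral_of_hasDerivAt_of_tendsto hd hint h2 h1]
  ring

/-- A primitive is a logarithm of the quadratic plus an arctangent of (eu + dε)/(Sε). As ε ↓ 0 the
logarithms at u = ±1 both tend to log e and cancel, while the arctangents tend to ±π/2. -/
lemma tendsto_integral_dipole {k d e : ℝ} (he : 0 < e) (hD : 0 < k * e - d ^ 2) :
    Tendsto (fun ε : ℝ => ∫ u in (-1 : ℝ)..1,
      (ε * k + d * u) / (k * ε ^ 2 + 2 * d * ε * u + e * u ^ 2)) (𝓝[>] 0)
      (𝓝 (Real.pi * √(k * e - d ^ 2) / e)) := by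
  set D := k * e - d ^ 2 with hDd
  set S := √D with hS
  have hSp : 0 < S := Real.sqrt_pos.2 hD
  have hS2 : S ^ 2 = D := Real.sq_sqrt hD.le
  set q : ℝ → ℝ → ℝ := fun ε u => k * ε ^ 2 + 2 * d * ε * u + e * u ^ 2 with hq
  have hqe : ∀ ε u, e * q ε u = D * ε ^ 2 + (e * u + d * ε) ^ 2 := fun ε u => by
    simp only [hq, hDd]; ring
  have hqp : ∀ ε u, 0 < ε → 0 < q ε u := fun ε u hε => by
    have h2 : 0 < e * q ε u := by rw [hqe]; positivity
    exact pos_of_mul_pos_right h2 he.le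
  have hval : ∀ ε : ℝ, 0 < ε → ∫ u in (-1 : ℝ)..1,
      (ε * k + d * u) / (k * ε ^ 2 + 2 * d * ε * u + e * u ^ 2)
      = (d / (2 * e) * Real.log (q ε 1) + S / e * Real.arctan ((e * 1 + d * ε) / (S * ε)))
        - (d / (2 * e) * Real.log (q ε (-1))
          + S / e * Real.arctan ((e * (-1) + d * ε) / (S * ε))) := by
    intro ε hε
    refine intervalIntegral.integral_eq_sub_of_hasDerivAt (f := fun u => d / (2 * e)
      * Real.log (q ε u) + S / e * Real.arctan ((e * u + d * ε) / (S * ε))) (fun u _ => ?_) ?_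
    · have h1 : HasDerivAt (fun u : ℝ => q ε u) (2 * d * ε + e * (2 * u)) u :=
        hasDerivAt_quadratic (k * ε ^ 2) (2 * d * ε) e u
      have h2 : HasDerivAt (fun u : ℝ => (e * u + d * ε) / (S * ε)) (e / (S * ε)) u := by
        simpa using (((hasDerivAt_id u).const_mul e).add_const (d * ε)).div_const (S * ε)
      refine (((h1.log (hqp ε u hε).ne').const_mul (d / (2 * e))).add
        (h2.arctan.const_mul (S / e))).congr_deriv ?_
      have h3 : 1 + ((e * u + d * ε) / (S * ε)) ^ 2 = e * q ε u / (D * ε ^ 2) := by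
        rw [hqe, ← hS2]; field_simp
      have h4 := hqp ε u hε
      change _ = (ε * k + d * u) / q ε u
      rw [h3]
      have hk : k = (S ^ 2 + d ^ 2) / e := by rw [hS2, hDd]; field_simp; ring
      generalize q ε u = Q at h4
      rw [← hS2, hk]
      field_simp
      ring
    · refine ContinuousOn.intervalIntegrable (Continuous.continuousOn ?_)
      exact Continuous.div (by fun_prop) (by fun_prop) fun u => (hqp ε u hε).ne'
  have hlog : ∀ s : ℝ, s ^ 2 = 1 → Tendsto (fun ε : ℝ => Real.log (q ε s)) (𝓝[>] 0)
      (𝓝 (Real.log e)) := fun s hs => by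
    have h1 : ContinuousAt (fun ε : ℝ => Real.log (q ε s)) 0 := by
      refine ContinuousAt.log (by simp only [hq]; fun_prop) ?_
      simp [hq, hs, he.ne']
    have h2 := h1.tendsto.mono_left (nhdsWithin_le_nhds (s := Ioi (0 : ℝ)))
    simpa [hq, hs] using h2
  have hinv : Tendsto (fun ε : ℝ => ε⁻¹) (𝓝[>] 0) atTop := tendsto_inv_nhdsGT_zero
  have ha : Tendsto (fun ε : ℝ => Real.arctan ((e * 1 + d * ε) / (S * ε))) (𝓝[>] 0)
      (𝓝 (Real.pi / 2)) := by
    refine (tendsto_nhds_of_tendsto_nhdsWithin Real.tendsto_arctan_atTop).comp ?_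
    have h1 := tendsto_atTop_add_const_right _ (d / S) (hinv.const_mul_atTop (div_pos he hSp))
    refine h1.congr' ?_
    filter_upwards [self_mem_nhdsWithin] with ε hε
    have := ne_of_gt (mem_Ioi.1 hε)
    field_simp
  have hb : Tendsto (fun ε : ℝ => Real.arctan ((e * (-1) + d * ε) / (S * ε))) (𝓝[>] 0)
      (𝓝 (-(Real.pi / 2))) := by
    refine (tendsto_nhds_of_tendsto_nhdsWithin Real.tendsto_arctan_atBot).comp ?_
    have h1 := tendsto_atBot_add_const_right _ (d / S)
      (tendsto_neg_atTop_atBot.comp (hinv.const_mul_atTop (div_pos he hSp)))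
    refine h1.congr' ?_
    filter_upwards [self_mem_nhdsWithin] with ε hε
    have := ne_of_gt (mem_Ioi.1 hε)
    simp only [Function.comp_apply]
    field_simp
  have h := (((hlog 1 (by norm_num)).const_mul (d / (2 * e))).add (ha.const_mul (S / e))).sub
    (((hlog (-1) (by norm_num)).const_mul (d / (2 * e))).add (hb.const_mul (S / e)))
  have h0 : d / (2 * e) * Real.log e + S / e * (Real.pi / 2)
      - (d / (2 * e) * Real.log e + S / e * -(Real.pi / 2)) = Real.pi * S / e := by ring
  rw [h0] at h
  refine h.congr' ?_
  filter_upwards [self_mem_nhdsWithin] with ε hε using (hval ε hε).symm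

end ExplicitIntegrals

/-! ### The flux of the leading part through a strip of the tangent plane -/

section Flux

/-- The quadratic form in the denominator of `leadForm`, polarized. -/
noncomputable def coneForm (κ : ℝ) (V Q Q' : E3) : ℝ :=
  κ ^ 2 * ⟪V, Q⟫ * ⟪V, Q'⟫ + (1 - κ ^ 2 * ‖V‖ ^ 2) * ⟪Q, Q'⟫

lemma leadForm_eq_coneForm (κ : ℝ) (N V Q : E3) :
    leadForm κ N V Q = coneForm κ V N Q / √(coneForm κ V Q Q) ^ 3 := by
  have h1 : κ ^ 2 * ⟪V, Q⟫ ^ 2 + (1 - κ ^ 2 * ‖V‖ ^ 2) * ‖Q‖ ^ 2 = coneForm κ V Q Q := by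
    rw [coneForm, real_inner_self_eq_norm_sq]; ring
  rw [leadForm, h1]
  congr 1
  rw [coneForm, real_inner_comm V N]
  ring

/-- Pythagoras for the components of V along f × g and in the plane of f and g, with the Gram
determinant cleared from the denominators. -/
lemma norm_sq_cross_mul (f g V : E3) : ‖cross f g‖ ^ 2 * ‖V‖ ^ 2 = ⟪cross f g, V⟫ ^ 2
    + (⟪g, g⟫ * ⟪V, f⟫ ^ 2 - 2 * ⟪f, g⟫ * ⟪V, f⟫ * ⟪V, g⟫ + ⟪f, f⟫ * ⟪V, g⟫ ^ 2) := by
  simp only [← real_inner_self_eq_norm_sq, E3.inner_eq, cross_apply_zero, cross_apply_one,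
    cross_apply_two]
  ring

lemma coneForm_self_pos {κ : ℝ} {V Q : E3} (hV : 0 < 1 - κ ^ 2 * ‖V‖ ^ 2) (hQ : Q ≠ 0) :
    0 < coneForm κ V Q Q := by
  have h1 := norm_pos_iff.2 hQ
  rw [coneForm, real_inner_self_eq_norm_sq]
  have : 0 ≤ κ ^ 2 * ⟪V, Q⟫ * ⟪V, Q⟫ := by
    rw [mul_assoc]; exact mul_nonneg (sq_nonneg _) (mul_self_nonneg _)
  positivity

variable {κ s : ℝ} {N V f g : E3}

/-- With P = 1 − κ²‖V‖², the form P·1 + κ²VVᵀ restricted to the tangent plane has determinant P(P +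
κ²|V_tan|²) = P(1 − κ²V_N²), where V_tan is the tangential part of V; s² is the Gram determinant of
f and g. -/
lemma coneForm_tangent_det (hN : ‖N‖ = 1) (ha : cross f g = s • N) :
    coneForm κ V f f * coneForm κ V g g - coneForm κ V f g ^ 2
      = s ^ 2 * (1 - κ ^ 2 * ‖V‖ ^ 2) * (1 - κ ^ 2 * ⟪N, V⟫ ^ 2) := by
  have h1 := norm_sq_cross_mul f g V
  have h2 := norm_sq_cross f g
  have h3 : ‖cross f g‖ ^ 2 = s ^ 2 := by rw [ha, norm_smul, hN, mul_one, Real.norm_eq_abs, sq_abs]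
  rw [h3] at h1 h2
  rw [ha, real_inner_smul_left] at h1
  simp only [coneForm, real_inner_self_eq_norm_sq] at h1 h2 ⊢
  linear_combination (-(1 - κ ^ 2 * ‖V‖ ^ 2) ^ 2) * h2 - (1 - κ ^ 2 * ‖V‖ ^ 2) * κ ^ 2 * h1

/-- Expansion about the pivot at g: the left side is that pivot times the Gram determinant of N, f,
g for the cone form. The latter is s² det(P·1 + κ²VVᵀ) = s²P²(P + κ²‖V‖²) = s²P², with P = 1 −
κ²‖V‖². -/
lemma coneForm_det (hN : ‖N‖ = 1) (ha : cross f g = s • N) (hf : ⟪N, f⟫ = 0) (hg : ⟪N, g⟫ = 0) :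
    (coneForm κ V N N * coneForm κ V g g - coneForm κ V N g ^ 2)
        * (coneForm κ V f f * coneForm κ V g g - coneForm κ V f g ^ 2)
      - (coneForm κ V N g * coneForm κ V f g - coneForm κ V N f * coneForm κ V g g) ^ 2
      = coneForm κ V g g * ((1 - κ ^ 2 * ‖V‖ ^ 2) ^ 2 * s ^ 2) := by
  have h1 := norm_sq_cross_mul f g V
  have h2 := norm_sq_cross f g
  have h3 : ‖cross f g‖ ^ 2 = s ^ 2 := by rw [ha, norm_smul, hN, mul_one, Real.norm_eq_abs, sq_abs]
  rw [h3] at h1 h2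
  rw [ha, real_inner_smul_left] at h1
  simp only [coneForm, real_inner_self_eq_norm_sq, hf, hg, hN, real_inner_comm N V] at h1 h2 ⊢
  linear_combination
    (-(κ ^ 2 * ⟪V, g⟫ * ⟪V, g⟫ + (1 - κ ^ 2 * ‖V‖ ^ 2) * ‖g‖ ^ 2)
      * ((1 - κ ^ 2 * ‖V‖ ^ 2) ^ 3 + (1 - κ ^ 2 * ‖V‖ ^ 2) ^ 2 * κ ^ 2 * ⟪N, V⟫ ^ 2)) * h2
    - (κ ^ 2 * ⟪V, g⟫ * ⟪V, g⟫ + (1 - κ ^ 2 * ‖V‖ ^ 2) * ‖g‖ ^ 2)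
      * ((1 - κ ^ 2 * ‖V‖ ^ 2) ^ 2 * κ ^ 2) * h1

/-- The strip `|u₁| < 1` in the tangent plane. -/
abbrev planeStrip : Set (ℝ × ℝ) := Ioo (-1) 1 ×ˢ univ

/-- The position relative to the point `u₁ f + u₂ g` of a tangent plane of the observation point at
height `ε`. -/
noncomputable def planeVec (N f g : E3) (ε : ℝ) (u : ℝ × ℝ) : E3 := ε • N - (u.1 • f + u.2 • g)

lemma one_sub_sq_mul_inner_pos (hV : 0 < 1 - κ ^ 2 * ‖V‖ ^ 2) (hN : ‖N‖ = 1) :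
    0 < 1 - κ ^ 2 * ⟪N, V⟫ ^ 2 := by
  have h1 := abs_real_inner_le_norm N V
  rw [hN, one_mul] at h1
  have h2 := sq_le_sq' (abs_le.1 h1).1 (abs_le.1 h1).2
  nlinarith [mul_le_mul_of_nonneg_left h2 (sq_nonneg κ)]

/-- Along each line of fixed u₁ the integrand is linear over the 3/2 power of a quadratic in u₂, so
the integral over u₂ is explicit and leaves a rational function of u₁. -/
lemma setIntegral_strip_leadForm (hV : 0 < 1 - κ ^ 2 * ‖V‖ ^ 2) (hN : ‖N‖ = 1) (hs : s ≠ 0)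
    (ha : cross f g = s • N) (hf : ⟪N, f⟫ = 0) (hg : ⟪N, g⟫ = 0) {ε : ℝ} (hε : 0 < ε)
    (hint : IntegrableOn (fun u => leadForm κ N V (planeVec N f g ε u)) planeStrip) :
    ∫ u in planeStrip, leadForm κ N V (planeVec N f g ε u)
      = 2 / √(coneForm κ V g g) * ∫ u in (-1 : ℝ)..1,
        (ε * (coneForm κ V N N * coneForm κ V g g - coneForm κ V N g ^ 2)
            + (coneForm κ V N g * coneForm κ V f g - coneForm κ V N f * coneForm κ V g g) * u)
          / ((coneForm κ V N N * coneForm κ V g g - coneForm κ V N g ^ 2) * ε ^ 2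
            + 2 * (coneForm κ V N g * coneForm κ V f g - coneForm κ V N f * coneForm κ V g g) * ε * u
            + (coneForm κ V f f * coneForm κ V g g - coneForm κ V f g ^ 2) * u ^ 2) := by
  have hg0 : g ≠ 0 := by
    rintro rfl
    have h1 := norm_sq_cross f 0
    rw [ha, norm_smul, hN] at h1
    simp [hs] at h1
  have hZ := coneForm_self_pos hV hg0
  have he := coneForm_tangent_det (κ := κ) (V := V) hN ha
  have hD := coneForm_det (κ := κ) (V := V) hN ha hf hg
  have he' : 0 < coneForm κ V f f * coneForm κ V g g - coneForm κ V f g ^ 2 := by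
    rw [he]
    have := one_sub_sq_mul_inner_pos hV hN
    positivity
  have hD' : 0 < coneForm κ V g g * ((1 - κ ^ 2 * ‖V‖ ^ 2) ^ 2 * s ^ 2) := by positivity
  rw [← hD] at hD'
  have hform : ∀ u : ℝ × ℝ, leadForm κ N V (planeVec N f g ε u)
      = ((ε * coneForm κ V N N - u.1 * coneForm κ V N f) + -coneForm κ V N g * u.2)
        / √((ε ^ 2 * coneForm κ V N N - 2 * ε * u.1 * coneForm κ V N f
          + u.1 ^ 2 * coneForm κ V f f)
          + 2 * (-(ε * coneForm κ V N g) + u.1 * coneForm κ V f g) * u.2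
          + coneForm κ V g g * u.2 ^ 2) ^ 3 := by
    intro u
    rw [leadForm_eq_coneForm]
    congr 1
    · simp only [planeVec, coneForm, inner_sub_right, inner_add_right, real_inner_smul_right]
      ring
    · congr 2
      simp only [planeVec, coneForm, inner_sub_right, inner_add_right, real_inner_smul_right,
        inner_sub_left, inner_add_left, real_inner_smul_left, real_inner_comm N f,
        real_inner_comm N g, real_inner_comm f g]
      ring
  have hint' := hint
  rw [IntegrableOn, Measure.volume_eq_prod, ← Measure.prod_restrict] at hint'
  rw [Measure.volume_eq_prod] at hint ⊢
  rw [setIntegral_prod _ hint, intervalIntegral.integral_of_le (by norm_num),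
    integral_Ioc_eq_integral_Ioo, ← integral_const_mul]
  refine integral_congr_ae ?_
  -- Fubini provides the integrability in u₂ for almost every u₁, which the explicit one-dimensional
  -- integral assumes.
  filter_upwards [hint'.prod_right_ae] with u hu
  simp only [Measure.restrict_univ, hform] at hu ⊢
  have hkey : (ε ^ 2 * coneForm κ V N N - 2 * ε * u * coneForm κ V N f
      + u ^ 2 * coneForm κ V f f) * coneForm κ V g g
        - (-(ε * coneForm κ V N g) + u * coneForm κ V f g) ^ 2
      = (coneForm κ V N N * coneForm κ V g g - coneForm κ V N g ^ 2) * ε ^ 2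
            + 2 * (coneForm κ V N g * coneForm κ V f g - coneForm κ V N f * coneForm κ V g g) * ε * u
            + (coneForm κ V f f * coneForm κ V g g - coneForm κ V f g ^ 2) * u ^ 2 := by ring
  rw [integral_linear_div_sqrt_quadratic_cube hZ _ hu, hkey]
  · congr 2
    ring
  · rw [hkey]
    generalize coneForm κ V N N * coneForm κ V g g - coneForm κ V N g ^ 2 = k at *
    generalize coneForm κ V N g * coneForm κ V f g - coneForm κ V N f * coneForm κ V g g = d at *
    generalize coneForm κ V f f * coneForm κ V g g - coneForm κ V f g ^ 2 = e at *
    have h1 : e * (k * ε ^ 2 + 2 * d * ε * u + e * u ^ 2)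
      = (k * e - d ^ 2) * ε ^ 2 + (e * u + d * ε) ^ 2 := by ring
    have h2 : 0 < e * (k * ε ^ 2 + 2 * d * ε * u + e * u ^ 2) := by rw [h1]; positivity
    exact pos_of_mul_pos_right h2 he'.le

/-- By the two determinant identities the factors 1 − κ²‖V‖² and the value of the cone form at g
cancel. The tangential velocity drops out of the limit and only V_N remains. -/
lemma tendsto_setIntegral_strip_leadForm (hV : 0 < 1 - κ ^ 2 * ‖V‖ ^ 2) (hN : ‖N‖ = 1)
    (hs : s ≠ 0) (ha : cross f g = s • N) (hf : ⟪N, f⟫ = 0) (hg : ⟪N, g⟫ = 0)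
    (hint : ∀ ε > 0, IntegrableOn (fun u => leadForm κ N V (planeVec N f g ε u)) planeStrip) :
    Tendsto (fun ε => ∫ u in planeStrip, leadForm κ N V (planeVec N f g ε u)) (𝓝[>] 0)
      (𝓝 (2 * Real.pi / (|s| * (1 - κ ^ 2 * ⟪N, V⟫ ^ 2)))) := by
  have hg0 : g ≠ 0 := by
    rintro rfl
    have h1 := norm_sq_cross f 0
    rw [ha, norm_smul, hN] at h1
    simp [hs] at h1
  have hZ := coneForm_self_pos hV hg0
  have hp := one_sub_sq_mul_inner_pos hV hN
  have he := coneForm_tangent_det (κ := κ) (V := V) hN ha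
  have hD := coneForm_det (κ := κ) (V := V) hN ha hf hg
  have h1 := (tendsto_integral_dipole
    (k := coneForm κ V N N * coneForm κ V g g - coneForm κ V N g ^ 2)
    (d := coneForm κ V N g * coneForm κ V f g - coneForm κ V N f * coneForm κ V g g)
    (e := coneForm κ V f f * coneForm κ V g g - coneForm κ V f g ^ 2)
    (by rw [he]; positivity) (by rw [hD]; positivity)).const_mul (2 / √(coneForm κ V g g))
  have h2 : 2 / √(coneForm κ V g g) * (Real.pi * √((coneForm κ V N N * coneForm κ V g g
      - coneForm κ V N g ^ 2) * (coneForm κ V f f * coneForm κ V g g - coneForm κ V f g ^ 2)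
      - (coneForm κ V N g * coneForm κ V f g - coneForm κ V N f * coneForm κ V g g) ^ 2)
      / (coneForm κ V f f * coneForm κ V g g - coneForm κ V f g ^ 2))
      = 2 * Real.pi / (|s| * (1 - κ ^ 2 * ⟪N, V⟫ ^ 2)) := by
    rw [hD, he, Real.sqrt_mul hZ.le, Real.sqrt_mul (by positivity), Real.sqrt_sq hV.le,
      Real.sqrt_sq_eq_abs, ← sq_abs s]
    have h3 := Real.sqrt_pos.2 hZ
    have h4 := abs_pos.2 hs
    field_simp
  rw [h2] at h1
  refine h1.congr' ?_
  filter_upwards [self_mem_nhdsWithin] with ε hε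
  exact (setIntegral_strip_leadForm hV hN hs ha hf hg hε (hint ε hε)).symm

end Flux

/-! ### The leading part in the gnomonic chart -/

section BandIntegrals

variable {b : OrthonormalBasis (Fin 3) ℝ E3}

/-- The part of the sphere that projects from its centre onto the strip `|u₁| < 1` of the plane
tangent at `b 2`. -/
def band (b : OrthonormalBasis (Fin 3) ℝ E3) : Set S2 :=
  {β | 0 < ⟪b 2, (β : E3)⟫ ∧ |⟪b 0, (β : E3)⟫| < ⟪b 2, (β : E3)⟫}

lemma isOpen_band (b : OrthonormalBasis (Fin 3) ℝ E3) : IsOpen (band b) := by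
  have h : ∀ i, Continuous fun β : S2 => ⟪b i, (β : E3)⟫ := fun i =>
    (innerSL ℝ (b i)).continuous.comp continuous_subtype_val
  exact (isOpen_lt continuous_const (h 2)).inter (isOpen_lt (h 0).abs (h 2))

lemma inner_two_gnomonic (b : OrthonormalBasis (Fin 3) ℝ E3) (u : ℝ × ℝ) :
    ⟪b 2, (gnomonic b u : E3)⟫ = (planeNorm u)⁻¹ := by
  rw [coe_gnomonic, real_inner_smul_right, inner_heightPt_two, mul_one]

lemma gnomonic_mem_band {u : ℝ × ℝ} : gnomonic b u ∈ band b ↔ u ∈ planeStrip := by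
  have h := inv_pos.2 (planeNorm_pos u)
  rw [band, mem_ofPred_eq, inner_two_gnomonic, coe_gnomonic, real_inner_smul_right,
    inner_heightPt_zero, abs_mul, abs_of_pos h, mul_lt_iff_lt_one_right h, abs_lt]
  simp [h]

lemma integral_band {f : S2 → ℝ} (hf : Measurable f) :
    ∫ β in band b, f β ∂sphereMeasure
      = ∫ u in planeStrip, (planeNorm u ^ 3)⁻¹ * f (gnomonic b u) := by
  have h1 : {β : S2 | 0 < ⟪b 2, (β : E3)⟫} ∩ band b = band b :=
    inter_eq_right.2 fun β hβ => hβ.1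
  have hm := (isOpen_band b).measurableSet
  rw [← h1, ← setIntegral_indicator hm, integral_hemisphere b
    (hf.indicator hm).aestronglyMeasurable,
    ← integral_indicator (measurableSet_Ioo.prod MeasurableSet.univ)]
  refine integral_congr_ae (Eventually.of_forall fun u => ?_)
  by_cases hu : u ∈ planeStrip
  · simp only [smul_eq_mul]
    rw [indicator_of_mem hu, indicator_of_mem (gnomonic_mem_band.2 hu)]
  · simp only [smul_eq_mul]
    rw [indicator_of_notMem hu, indicator_of_notMem (mt gnomonic_mem_band.1 hu), mul_zero]

lemma integrableOn_band_iff {f : S2 → ℝ} (hf : Measurable f) :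
    IntegrableOn f (band b) sphereMeasure
      ↔ IntegrableOn (fun u => (planeNorm u ^ 3)⁻¹ * f (gnomonic b u)) planeStrip := by
  have h1 : band b ∩ {β : S2 | 0 < ⟪b 2, (β : E3)⟫} = band b :=
    inter_eq_left.2 fun β hβ => hβ.1
  have hm := (isOpen_band b).measurableSet
  rw [← h1, ← integrableOn_indicator_iff hm, integrableOn_hemisphere_iff b
    (hf.indicator hm).aestronglyMeasurable,
    ← integrable_indicator_iff (measurableSet_Ioo.prod MeasurableSet.univ)]
  refine integrable_congr (Eventually.of_forall fun u => ?_)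
  by_cases hu : u ∈ planeStrip
  · simp only [smul_eq_mul]
    rw [indicator_of_mem hu, indicator_of_mem (gnomonic_mem_band.2 hu)]
  · simp only [smul_eq_mul]
    rw [indicator_of_notMem hu, indicator_of_notMem (mt gnomonic_mem_band.1 hu), mul_zero]

lemma integrableOn_strip_inv_one_add_sq :
    IntegrableOn (fun u : ℝ × ℝ => (1 + u.2 ^ 2)⁻¹) planeStrip := by
  rw [IntegrableOn, Measure.volume_eq_prod, ← Measure.prod_restrict, Measure.restrict_univ]
  have h1 : Integrable (fun _ : ℝ => (1 : ℝ)) (volume.restrict (Ioo (-1) 1)) :=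
    integrable_const _
  simpa using h1.mul_prod integrable_inv_one_add_sq

lemma one_add_sq_le_planeNorm_sq (u : ℝ × ℝ) : 1 + u.2 ^ 2 ≤ planeNorm u ^ 2 := by
  rw [planeNorm, Real.sq_sqrt (by positivity)]; nlinarith [sq_nonneg u.1]

/-- The band reaches the equator, where the integrand is unbounded. In the chart it becomes
`(planeNorm u ^ 2)⁻¹`, at most 1/(1 + u₂²), which is integrable on the strip. -/
lemma integrableOn_band_inv_inner :
    IntegrableOn (fun β : S2 => ⟪b 2, (β : E3)⟫⁻¹) (band b) sphereMeasure := by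
  have hm : Measurable fun β : S2 => ⟪b 2, (β : E3)⟫⁻¹ :=
    ((innerSL ℝ (b 2)).continuous.comp continuous_subtype_val).measurable.inv
  rw [integrableOn_band_iff hm]
  refine integrableOn_strip_inv_one_add_sq.mono'
    (((continuous_planeNorm.pow 3).measurable.inv.mul
      (hm.comp (measurable_gnomonic b))).aestronglyMeasurable)
    (Eventually.of_forall fun u => ?_)
  have h := planeNorm_pos u
  rw [inner_two_gnomonic, inv_inv, Real.norm_of_nonneg (by positivity),
    show (planeNorm u ^ 3)⁻¹ * planeNorm u = (planeNorm u ^ 2)⁻¹ by field_simp]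
  exact inv_anti₀ (by positivity) (one_add_sq_le_planeNorm_sq u)

lemma dist_sq_eq (α β : S2) : ‖(β : E3) - α‖ ^ 2 = 2 - 2 * ⟪(α : E3), (β : E3)⟫ := by
  rw [norm_sub_sq_real, S2.norm_coe, S2.norm_coe, real_inner_comm]; ring

lemma norm_le_norm_gnomonic_sub (u : ℝ × ℝ) (α : S2) (hα : b 2 = (α : E3)) :
    (planeNorm u)⁻¹ * ‖u‖ ≤ ‖(gnomonic b u : E3) - α‖ := by
  have h := planeNorm_pos u
  have h1 := one_le_planeNorm u
  have h2 : planeNorm u ^ 2 = 1 + u.1 ^ 2 + u.2 ^ 2 := Real.sq_sqrt (by positivity)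
  have h3 : ‖u‖ ^ 2 ≤ u.1 ^ 2 + u.2 ^ 2 := by
    rw [Prod.norm_def]
    rcases max_cases ‖u.1‖ ‖u.2‖ with h | h <;> rw [h.1, Real.norm_eq_abs, sq_abs] <;>
      nlinarith [sq_nonneg u.1, sq_nonneg u.2]
  refine le_of_sq_le_sq ?_ (norm_nonneg _)
  rw [dist_sq_eq, ← hα, inner_two_gnomonic, mul_pow]
  -- With p = `planeNorm u` the claim reduces to p² − 1 ≤ 2p² − 2p, that is (p − 1)² ≥ 0.
  have h4 : 2 - 2 * (planeNorm u)⁻¹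
      = (planeNorm u)⁻¹ ^ 2 * (2 * planeNorm u ^ 2 - 2 * planeNorm u) := by field_simp
  rw [h4]
  gcongr
  nlinarith

/-- In the chart about α the integrand is bounded by 1/(|u|(1 + |u|²)), integrable in polar
coordinates; on the opposite hemisphere it is at most 1. -/
lemma integrable_inv_norm_sub (α : S2) :
    Integrable (fun β : S2 => ‖(β : E3) - α‖⁻¹) sphereMeasure := by
  obtain ⟨b, hb, -⟩ := exists_oriented_basis α
  have hm : Measurable fun β : S2 => ‖(β : E3) - α‖⁻¹ :=
    (continuous_subtype_val.sub continuous_const).norm.measurable.inv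
  have hH : MeasurableSet {β : S2 | 0 < ⟪b 2, (β : E3)⟫} :=
    (isOpen_lt continuous_const
      ((innerSL ℝ (b 2)).continuous.comp continuous_subtype_val)).measurableSet
  rw [← integrableOn_univ, ← union_compl_self {β : S2 | 0 < ⟪b 2, (β : E3)⟫}]
  refine IntegrableOn.union ?_ ?_
  · rw [integrableOn_hemisphere_iff b hm.aestronglyMeasurable]
    have h1 : Integrable (fun u : ℝ × ℝ => (‖u‖ * (1 + ‖u‖ ^ 2))⁻¹) := by
      rw [integrable_fun_norm_addHaar volume (f := fun y : ℝ => (y * (1 + y ^ 2))⁻¹)]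
      refine (integrable_inv_one_add_sq.integrableOn (s := Ioi (0 : ℝ))).congr_fun (fun y hy => ?_)
        measurableSet_Ioi
      have := ne_of_gt (mem_Ioi.1 hy)
      simp
      field_simp
    refine h1.mono' (((continuous_planeNorm.pow 3).measurable.inv.smul
      (hm.comp (measurable_gnomonic b))).aestronglyMeasurable) (Eventually.of_forall fun u => ?_)
    have h := planeNorm_pos u
    rw [smul_eq_mul, Real.norm_of_nonneg (by positivity)]
    -- At the centre of the chart the left side is 0, since the inverse of 0 is 0.
    by_cases hu : u = 0
    · subst hu
      have h2 : ‖(gnomonic b 0 : E3) - α‖ = 0 := by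
        rw [norm_eq_zero, sub_eq_zero, coe_gnomonic, ← hb]
        simp [planeNorm, heightPt]
      simp [h2]
    have hu' := norm_pos_iff.2 hu
    have h2 := norm_le_norm_gnomonic_sub (b := b) u α hb
    have h3 : 1 + ‖u‖ ^ 2 ≤ planeNorm u ^ 2 := by
      rw [planeNorm, Real.sq_sqrt (by positivity), Prod.norm_def]
      rcases max_cases ‖u.1‖ ‖u.2‖ with h | h <;> rw [h.1, Real.norm_eq_abs, sq_abs] <;>
        nlinarith [sq_nonneg u.1, sq_nonneg u.2]
    calc (planeNorm u ^ 3)⁻¹ * ‖(gnomonic b u : E3) - α‖⁻¹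
        ≤ (planeNorm u ^ 3)⁻¹ * ((planeNorm u)⁻¹ * ‖u‖)⁻¹ := by gcongr
      _ = (‖u‖ * planeNorm u ^ 2)⁻¹ := by field_simp
      _ ≤ (‖u‖ * (1 + ‖u‖ ^ 2))⁻¹ := by gcongr
  · refine Measure.integrableOn_of_bounded (M := 1) (measure_ne_top _ _)
      hm.aestronglyMeasurable ?_
    filter_upwards [ae_restrict_mem hH.compl] with β hβ
    have h1 : ⟪(α : E3), (β : E3)⟫ ≤ 0 := by simpa [hb] using hβ
    have h2 := dist_sq_eq α β
    have h3 : 1 ≤ ‖(β : E3) - α‖ := by nlinarith [norm_nonneg ((β : E3) - α)]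
    rw [norm_inv, norm_norm]
    exact inv_le_one_of_one_le₀ h3

end BandIntegrals

/-! ### Integrals of the leading part over a band of the sphere -/

section LeadingPart

lemma leadForm_neg (κ : ℝ) (N V Q : E3) : leadForm κ N V (-Q) = -leadForm κ N V Q := by
  simp only [leadForm, inner_neg_right, norm_neg, neg_sq]
  ring

lemma measurable_leadForm (κ : ℝ) (N V : E3) : Measurable (leadForm κ N V) := by
  have h1 : Continuous fun Q : E3 =>
      (1 - κ ^ 2 * ‖V‖ ^ 2) * ⟪N, Q⟫ + κ ^ 2 * ⟪N, V⟫ * ⟪V, Q⟫ := by fun_prop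
  have h2 : Continuous fun Q : E3 =>
      √(κ ^ 2 * ⟪V, Q⟫ ^ 2 + (1 - κ ^ 2 * ‖V‖ ^ 2) * ‖Q‖ ^ 2) ^ 3 := by fun_prop
  exact h1.measurable.div h2.measurable

lemma continuousAt_leadForm {κ : ℝ} {N V Q : E3} (hV : 0 < 1 - κ ^ 2 * ‖V‖ ^ 2) (hQ : Q ≠ 0) :
    ContinuousAt (leadForm κ N V) Q := by
  have h1 := norm_pos_iff.2 hQ
  refine ContinuousAt.div (by fun_prop) (by fun_prop) ?_
  positivity

/-- By Cauchy–Schwarz the numerator is at most (1 − κ²‖V‖² + κ²‖V‖²)‖Q‖ = ‖Q‖, and the root is at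
least √(1 − κ²‖V‖²)‖Q‖. -/
lemma abs_leadForm_le {κ : ℝ} {N V Q : E3} (hV : 0 < 1 - κ ^ 2 * ‖V‖ ^ 2) (hN : ‖N‖ = 1) :
    |leadForm κ N V Q| ≤ (√(1 - κ ^ 2 * ‖V‖ ^ 2) ^ 3)⁻¹ * (‖Q‖ ^ 2)⁻¹ := by
  by_cases hQ : Q = 0
  · simp [hQ, leadForm]
  have h0 := norm_pos_iff.2 hQ
  have hb := Real.sqrt_pos.2 hV
  have h1 : |(1 - κ ^ 2 * ‖V‖ ^ 2) * ⟪N, Q⟫ + κ ^ 2 * ⟪N, V⟫ * ⟪V, Q⟫| ≤ ‖Q‖ := by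
    have e1 := abs_real_inner_le_norm N Q
    have e2 := abs_real_inner_le_norm N V
    have e3 := abs_real_inner_le_norm V Q
    rw [hN, one_mul] at e1 e2
    calc _ ≤ |(1 - κ ^ 2 * ‖V‖ ^ 2) * ⟪N, Q⟫| + |κ ^ 2 * ⟪N, V⟫ * ⟪V, Q⟫| := abs_add_le _ _
      _ = (1 - κ ^ 2 * ‖V‖ ^ 2) * |⟪N, Q⟫| + κ ^ 2 * |⟪N, V⟫| * |⟪V, Q⟫| := by
        rw [abs_mul, abs_mul, abs_mul, abs_of_pos hV, abs_of_nonneg (sq_nonneg κ)]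
      _ ≤ (1 - κ ^ 2 * ‖V‖ ^ 2) * ‖Q‖ + κ ^ 2 * ‖V‖ * (‖V‖ * ‖Q‖) := by gcongr
      _ = ‖Q‖ := by ring
  have h2 : √(1 - κ ^ 2 * ‖V‖ ^ 2) * ‖Q‖
      ≤ √(κ ^ 2 * ⟪V, Q⟫ ^ 2 + (1 - κ ^ 2 * ‖V‖ ^ 2) * ‖Q‖ ^ 2) := by
    refine Real.le_sqrt_of_sq_le ?_
    rw [mul_pow, Real.sq_sqrt hV.le]
    nlinarith [mul_nonneg (sq_nonneg κ) (sq_nonneg ⟪V, Q⟫)]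
  rw [leadForm, abs_div, abs_of_nonneg (a := √_ ^ 3) (by positivity)]
  calc _ ≤ ‖Q‖ / (√(1 - κ ^ 2 * ‖V‖ ^ 2) * ‖Q‖) ^ 3 := by gcongr
    _ = _ := by field_simp

end LeadingPart

/-! ### Flux and oddness of the leading part on the moving surface. -/

namespace IsDoubleLayerSetting

variable {T : ℝ} {c : E3 → ℝ → ℝ} {Ωm : ℝ → Set E3} {z : S2 → ℝ → E3} {σ : ℝ}
  {η A : E3 → ℝ → E3 → ℝ → ℝ} {μ : S2 → ℝ → ℝ} {t : ℝ} {α : S2}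
  {b : OrthonormalBasis (Fin 3) ℝ E3}

lemma one_sub_sq_speed_pos (H : IsDoubleLayerSetting T c Ωm z σ η A μ) (ht : t ∈ Ico 0 T)
    (α : S2) : 0 < 1 - slowness c (z α t) t ^ 2 * ‖velocity z α t‖ ^ 2 := by
  have h1 := H.slowness_mul_speed_lt ht α
  have h2 := mul_nonneg (H.slowness_pos ht (z α t)).le (norm_nonneg (velocity z α t))
  nlinarith

lemma norm_normal (H : IsDoubleLayerSetting T c Ωm z σ η A μ) (ht : t ∈ Ico 0 T) (α : S2) :
    ‖unitNormal z σ α t‖ = 1 :=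
  norm_unitNormal H.obstacle.orientation (H.obstacle.immersion t ht α)

lemma measurable_modelKernel (c : E3 → ℝ → ℝ) (z : S2 → ℝ → E3) (σ : ℝ) (μ : S2 → ℝ → ℝ) (α : S2)
    (t ε : ℝ) : Measurable fun β : S2 => modelKernel c z σ μ α t (ε, β) := by
  have h1 : Continuous fun β : S2 => ⟪(α : E3), (β : E3)⟫ :=
    (innerSL ℝ (α : E3)).continuous.comp continuous_subtype_val
  have h2 : Continuous fun β : S2 => modelVec z σ α t (ε, β) :=
    ((continuous_const.mul h1).smul continuous_const).sub
      ((surfDeriv z α t).continuous.comp continuous_subtype_val)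
  exact (h1.measurable.inv.mul ((measurable_leadForm _ _ _).comp h2.measurable)).const_mul _

lemma modelVec_eq_frameMap (w : ℝ × S2) (H : IsDoubleLayerSetting T c Ωm z σ η A μ)
    (ht : t ∈ Ico 0 T) : modelVec z σ α t w = frameMap z σ α t
      ((w.1 * ⟪(α : E3), (w.2 : E3)⟫) • (α : E3)
        - ((w.2 : E3) - ⟪(α : E3), (w.2 : E3)⟫ • (α : E3))) := by
  rw [frameMap_apply, modelVec]
  simp only [map_sub, map_smul, surfDeriv_self H.obstacle.contDiff ht, inner_sub_right,
    real_inner_smul_right, S2.inner_self]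
  module

/-- The weight ⟪α, β⟫ on ε in `modelVec` serves this identity: central projection scales the normal
and the tangential part by the same factor. -/
lemma modelVec_gnomonic (H : IsDoubleLayerSetting T c Ωm z σ η A μ) (ht : t ∈ Ico 0 T)
    (hb : b 2 = (α : E3)) (ε : ℝ) (u : ℝ × ℝ) : modelVec z σ α t (ε, gnomonic b u)
      = (planeNorm u)⁻¹ • planeVec (unitNormal z σ α t) (surfDeriv z α t (b 0))
        (surfDeriv z α t (b 1)) ε u := by
  rw [modelVec, ← hb, inner_two_gnomonic, coe_gnomonic, map_smul, heightPt, map_add, map_add,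
    map_smul, map_smul, map_smul, hb, surfDeriv_self H.obstacle.contDiff ht, planeVec]
  module

/-- Homogeneity of degree −2 supplies `planeNorm u ^ 2` and the factor ⟪α, β⟫⁻¹ one more power,
which cancel the chart density exactly. The coefficients on the plane are then constant. -/
lemma modelKernel_gnomonic (H : IsDoubleLayerSetting T c Ωm z σ η A μ) (ht : t ∈ Ico 0 T)
    (hb : b 2 = (α : E3)) (ε : ℝ) (u : ℝ × ℝ) :
    (planeNorm u ^ 3)⁻¹ * modelKernel c z σ μ α t (ε, gnomonic b u)
      = μ α t * surfJ z α t / (4 * Real.pi) * leadForm (slowness c (z α t) t) (unitNormal z σ α t)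
        (velocity z α t) (planeVec (unitNormal z σ α t) (surfDeriv z α t (b 0))
        (surfDeriv z α t (b 1)) ε u) := by
  have h := planeNorm_pos u
  rw [modelKernel, H.modelVec_gnomonic ht hb, leadForm_smul (inv_pos.2 h), ← hb,
    inner_two_gnomonic]
  field_simp

lemma exists_le_norm_planeVec (H : IsDoubleLayerSetting T c Ωm z σ η A μ) (ht : t ∈ Ico 0 T)
    (hb : b 2 = (α : E3)) : ∃ C > 0, ∀ (ε : ℝ) (u : ℝ × ℝ), ε ^ 2 + u.2 ^ 2
      ≤ C * ‖planeVec (unitNormal z σ α t) (surfDeriv z α t (b 0)) (surfDeriv z α t (b 1)) ε u‖ ^ 2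
      := by
  obtain ⟨C, hC, h⟩ := exists_frameMap_lower_bound H.obstacle.contDiff ht H.obstacle.orientation
    (H.obstacle.immersion t ht α)
  refine ⟨C ^ 2, by positivity, fun ε u => ?_⟩
  have h1 : planeVec (unitNormal z σ α t) (surfDeriv z α t (b 0)) (surfDeriv z α t (b 1)) ε u
      = frameMap z σ α t (heightPt b (ε, -u)) := by
    rw [frameMap_apply, ← hb, inner_heightPt_two, heightPt, map_add, map_add, map_smul, map_smul,
      map_smul, hb, surfDeriv_self H.obstacle.contDiff ht, planeVec]
    simp only [Prod.fst_neg, Prod.snd_neg]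
    module
  have h2 := h (heightPt b (ε, -u))
  rw [← h1, norm_heightPt] at h2
  have h3 := pow_le_pow_left₀ (Real.sqrt_nonneg _) h2 2
  rw [Real.sq_sqrt (by positivity), mul_pow] at h3
  simp only [Prod.fst_neg, Prod.snd_neg, neg_sq] at h3
  nlinarith [sq_nonneg u.1]

/-- The form is O(1/(ε² + u₂²)), and ε² + u₂² ≥ min(ε², 1)(1 + u₂²). Since u₁ is bounded in the
strip, decay in u₂ suffices. -/
lemma integrableOn_strip_leadForm (H : IsDoubleLayerSetting T c Ωm z σ η A μ) (ht : t ∈ Ico 0 T)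
    (hb : b 2 = (α : E3)) {ε : ℝ} (hε : 0 < ε) :
    IntegrableOn (fun u => leadForm (slowness c (z α t) t) (unitNormal z σ α t)
        (velocity z α t) (planeVec (unitNormal z σ α t) (surfDeriv z α t (b 0))
        (surfDeriv z α t (b 1)) ε u)) planeStrip := by
  obtain ⟨C, hC, h⟩ := H.exists_le_norm_planeVec ht hb
  set b' := √(1 - slowness c (z α t) t ^ 2 * ‖velocity z α t‖ ^ 2) with hb'
  have hbp : 0 < b' := Real.sqrt_pos.2 (H.one_sub_sq_speed_pos ht α)
  have hm : Measurable fun u : ℝ × ℝ => leadForm (slowness c (z α t) t) (unitNormal z σ α t)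
        (velocity z α t) (planeVec (unitNormal z σ α t) (surfDeriv z α t (b 0))
        (surfDeriv z α t (b 1)) ε u) := by
    refine (measurable_leadForm _ _ _).comp (Continuous.measurable ?_)
    unfold planeVec
    fun_prop
  refine (integrableOn_strip_inv_one_add_sq.const_mul
    ((b' ^ 3)⁻¹ * (C * (min (ε ^ 2) 1)⁻¹))).mono' hm.aestronglyMeasurable
    (Eventually.of_forall fun u => ?_)
  have h1 := abs_leadForm_le (Q := planeVec (unitNormal z σ α t) (surfDeriv z α t (b 0))
        (surfDeriv z α t (b 1)) ε u) (H.one_sub_sq_speed_pos ht α) (H.norm_normal ht α)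
  have h2 := h ε u
  set q := ‖planeVec (unitNormal z σ α t) (surfDeriv z α t (b 0))
        (surfDeriv z α t (b 1)) ε u‖ ^ 2 with hq
  have hm0 : 0 < min (ε ^ 2) 1 := lt_min (by positivity) one_pos
  have h3 : min (ε ^ 2) 1 * (1 + u.2 ^ 2) ≤ ε ^ 2 + u.2 ^ 2 := by
    nlinarith [min_le_left (ε ^ 2) 1, min_le_right (ε ^ 2) 1, sq_nonneg u.2]
  have h4 : 0 < C * q := by
    have : 0 < ε ^ 2 + u.2 ^ 2 := by positivity
    linarith
  have hq0 : 0 < q := pos_of_mul_pos_right h4 hC.le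
  rw [Real.norm_eq_abs]
  refine h1.trans ?_
  rw [mul_assoc (b' ^ 3)⁻¹]
  refine mul_le_mul_of_nonneg_left ?_ (by positivity)
  rw [inv_le_comm₀ hq0 (by positivity), mul_inv, mul_inv, inv_inv, inv_inv, mul_assoc,
    inv_mul_le_iff₀ hC]
  exact h3.trans h2

lemma integrableOn_band_modelKernel (H : IsDoubleLayerSetting T c Ωm z σ η A μ)
    (ht : t ∈ Ico 0 T) (hb : b 2 = (α : E3)) {ε : ℝ} (hε : 0 < ε) :
    IntegrableOn (fun β => modelKernel c z σ μ α t (ε, β)) (band b) sphereMeasure := by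
  rw [integrableOn_band_iff (measurable_modelKernel c z σ μ α t ε)]
  simp only [H.modelKernel_gnomonic ht hb]
  exact (H.integrableOn_strip_leadForm ht hb hε).const_mul _

lemma jumpCoeff_eq (H : IsDoubleLayerSetting T c Ωm z σ η A μ) (ht : t ∈ Ico 0 T) (α : S2) :
    jumpCoeff c z σ α t
      = (1 - slowness c (z α t) t ^ 2 * ⟪unitNormal z σ α t, velocity z α t⟫ ^ 2)⁻¹ := by
  have h1 := one_sub_sq_mul_inner_pos (H.one_sub_sq_speed_pos ht α) (H.norm_normal ht α)
  have hC := H.soundSpeed.pos (z α t) t ht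
  have h2 : 0 < c (z α t) t ^ 2 - ⟪unitNormal z σ α t, velocity z α t⟫ ^ 2 := by
    have h3 : c (z α t) t ^ 2 - ⟪unitNormal z σ α t, velocity z α t⟫ ^ 2 = c (z α t) t ^ 2
        * (1 - slowness c (z α t) t ^ 2 * ⟪unitNormal z σ α t, velocity z α t⟫ ^ 2) := by
      rw [slowness]; field_simp
    rw [h3]; positivity
  have h4 : 1 - slowness c (z α t) t ^ 2 * ⟪unitNormal z σ α t, velocity z α t⟫ ^ 2
      = (c (z α t) t ^ 2 - ⟪unitNormal z σ α t, velocity z α t⟫ ^ 2) / c (z α t) t ^ 2 := by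
    rw [slowness]; field_simp
  rw [jumpCoeff, normalVelocity, h4, inv_div]
  field_simp
  ring

/-- The jump: the flux of the leading part through a band about the singularity. -/
lemma tendsto_integral_band_modelKernel (H : IsDoubleLayerSetting T c Ωm z σ η A μ)
    (ht : t ∈ Ico 0 T) (hb : b 2 = (α : E3)) (hbc : cross (b 0) (b 1) = (α : E3)) :
    Tendsto (fun ε => ∫ β in band b, modelKernel c z σ μ α t (ε, β) ∂sphereMeasure) (𝓝[>] 0)
      (𝓝 (1 / 2 * jumpCoeff c z σ α t * μ α t)) := by
  have hJ : 0 < ‖areaVector z α t‖ := norm_pos_iff.2 (H.obstacle.immersion t ht α)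
  have hσ2 : σ * σ = 1 := by rcases H.obstacle.orientation with h | h <;> rw [h] <;> norm_num
  -- The orientation sign enters through s = σJ, and the flux depends on |s| = J only.
  have ha : cross (surfDeriv z α t (b 0)) (surfDeriv z α t (b 1))
      = (σ * ‖areaVector z α t‖) • unitNormal z σ α t := by
    rw [← areaVector_eq_cross H.obstacle.contDiff ht hbc, unitNormal, smul_smul, smul_smul,
      show σ * ‖areaVector z α t‖ * σ * ‖areaVector z α t‖⁻¹ = 1 by
        rw [mul_right_comm, mul_inv_cancel_right₀ hJ.ne', hσ2], one_smul]
  have hσ : |σ| = 1 := by rcases H.obstacle.orientation with h | h <;> rw [h] <;> norm_num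
  have hs : σ * ‖areaVector z α t‖ ≠ 0 := by
    rw [← abs_pos, abs_mul, hσ, one_mul, abs_norm]; exact hJ
  have hP := H.one_sub_sq_speed_pos ht α
  have hN := H.norm_normal ht α
  have h1 := (tendsto_setIntegral_strip_leadForm hP hN hs ha
    (inner_unitNormal_surfDeriv H.obstacle.contDiff ht _)
    (inner_unitNormal_surfDeriv H.obstacle.contDiff ht _)
    (fun ε hε => H.integrableOn_strip_leadForm ht hb hε)).const_mul
      (μ α t * surfJ z α t / (4 * Real.pi))
  have hp := one_sub_sq_mul_inner_pos hP hN
  have h2 : μ α t * surfJ z α t / (4 * Real.pi) * (2 * Real.pi / (|σ * ‖areaVector z α t‖|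
      * (1 - slowness c (z α t) t ^ 2 * ⟪unitNormal z σ α t, velocity z α t⟫ ^ 2)))
      = 1 / 2 * jumpCoeff c z σ α t * μ α t := by
    rw [H.jumpCoeff_eq ht, abs_mul, hσ, one_mul, abs_norm, surfJ]
    field_simp
    norm_num
  rw [h2] at h1
  refine h1.congr fun ε => ?_
  rw [integral_band (measurable_modelKernel c z σ μ α t ε), ← integral_const_mul]
  simp only [H.modelKernel_gnomonic ht hb]

/-- The leading part at the boundary is odd in the gnomonic chart. -/
lemma integral_band_far_modelKernel (H : IsDoubleLayerSetting T c Ωm z σ η A μ)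
    (ht : t ∈ Ico 0 T) (hb : b 2 = (α : E3)) (ρ : ℝ) :
    ∫ β in {β : S2 | ρ < dist β α} ∩ band b, modelKernel c z σ μ α t (0, β) ∂sphereMeasure = 0 := by
  have hS : MeasurableSet {β : S2 | ρ < dist β α} :=
    (isOpen_lt continuous_const (continuous_id.dist continuous_const)).measurableSet
  rw [inter_comm, ← setIntegral_indicator hS,
    integral_band ((measurable_modelKernel c z σ μ α t 0).indicator hS),
    ← integral_indicator (measurableSet_Ioo.prod MeasurableSet.univ)]
  set g : ℝ × ℝ → ℝ := planeStrip.indicator fun u => (planeNorm u ^ 3)⁻¹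
    * {β : S2 | ρ < dist β α}.indicator (fun β => modelKernel c z σ μ α t (0, β)) (gnomonic b u)
    with hg
  have hodd : ∀ u, g (-u) = -g u := by
    intro u
    have hn : planeNorm (-u) = planeNorm u := by simp [planeNorm]
    -- The distance to α depends on `planeNorm u` alone, so the truncation is symmetric under u ↦
    -- −u; so is the strip.
    have hd : dist (gnomonic b (-u)) α = dist (gnomonic b u) α := by
      rw [Subtype.dist_eq, Subtype.dist_eq, dist_eq_norm, dist_eq_norm,
        ← sq_eq_sq₀ (norm_nonneg _) (norm_nonneg _), dist_sq_eq, dist_sq_eq, ← hb,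
        inner_two_gnomonic, inner_two_gnomonic, hn]
    have hk := H.modelKernel_gnomonic (μ := μ) ht hb 0 (-u)
    have hv : planeVec (unitNormal z σ α t) (surfDeriv z α t (b 0)) (surfDeriv z α t (b 1)) 0 (-u)
        = -planeVec (unitNormal z σ α t) (surfDeriv z α t (b 0)) (surfDeriv z α t (b 1)) 0 u := by
      simp only [planeVec, Prod.fst_neg, Prod.snd_neg]
      module
    rw [hv, leadForm_neg, mul_neg, ← H.modelKernel_gnomonic ht hb] at hk
    have hs : -u ∈ planeStrip ↔ u ∈ planeStrip := by
      simp only [mem_prod, mem_Ioo, mem_univ, and_true, Prod.fst_neg]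
      constructor <;> rintro ⟨h1, h2⟩ <;> constructor <;> linarith
    simp only [hg, indicator, hs, mem_ofPred_eq, hd]
    split_ifs
    · exact hk
    · simp
    · simp
  have h1 := integral_neg_eq_self g volume
  simp only [hodd, integral_neg] at h1
  linarith

end IsDoubleLayerSetting

/-! ### Dominated convergence and the exterior trace -/

lemma sphereMeasure_singleton (α : S2) : sphereMeasure {α} = 0 := by
  obtain ⟨b, hb, -⟩ := exists_oriented_basis α
  have hα : α ∈ {β : S2 | 0 < ⟪b 2, (β : E3)⟫} := by
    rw [mem_ofPred_eq, hb, S2.inner_self]; exact one_pos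
  have hm : MeasurableSet ({α} : Set S2) := measurableSet_singleton α
  rw [← Measure.restrict_eq_self sphereMeasure (singleton_subset_iff.2 hα),
    sphereMeasure_hemisphere, Measure.map_apply (measurable_gnomonic b) hm]
  refine withDensity_absolutelyContinuous _ _ (measure_mono_null (t := {0}) (fun u hu => ?_)
    (measure_singleton _))
  have h1 := norm_le_norm_gnomonic_sub u α hb
  rw [mem_preimage, mem_singleton_iff] at hu
  rw [hu, sub_self, norm_zero] at h1
  have h2 := inv_pos.2 (planeNorm_pos u)
  exact norm_le_zero_iff.1 (nonpos_of_mul_nonpos_right h1 h2)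

lemma ae_ne_sphereMeasure (α : S2) : ∀ᵐ β ∂sphereMeasure, β ≠ α :=
  compl_mem_ae_iff.2 (sphereMeasure_singleton α)

namespace IsDoubleLayerSetting

variable {T : ℝ} {c : E3 → ℝ → ℝ} {Ωm : ℝ → Set E3} {z : S2 → ℝ → E3} {σ : ℝ}
  {η A : E3 → ℝ → E3 → ℝ → ℝ} {μ : S2 → ℝ → ℝ} {t : ℝ} {α : S2}
  {b : OrthonormalBasis (Fin 3) ℝ E3}

/-- The bound is uniform in ε because the normal part is orthogonal to the tangential one before the
frame map is applied. The tangential part has square norm 1 − ⟪α, β⟫² ≥ 1 − ⟪α, β⟫ = |β − α|²/2 on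
the hemisphere. -/
lemma exists_le_norm_modelVec (H : IsDoubleLayerSetting T c Ωm z σ η A μ) (ht : t ∈ Ico 0 T)
    (α : S2) : ∃ C > 0, ∀ (ε : ℝ) (β : S2), 0 < ⟪(α : E3), (β : E3)⟫ →
      ‖(β : E3) - α‖ ^ 2 ≤ C * ‖modelVec z σ α t (ε, β)‖ ^ 2 := by
  obtain ⟨C, hC, h⟩ := exists_frameMap_lower_bound H.obstacle.contDiff ht H.obstacle.orientation
    (H.obstacle.immersion t ht α)
  refine ⟨2 * C ^ 2, by positivity, fun ε β hβ => ?_⟩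
  have h1 := pow_le_pow_left₀ (norm_nonneg _) (h ((ε * ⟪(α : E3), (β : E3)⟫) • (α : E3)
        - ((β : E3) - ⟪(α : E3), (β : E3)⟫ • (α : E3)))) 2
  rw [← modelVec_eq_frameMap (ε, β) H ht, mul_pow, ← real_inner_self_eq_norm_sq] at h1
  simp only [inner_sub_left, inner_sub_right, real_inner_smul_left, real_inner_smul_right,
    S2.inner_self, real_inner_comm (α : E3) (β : E3)] at h1
  have h2 := dist_sq_eq α β
  have h3 : 0 ≤ ‖(β : E3) - α‖ ^ 2 := sq_nonneg _
  nlinarith [sq_nonneg (ε * ⟪(α : E3), (β : E3)⟫)]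

lemma exists_abs_modelKernel_le (H : IsDoubleLayerSetting T c Ωm z σ η A μ) (ht : t ∈ Ico 0 T)
    (α : S2) : ∃ C ≥ 0, ∀ (ε : ℝ) (β : S2), β ≠ α → 0 < ⟪(α : E3), (β : E3)⟫ →
      |modelKernel c z σ μ α t (ε, β)| ≤ C * (⟪(α : E3), (β : E3)⟫⁻¹ * (‖(β : E3) - α‖ ^ 2)⁻¹) := by
  obtain ⟨C, hC, h⟩ := H.exists_le_norm_modelVec ht α
  set s := √(1 - slowness c (z α t) t ^ 2 * ‖velocity z α t‖ ^ 2) with hs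
  refine ⟨|μ α t * surfJ z α t / (4 * Real.pi)| * ((s ^ 3)⁻¹ * C), by positivity,
    fun ε β hβ hp => ?_⟩
  have h1 := abs_leadForm_le (Q := modelVec z σ α t (ε, β)) (H.one_sub_sq_speed_pos ht α)
    (H.norm_normal ht α)
  have h2 := h ε β hp
  have h3 : 0 < ‖(β : E3) - α‖ ^ 2 := by
    have := norm_pos_iff.2 (sub_ne_zero.2 (Subtype.coe_injective.ne hβ))
    positivity
  set q := ‖modelVec z σ α t (ε, β)‖ ^ 2
  have hq : 0 < q := pos_of_mul_pos_right (h3.trans_le h2) hC.le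
  have h4 : q⁻¹ ≤ C * (‖(β : E3) - α‖ ^ 2)⁻¹ := by
    rw [inv_le_comm₀ hq (by positivity), mul_inv, inv_inv, inv_mul_le_iff₀ hC]
    exact h2
  rw [modelKernel, abs_mul, abs_mul, abs_of_pos (inv_pos.2 hp)]
  calc _ ≤ |μ α t * surfJ z α t / (4 * Real.pi)| * (⟪(α : E3), (β : E3)⟫⁻¹
        * ((s ^ 3)⁻¹ * (C * (‖(β : E3) - α‖ ^ 2)⁻¹))) := by
        gcongr
        exact h1.trans (mul_le_mul_of_nonneg_left h4 (by positivity))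
    _ = _ := by ring

/-- The density minus its leading part in a band about the singularity. -/
noncomputable def regularPart (c : E3 → ℝ → ℝ) (z : S2 → ℝ → E3) (σ : ℝ)
    (η A : E3 → ℝ → E3 → ℝ → ℝ) (μ : S2 → ℝ → ℝ) (b : OrthonormalBasis (Fin 3) ℝ E3) (α : S2)
    (t ε : ℝ) (β : S2) : ℝ :=
  doubleLayerDensity z σ η A μ (obsPt z σ α t ε) t β
    - (band b).indicator (fun β => modelKernel c z σ μ α t (ε, β)) β

lemma continuousOn_density_obsPt (H : IsDoubleLayerSetting T c Ωm z σ η A μ) (ht : t ∈ Ioo 0 T)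
    (α : S2) : ContinuousOn (fun w : ℝ × S2 => doubleLayerDensity z σ η A μ (obsPt z σ α t w.1) t w.2)
      {w | obsPt z σ α t w.1 ≠ z w.2 t} := by
  have h1 : Continuous fun w : ℝ × S2 => (obsPt z σ α t w.1, w.2) :=
    (continuous_obsPt.comp continuous_fst).prodMk continuous_snd
  exact (H.continuousOn_doubleLayerDensity ht).comp h1.continuousOn fun w hw => hw

lemma continuousOn_density (H : IsDoubleLayerSetting T c Ωm z σ η A μ) (ht : t ∈ Ioo 0 T)
    (x : E3) : ContinuousOn (doubleLayerDensity z σ η A μ x t) {β | x ≠ z β t} := by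
  have h1 : Continuous fun β : S2 => (x, β) := by fun_prop
  exact (H.continuousOn_doubleLayerDensity ht).comp h1.continuousOn fun w hw => hw

/-- Near α this is the comparison with the model kernel. Away from α the density is bounded by
compactness, and the model kernel is controlled by ⟪b 2, β⟫⁻¹, which accounts for the edge of the
band at the equator. -/
lemma exists_abs_regularPart_le (H : IsDoubleLayerSetting T c Ωm z σ η A μ) (ht : t ∈ Ioo 0 T)
    (hb : b 2 = (α : E3)) : ∃ C, ∃ ε₀ > 0, ∀ ε ∈ Icc 0 ε₀, ∀ β ≠ α,
      |regularPart c z σ η A μ b α t ε β| ≤ C * (‖(β : E3) - α‖⁻¹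
        + (band b).indicator (fun β : S2 => ⟪b 2, (β : E3)⟫⁻¹) β) := by
  have ht' : t ∈ Ico 0 T := ⟨ht.1.le, ht.2⟩
  have hαb : α ∈ band b := by
    have h1 : ⟪b 0, (α : E3)⟫ = 0 := by rw [← hb]; simp [b.inner_eq_ite]
    rw [band, mem_ofPred_eq, h1, hb, S2.inner_self]
    norm_num
  obtain ⟨C₁, hC₁, h1⟩ := (H.isBigO_density_sub_model (α := α) ht).exists_pos
  rw [Asymptotics.isBigOWith_iff, approach, eventually_nhdsWithin_iff] at h1
  have h2 : ∀ᶠ w : ℝ × S2 in 𝓝 (0, α), w.2 ∈ band b :=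
    continuous_snd.continuousAt.eventually ((isOpen_band b).mem_nhds hαb)
  obtain ⟨δ, hδ, h3⟩ := Metric.eventually_nhds_iff.1 (h1.and h2)
  obtain ⟨ε₁, hε₁, h4⟩ := H.exists_obsPt_ne ht' α
  set K : Set (ℝ × S2) := Icc 0 ε₁ ×ˢ {β | δ ≤ dist β α} with hK
  have hKc : IsCompact K := by
    refine isCompact_Icc.prod (IsClosed.isCompact ?_)
    exact isClosed_le continuous_const (continuous_id.dist continuous_const)
  obtain ⟨M, hM⟩ := hKc.exists_bound_of_continuousOn
    ((H.continuousOn_density_obsPt ht α).mono fun w hw => h4 w.1 hw.1 w.2 fun h => by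
      have h5 : δ ≤ dist w.2 α := hw.2
      rw [(Prod.ext_iff.1 h).2, dist_self] at h5
      exact hδ.not_ge h5)
  obtain ⟨C₂, hC₂, h5⟩ := H.exists_abs_modelKernel_le (μ := μ) ht' α
  -- The summands come from the near part, the far density and the far model kernel; ε ≤ δ/2 keeps
  -- (ε, β) in the δ-ball when β is close to α.
  refine ⟨C₁ + 2 * |M| + C₂ * (δ ^ 2)⁻¹, min ε₁ (δ / 2), lt_min hε₁ (by positivity),
    fun ε hε β hβ => ?_⟩
  have hr : 0 < ‖(β : E3) - α‖ := norm_pos_iff.2 (sub_ne_zero.2 (Subtype.coe_injective.ne hβ))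
  have hχ : 0 ≤ (band b).indicator (fun β : S2 => ⟪b 2, (β : E3)⟫⁻¹) β :=
    indicator_nonneg (fun β hβ => (inv_pos.2 hβ.1).le) β
  set X := (band b).indicator (fun β : S2 => ⟪b 2, (β : E3)⟫⁻¹) β with hX
  by_cases hd : dist β α < δ
  · have hw : dist (ε, β) ((0 : ℝ), α) < δ := by
      rw [Prod.dist_eq, max_lt_iff]
      refine ⟨?_, hd⟩
      rw [Real.dist_eq, sub_zero, abs_of_nonneg hε.1]
      linarith [hε.2.trans (min_le_right _ _)]
    obtain ⟨h6, h7⟩ := h3 hw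
    have h8 := h6 ⟨hε.1, fun h => hβ (Prod.ext_iff.1 h).2⟩
    rw [regularPart, indicator_of_mem h7]
    simp only [Real.norm_eq_abs] at h8
    rw [abs_of_nonneg (a := (_)⁻¹) (inv_nonneg.2 (add_nonneg hε.1 hr.le))] at h8
    have h9 : (ε + ‖(β : E3) - α‖)⁻¹ ≤ ‖(β : E3) - α‖⁻¹ :=
      inv_anti₀ hr (le_add_of_nonneg_left hε.1)
    calc _ ≤ C₁ * (ε + ‖(β : E3) - α‖)⁻¹ := h8
      _ ≤ C₁ * ‖(β : E3) - α‖⁻¹ := by gcongr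
      _ ≤ (C₁ + 2 * |M| + C₂ * (δ ^ 2)⁻¹) * (‖(β : E3) - α‖⁻¹ + X) := by
        gcongr
        · have : 0 ≤ 2 * |M| + C₂ * (δ ^ 2)⁻¹ := by positivity
          linarith
        · linarith
  · rw [not_lt] at hd
    have hd' : δ ≤ ‖(β : E3) - α‖ := by rwa [Subtype.dist_eq, dist_eq_norm] at hd
    have h6 : |doubleLayerDensity z σ η A μ (obsPt z σ α t ε) t β| ≤ M :=
      hM (ε, β) ⟨⟨hε.1, hε.2.trans (min_le_left _ _)⟩, hd⟩
    have h7 : |(band b).indicator (fun β => modelKernel c z σ μ α t (ε, β)) β|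
        ≤ C₂ * (δ ^ 2)⁻¹ * X := by
      by_cases hβb : β ∈ band b
      · rw [hX, indicator_of_mem hβb, indicator_of_mem hβb]
        have hp := hβb.1
        rw [hb] at hp ⊢
        refine (h5 ε β hβ hp).trans ?_
        have := inv_pos.2 hp
        calc C₂ * (⟪(α : E3), (β : E3)⟫⁻¹ * (‖(β : E3) - α‖ ^ 2)⁻¹)
            ≤ C₂ * (⟪(α : E3), (β : E3)⟫⁻¹ * (δ ^ 2)⁻¹) := by gcongr
          _ = _ := by ring
      · rw [indicator_of_notMem hβb, abs_zero]
        positivity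
    -- The sphere has diameter 2, so a constant is dominated by a multiple of |β − α|⁻¹.
    have h8 : (1 : ℝ) ≤ 2 * ‖(β : E3) - α‖⁻¹ := by
      rw [← div_eq_mul_inv, one_le_div hr]
      have := norm_sub_le (β : E3) α
      rw [S2.norm_coe, S2.norm_coe] at this
      linarith
    have h9 : M ≤ 2 * |M| * ‖(β : E3) - α‖⁻¹ := by
      nlinarith [le_abs_self M, abs_nonneg M]
    have h10 := abs_sub (doubleLayerDensity z σ η A μ (obsPt z σ α t ε) t β)
      ((band b).indicator (fun β => modelKernel c z σ μ α t (ε, β)) β)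
    have e1 : 0 ≤ C₂ * (δ ^ 2)⁻¹ * ‖(β : E3) - α‖⁻¹ := by positivity
    have e2 : 0 ≤ 2 * |M| * X := by positivity
    have e3 : 0 ≤ C₁ * (‖(β : E3) - α‖⁻¹ + X) := by positivity
    rw [regularPart]
    nlinarith

lemma measurable_density_obsPt (H : IsDoubleLayerSetting T c Ωm z σ η A μ) (ht : t ∈ Ioo 0 T)
    {ε : ℝ} (hε : ∀ β ≠ α, obsPt z σ α t ε ≠ z β t) :
    Measurable (doubleLayerDensity z σ η A μ (obsPt z σ α t ε) t) :=
  measurable_of_continuousOn_compl_singleton α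
    ((H.continuousOn_density ht _).mono fun β hβ => hε β hβ)

lemma tendsto_regularPart (H : IsDoubleLayerSetting T c Ωm z σ η A μ) (ht : t ∈ Ioo 0 T)
    (hb : b 2 = (α : E3)) {β : S2} (hβ : β ≠ α) :
    Tendsto (fun ε => regularPart c z σ η A μ b α t ε β) (𝓝[>] 0)
      (𝓝 (regularPart c z σ η A μ b α t 0 β)) := by
  have ht' : t ∈ Ico 0 T := ⟨ht.1.le, ht.2⟩
  obtain ⟨ε₁, hε₁, h4⟩ := H.exists_obsPt_ne ht' α
  have hI : ∀ᶠ ε in 𝓝[>] (0 : ℝ), ε ∈ Icc 0 ε₁ := by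
    filter_upwards [Ioo_mem_nhdsGT hε₁] with ε hε using ⟨hε.1.le, hε.2.le⟩
  unfold regularPart
  refine Tendsto.sub ?_ ?_
  · have h1 : Tendsto (fun w : ℝ × S2 => doubleLayerDensity z σ η A μ (obsPt z σ α t w.1) t w.2)
        (𝓝[{w | obsPt z σ α t w.1 ≠ z w.2 t}] (0, β))
        (𝓝 (doubleLayerDensity z σ η A μ (obsPt z σ α t 0) t β)) :=
      (H.continuousOn_density_obsPt ht α (0, β)
        (h4 0 ⟨le_rfl, hε₁.le⟩ β fun h => hβ (Prod.ext_iff.1 h).2)).tendsto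
    have h2 : Tendsto (fun ε : ℝ => (ε, β)) (𝓝[>] 0)
        (𝓝[{w | obsPt z σ α t w.1 ≠ z w.2 t}] (0, β)) := by
      refine tendsto_nhdsWithin_iff.2 ⟨?_, ?_⟩
      · have h3 : Continuous fun ε : ℝ => (ε, β) := by fun_prop
        exact (h3.tendsto 0).mono_left nhdsWithin_le_nhds
      · filter_upwards [hI] with ε hε using h4 ε hε β fun h => hβ (Prod.ext_iff.1 h).2
    have h3 := Tendsto.comp h1 h2
    simpa only [Function.comp_def] using h3
  · by_cases hβb : β ∈ band b
    · simp only [indicator_of_mem hβb]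
      have hp := hβb.1
      rw [hb] at hp
      obtain ⟨C, hC, h1⟩ := H.exists_le_norm_modelVec ht' α
      have hr : 0 < ‖(β : E3) - α‖ := norm_pos_iff.2 (sub_ne_zero.2 (Subtype.coe_injective.ne hβ))
      have h2 : modelVec z σ α t (0, β) ≠ 0 := by
        intro h0
        have h3 := h1 0 β hp
        rw [h0, norm_zero] at h3
        nlinarith [pow_pos hr 2]
      have h3 : Continuous fun ε : ℝ => modelVec z σ α t (ε, β) := by
        unfold modelVec; fun_prop
      have h5 : ContinuousAt (fun ε : ℝ => modelKernel c z σ μ α t (ε, β)) 0 := by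
        have h6 : ContinuousAt (fun ε : ℝ => leadForm (slowness c (z α t) t)
            (unitNormal z σ α t) (velocity z α t) (modelVec z σ α t (ε, β))) 0 :=
          ContinuousAt.comp (f := fun ε : ℝ => modelVec z σ α t (ε, β)) (x := (0 : ℝ))
            (continuousAt_leadForm (H.one_sub_sq_speed_pos ht' α) h2) h3.continuousAt
        exact continuousAt_const.mul (continuousAt_const.mul h6)
      exact h5.tendsto.mono_left nhdsWithin_le_nhds
    · simp only [indicator_of_notMem hβb]
      exact tendsto_const_nhds

lemma integrable_density (H : IsDoubleLayerSetting T c Ωm z σ η A μ) (ht : t ∈ Ioo 0 T) {x : E3}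
    (hx : ∀ β, x ≠ z β t) : Integrable (doubleLayerDensity z σ η A μ x t) sphereMeasure := by
  have h1 : Continuous (doubleLayerDensity z σ η A μ x t) := by
    rw [← continuousOn_univ]
    exact (H.continuousOn_density ht x).mono fun β _ => hx β
  rw [← integrableOn_univ]
  exact h1.continuousOn.integrableOn_compact isCompact_univ

lemma integrableOn_density_far (H : IsDoubleLayerSetting T c Ωm z σ η A μ) (ht : t ∈ Ioo 0 T)
    (α : S2) {ρ : ℝ} (hρ : 0 < ρ) :
    IntegrableOn (doubleLayerDensity z σ η A μ (z α t) t) {β | ρ < dist β α} sphereMeasure := by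
  have hc : IsCompact {β : S2 | ρ ≤ dist β α} :=
    (isClosed_le continuous_const (continuous_id.dist continuous_const)).isCompact
  refine (ContinuousOn.integrableOn_compact hc ((H.continuousOn_density ht _).mono
    fun β hβ h => ?_)).mono_set fun β (hβ : ρ < dist β α) => hβ.le
  have h1 : α = β := H.obstacle.injective t ⟨ht.1.le, ht.2⟩ h
  have h2 : ρ ≤ dist β α := hβ
  rw [h1, dist_self] at h2
  exact hρ.not_ge h2

/-- The exterior trace of the double-layer potential and its principal value. -/
lemma exists_principalValue_and_trace (H : IsDoubleLayerSetting T c Ωm z σ η A μ)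
    (ht : t ∈ Ioo 0 T) (α : S2) : ∃ D : ℝ, IsPrincipalValue z σ η A μ α t D ∧
      Tendsto (fun ε : ℝ => doubleLayer z σ η A μ (obsPt z σ α t ε) t) (𝓝[>] 0)
        (𝓝 (1 / 2 * jumpCoeff c z σ α t * μ α t + D)) := by
  have ht' : t ∈ Ico 0 T := ⟨ht.1.le, ht.2⟩
  obtain ⟨b, hb, hbc⟩ := exists_oriented_basis α
  obtain ⟨C, ε₀, hε₀, hbound⟩ := H.exists_abs_regularPart_le ht hb
  obtain ⟨ε₁, hε₁, hne⟩ := H.exists_obsPt_ne ht' α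
  have hband := (isOpen_band b).measurableSet
  have hdom : Integrable (fun β : S2 => C * (‖(β : E3) - α‖⁻¹
        + (band b).indicator (fun β : S2 => ⟪b 2, (β : E3)⟫⁻¹) β)) sphereMeasure :=
    ((integrable_inv_norm_sub α).add
      (integrableOn_band_inv_inner.integrable_indicator hband)).const_mul C
  have hmeas : ∀ ε ∈ Icc 0 ε₁, AEStronglyMeasurable (regularPart c z σ η A μ b α t ε)
      sphereMeasure := fun ε hε =>
    ((H.measurable_density_obsPt ht fun β hβ => hne ε hε β fun h => hβ (Prod.ext_iff.1 h).2).sub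
      ((measurable_modelKernel c z σ μ α t ε).indicator hband)).aestronglyMeasurable
  have hI : ∀ᶠ ε in 𝓝[>] (0 : ℝ), 0 < ε ∧ ε ∈ Icc 0 ε₁ ∧ ε ∈ Icc 0 ε₀ := by
    filter_upwards [Ioo_mem_nhdsGT (lt_min hε₁ hε₀)] with ε hε
    exact ⟨hε.1, ⟨hε.1.le, hε.2.le.trans (min_le_left _ _)⟩,
      ⟨hε.1.le, hε.2.le.trans (min_le_right _ _)⟩⟩
  have hlim : Tendsto (fun ε => ∫ β, regularPart c z σ η A μ b α t ε β ∂sphereMeasure) (𝓝[>] 0)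
      (𝓝 (∫ β, regularPart c z σ η A μ b α t 0 β ∂sphereMeasure)) := by
    refine tendsto_integral_filter_of_dominated_convergence _ ?_ ?_ hdom ?_
    · filter_upwards [hI] with ε hε using hmeas ε hε.2.1
    · filter_upwards [hI] with ε hε
      filter_upwards [ae_ne_sphereMeasure α] with β hβ using hbound ε hε.2.2 β hβ
    · filter_upwards [ae_ne_sphereMeasure α] with β hβ using H.tendsto_regularPart ht hb hβ
  have hint0 : Integrable (regularPart c z σ η A μ b α t 0) sphereMeasure := by
    refine hdom.mono' (hmeas 0 ⟨le_rfl, hε₁.le⟩) ?_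
    filter_upwards [ae_ne_sphereMeasure α] with β hβ using hbound 0 ⟨le_rfl, hε₀.le⟩ β hβ
  -- The regular part at ε = 0 is absolutely integrable; its integral is the principal value,
  -- because the truncated integrals of the odd leading part vanish.
  refine ⟨∫ β, regularPart c z σ η A μ b α t 0 β ∂sphereMeasure,
    ⟨fun ρ hρ => H.integrableOn_density_far ht α hρ, ?_⟩, ?_⟩
  · have hS : ∀ ρ : ℝ, MeasurableSet {β : S2 | ρ < dist β α} := fun ρ =>
      (isOpen_lt continuous_const (continuous_id.dist continuous_const)).measurableSet
    have h1 : Tendsto (fun ρ : ℝ => ∫ β, {β : S2 | ρ < dist β α}.indicator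
        (regularPart c z σ η A μ b α t 0) β ∂sphereMeasure) (𝓝[>] 0)
        (𝓝 (∫ β, regularPart c z σ η A μ b α t 0 β ∂sphereMeasure)) := by
      refine tendsto_integral_filter_of_dominated_convergence _ ?_ ?_ hint0.norm ?_
      · exact Eventually.of_forall fun ρ => hint0.aestronglyMeasurable.indicator (hS ρ)
      · exact Eventually.of_forall fun ρ => Eventually.of_forall fun β =>
          norm_indicator_le_norm_self _ _
      · filter_upwards [ae_ne_sphereMeasure α] with β hβ
        refine tendsto_const_nhds.congr' ?_
        filter_upwards [Ioo_mem_nhdsGT (dist_pos.2 hβ)] with ρ hρ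
        exact (indicator_of_mem (s := {β : S2 | ρ < dist β α}) hρ.2 _).symm
    refine h1.congr' ?_
    filter_upwards [self_mem_nhdsWithin] with ρ hρ
    have h2 := H.integrableOn_density_far (A := A) ht α hρ
    have h3 : ∫ β in {β : S2 | ρ < dist β α}, (band b).indicator
        (fun β => modelKernel c z σ μ α t (0, β)) β ∂sphereMeasure = 0 := by
      rw [setIntegral_indicator hband, H.integral_band_far_modelKernel ht' hb]
    have h4 : ∀ β, (band b).indicator (fun β => modelKernel c z σ μ α t (0, β)) β
        = doubleLayerDensity z σ η A μ (z α t) t β - regularPart c z σ η A μ b α t 0 β := by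
      intro β
      rw [regularPart, obsPt_zero]
      ring
    simp only [h4] at h3
    rw [integral_sub h2 hint0.integrableOn] at h3
    rw [integral_indicator (hS ρ)]
    linarith
  -- For ε > 0 both the density and the model kernel on the band are integrable, so the potential
  -- splits into the flux, which yields the jump, and the regular part.
  · have h1 := (H.tendsto_integral_band_modelKernel ht' hb hbc).add hlim
    refine h1.congr' ?_
    filter_upwards [hI] with ε hε
    have h2 : Integrable (doubleLayerDensity z σ η A μ (obsPt z σ α t ε) t) sphereMeasure :=
      H.integrable_density ht fun β => hne ε hε.2.1 β fun h => hε.1.ne' (Prod.ext_iff.1 h).1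
    have h3 := H.integrableOn_band_modelKernel (μ := μ) ht' hb hε.1
    simp only [regularPart, doubleLayer]
    rw [integral_sub h2 (h3.integrable_indicator hband), integral_indicator hband]
    ring

end IsDoubleLayerSetting

/-! ### The exterior trace formula. -/

theorem mainTheorem1 (T : ℝ) (c : E3 → ℝ → ℝ) (Ωm : ℝ → Set E3) (z : S2 → ℝ → E3) (σ : ℝ)
    (η A : E3 → ℝ → E3 → ℝ → ℝ) (μ : S2 → ℝ → ℝ)
    (hc : IsSoundSpeed T c) (hz : IsMovingObstacle T Ωm z σ) (hsub : Subsonic T c z σ)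
    (hη : IsTravelTime T c z η) (hA : IsAmplitude T c A) (hμ : IsCausalDensity T μ)
    (α : S2) (t : ℝ) (ht : t ∈ Ioo 0 T) :
    (∀ᶠ ε in 𝓝[>] (0 : ℝ), z α t + ε • unitNormal z σ α t ∈ exterior Ωm t ∧
      Integrable (doubleLayerDensity z σ η A μ (z α t + ε • unitNormal z σ α t) t)
        sphereMeasure) ∧
    ∃ D : ℝ, IsPrincipalValue z σ η A μ α t D ∧
      Tendsto (fun ε : ℝ => doubleLayer z σ η A μ (z α t + ε • unitNormal z σ α t) t)
        (𝓝[>] 0) (𝓝 (1 / 2 * jumpCoeff c z σ α t * μ α t + D)) := by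
  have H : IsDoubleLayerSetting T c Ωm z σ η A μ := ⟨hc, hz, hsub, hη, hA, hμ⟩
  have ht' : t ∈ Ico 0 T := ⟨ht.1.le, ht.2⟩
  refine ⟨?_, H.exists_principalValue_and_trace ht α⟩
  filter_upwards [hz.outward t ht' α] with ε hε
  refine ⟨hε.1, H.integrable_density ht fun β hβ => hε.1 (frontier_subset_closure ?_)⟩
  rw [hz.frontier_eq t ht', hβ]
  exact mem_range_self β
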